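/- Fix an integer $d\ge 1$. For $N\ge 2$ let $V_N=\{0,1,\dots,N-1\}^d$, let $|\cdot|$ be the Euclidean norm, let $\log_+x=\max(\log x,0)$ (with $\log_+0=0$), and put $$m_N=\sqrt{2d}\,\log N-\frac{3}{2\sqrt{2d}}\log\log N,\qquad n=\log_2 N .$$ For every $\alpha_0>0$ there is a constant $C>0$, depending only on $\alpha_0$ and $d$, such that the following holds for every integer $N\ge2$ and every centered Gaussian field $\{\varphi_{N,v}:v\in V_N\}$ which satisfies assumption (A.0) with constant $\alpha_0$, that is, for all $u,v\in V_N$, $$\operatorname{Var}\varphi_{N,v}\le \log N+\alpha_0,\qquad \mathbb E(\varphi_{N,v}-\varphi_{N,u})^2\le 2\log_+|u-v|-|\operatorname{Var}\varphi_{N,v}-\operatorname{Var}\varphi_{N,u}|+4\alpha_0 .$$ With $M_N=\max_{v\in V_N}\varphi_{N,v}$, for all real $z\ge1$, $$\mathbb P(M_N\ge m_N+z)\le C\,z\,e^{-\sqrt{2d}\,z}\,e^{-C^{-1}z^2/n};$$ and for all real $z\ge1$, $y\ge0$ and every subset $A\subseteq V_N$, $$\mathbb P\Big(\max_{v\in A}\varphi_{N,v}\ge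 m_N+z-y\Big)\le C\Big(\frac{|A|}{|V_N|}\Big)^{1/2}z\,e^{-\sqrt{2d}\,(z-y)}$$ (the maximum over the empty set being $-\infty$). -/

import Mathlib

open MeasureTheory ProbabilityTheory

noncomputable section

namespace LogCorrelated

/-- The box `V_N = {0, …, N - 1}^d` of side length `N`. -/
abbrev Box (d N : ℕ) : Type := Fin d → Fin N

/-- The Euclidean distance `|u - v|` between two points of the box. -/
def eucDist {d N : ℕ} (u v : Box d N) : ℝ :=
  ‖(WithLp.toLp 2 (fun i => ((u i : ℕ) : ℝ) - ((v i : ℕ) : ℝ)) : EuclideanSpace ℝ (Fin d))‖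

/-- A centered, jointly Gaussian family of real random variables indexed by the box
(degenerate Gaussian laws are allowed). -/
structure IsCenteredGaussianField {d N : ℕ} {Ω : Type*} [MeasurableSpace Ω]
    (φ : Box d N → Ω → ℝ) (P : Measure Ω) : Prop where
  gaussian : IsGaussianProcess φ P
  centered : ∀ v, ∫ ω, φ v ω ∂P = 0

/-- The field is logarithmically bounded with constant `α₀`. Here `Real.posLog x = max 0 (log x)`
(so its value at `0` is `0`). -/
structure IsLogBounded {d N : ℕ} {Ω : Type*} [MeasurableSpace Ω]
    (α₀ : ℝ) (φ : Box d N → Ω → ℝ) (P : Measure Ω) : Prop where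
  variance_le : ∀ v, variance (φ v) P ≤ Real.log N + α₀
  increment_le : ∀ u v,
    ∫ ω, (φ v ω - φ u ω) ^ 2 ∂P
      ≤ 2 * Real.posLog (eucDist u v) - |variance (φ v) P - variance (φ u) P| + 4 * α₀

/-- The maximum of the field over a set `A` of vertices, with value `-∞` if `A` is empty. -/
def maxOver {d N : ℕ} {Ω : Type*} (φ : Box d N → Ω → ℝ) (A : Finset (Box d N)) (ω : Ω) : EReal :=
  A.sup (fun v => (φ v ω : EReal))

/-- The maximum `M_N` of the field over the whole box. -/
def boxMax {d N : ℕ} {Ω : Type*} (φ : Box d N → Ω → ℝ) (ω : Ω) : EReal :=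
  maxOver φ Finset.univ ω

/-- The centering `m_N = √(2d) log N - (3 / (2 √(2d))) log log N`. -/
def centering (d N : ℕ) : ℝ :=
  Real.sqrt (2 * d) * Real.log N - 3 / (2 * Real.sqrt (2 * d)) * Real.log (Real.log N)

end LogCorrelated

end

/-! The field is compared with a Gaussian branching random walk (BRW) on the dyadic tree, and the
tail of the BRW maximum is bounded by a deterministic supersolution.

Comparison (`measureReal_exists_le_le_two_mul_brwTail`). Take `N ≤ 2 ^ k` and the tree of depth `k`
with `2 ^ d` children per vertex, step variance `log 2` and an extra variance `K` at the leaves.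
Adding to each `φ u` a nonnegative multiple of one common standard Gaussian equalizes the variances
with those of the BRW. The increment bound then makes every covariance at least the tree covariance,
so Slepian's inequality applies. The common Gaussian is nonnegative with probability at least 1/2,
which costs a factor 2. Slepian's inequality itself is proved by a Lindeberg replacement: both
Gaussian laws are split into `n` independent pieces and exchanged one at a time.

Recursion. Put `c = √(2d)` and `v = log 2`. The tail at height `c k v + x`, multiplied by `exp (c
x)`, is the tilted tail. A union bound over the children of the root bounds it by the average over
children of Gaussian convolutions (`tiltedTail_succ_le`), because `exp (c² v / 2)` is exactly the
number of children. A probability is at most 1, so the tilted tail is also at most `exp (c x)`. This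
cap acts as absorption near the origin, and absorption turns the heat kernel into its odd version `u
exp (-u² / (2 v t))`, which decays by the power 3/2. That power is the origin of the correction `3 /
(2c) * log log N`.

Barrier. The supersolution is the minimum of `exp (c u)` and a profile, in a frame displaced by `3 /
(2c) * log t`. The profile is the odd heat solution with a slowly increasing coefficient plus a
wider Gaussian correction (`exists_profile_step`, `exists_supersolution_step`). The linear factor of
the profile yields the factor `z`; its Gaussian factor yields `exp (-z² / (C n))`.

Subsets. Moving the barrier by `b` gains `exp (-c b)` wherever the cap is used, while the other
contribution is proportional to the number of leaves retained. The resulting prefactor `exp (-c b) +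
|B| / (number of leaves)` is stable under the recursion. Choosing `exp (-c b)` equal to the density
of `A` gives that density times a polynomial in `b`, and half of the density absorbs the polynomial.
-/

open Filter Topology
open scoped NNReal

namespace LogCorrelated

/-! ### Taylor estimates for smooth test functions -/

/-- A bound `C |x|^n` on a derivative integrates to a bound `C |x|^(n+1)`. -/
theorem abs_le_pow_succ_of_hasDerivAt {e e' : ℝ → ℝ} {C : ℝ} {n : ℕ} (hC : 0 ≤ C)
    (he : ∀ x, HasDerivAt e (e' x) x) (h0 : e 0 = 0) (hb : ∀ x, |e' x| ≤ C * |x| ^ n) (x : ℝ) :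
    |e x| ≤ C * |x| ^ (n + 1) := by
  have h := (convex_closedBall (0 : ℝ) |x|).norm_image_sub_le_of_norm_hasDerivWithin_le
    (f := e) (f' := e') (C := C * |x| ^ n) (x := 0) (y := x)
    (fun y _ => (he y).hasDerivWithinAt)
    (fun y hy => by
      refine (hb y).trans ?_
      have : |y| ≤ |x| := by simpa using hy
      gcongr)
    (by simp) (by simp)
  simpa [h0, pow_succ, mul_assoc] using h

/-- A function `g` with derivative data `g₁`, `g₂` satisfying uniform Taylor estimates. -/
structure TaylorBound (g g₁ g₂ : ℝ → ℝ) (C : ℝ) : Prop where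
  zero : ∀ s x, |g (s + x) - g s| ≤ C * |x|
  one : ∀ s x, |g (s + x) - g s - g₁ s * x| ≤ C * |x| ^ 2
  two : ∀ s x, |g (s + x) - g s - g₁ s * x - g₂ s * x ^ 2 / 2| ≤ C * |x| ^ 3

/-- Since `g` is constant on each side of `[0, 1]`, its first three derivatives vanish off that
compact interval and are therefore bounded, which makes the Taylor remainders uniform in the base
point. -/
theorem exists_taylorBound {g : ℝ → ℝ} (hg : ContDiff ℝ 3 g)
    (h0 : ∀ x, x ≤ 0 → g x = 0) (h1 : ∀ x, 1 ≤ x → g x = 1) :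
    ∃ C, 0 ≤ C ∧ TaylorBound g (deriv g) (deriv (deriv g)) C := by
  have hg1 : ContDiff ℝ 2 (deriv g) := by
    have : ContDiff ℝ (2 + 1) g := by norm_num; exact hg
    exact (contDiff_succ_iff_deriv.1 this).2.2
  have hg2 : ContDiff ℝ 1 (deriv (deriv g)) := by
    have : ContDiff ℝ (1 + 1) (deriv g) := by norm_num; exact hg1
    exact (contDiff_succ_iff_deriv.1 this).2.2
  have hg3 : Continuous (deriv (deriv (deriv g))) := hg2.continuous_deriv le_rfl
  have key : ∀ f : ℝ → ℝ, (∀ x, x < 0 → f x = f (-1)) → (∀ x, 1 < x → f x = f 2) →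
      (∀ x, x < 0 → deriv f x = 0) ∧ (∀ x, 1 < x → deriv f x = 0) := by
    intro f hf hf'
    constructor
    · intro x hx
      have : f =ᶠ[𝓝 x] fun _ => f (-1) := by
        filter_upwards [Iio_mem_nhds hx] with y hy using hf y hy
      rw [this.deriv_eq]; simp
    · intro x hx
      have : f =ᶠ[𝓝 x] fun _ => f 2 := by
        filter_upwards [Ioi_mem_nhds hx] with y hy using hf' y hy
      rw [this.deriv_eq]; simp
  have z0 := key g (fun x hx => by rw [h0 x hx.le, h0 (-1) (by norm_num)])
    (fun x hx => by rw [h1 x hx.le, h1 2 (by norm_num)])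
  have z1 := key (deriv g) (fun x hx => by rw [z0.1 x hx, z0.1 (-1) (by norm_num)])
    (fun x hx => by rw [z0.2 x hx, z0.2 2 (by norm_num)])
  have z2 := key (deriv (deriv g)) (fun x hx => by rw [z1.1 x hx, z1.1 (-1) (by norm_num)])
    (fun x hx => by rw [z1.2 x hx, z1.2 2 (by norm_num)])
  have bdd : ∀ f : ℝ → ℝ, Continuous f → (∀ x, x < 0 → f x = 0) → (∀ x, 1 < x → f x = 0) →
      ∃ C, 0 ≤ C ∧ ∀ x, |f x| ≤ C := by
    intro f hf hf0 hf1
    obtain ⟨C, hC⟩ := (isCompact_Icc (a := (0 : ℝ)) (b := 1)).exists_bound_of_continuousOn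
      hf.continuousOn
    refine ⟨max C 0, le_max_right _ _, fun x => ?_⟩
    by_cases hx : x < 0
    · simp [hf0 x hx]
    by_cases hx' : 1 < x
    · simp [hf1 x hx']
    · exact (hC x ⟨not_lt.1 hx, not_lt.1 hx'⟩).trans (le_max_left _ _)
  obtain ⟨C1, hC1, b1⟩ := bdd _ hg1.continuous z0.1 z0.2
  obtain ⟨C2, hC2, b2⟩ := bdd _ hg2.continuous z1.1 z1.2
  obtain ⟨C3, hC3, b3⟩ := bdd _ hg3 z2.1 z2.2
  have d0 : ∀ s x, HasDerivAt (fun x => g (s + x)) (deriv g (s + x)) x := fun s x =>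
    ((hg.differentiable (by norm_num)) (s + x)).hasDerivAt.comp_const_add s x
  have d1 : ∀ s x, HasDerivAt (fun x => deriv g (s + x)) (deriv (deriv g) (s + x)) x :=
    fun s x => ((hg1.differentiable (by norm_num)) (s + x)).hasDerivAt.comp_const_add s x
  have d2 : ∀ s x, HasDerivAt (fun x => deriv (deriv g) (s + x))
      (deriv (deriv (deriv g)) (s + x)) x :=
    fun s x => ((hg2.differentiable (by norm_num)) (s + x)).hasDerivAt.comp_const_add s x
  have e0 : ∀ s x, |g (s + x) - g s| ≤ C1 * |x| ^ 1 := fun s =>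
    abs_le_pow_succ_of_hasDerivAt (n := 0) hC1 (fun x => (d0 s x).sub_const _) (by simp)
      (fun x => by simpa using b1 _)
  have e1 : ∀ s x, |deriv g (s + x) - deriv g s| ≤ C2 * |x| ^ 1 := fun s =>
    abs_le_pow_succ_of_hasDerivAt (n := 0) hC2 (fun x => (d1 s x).sub_const _) (by simp)
      (fun x => by simpa using b2 _)
  have e2 : ∀ s x, |deriv (deriv g) (s + x) - deriv (deriv g) s| ≤ C3 * |x| ^ 1 := fun s =>
    abs_le_pow_succ_of_hasDerivAt (n := 0) hC3 (fun x => (d2 s x).sub_const _) (by simp)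
      (fun x => by simpa using b3 _)
  have f1 : ∀ s x, |g (s + x) - g s - deriv g s * x| ≤ C2 * |x| ^ 2 := fun s =>
    abs_le_pow_succ_of_hasDerivAt (n := 1) hC2
      (fun x => ((d0 s x).sub_const (g s)).sub (by
        simpa using (hasDerivAt_id x).const_mul (deriv g s))) (by simp) (e1 s)
  have f2 : ∀ s x, |deriv g (s + x) - deriv g s - deriv (deriv g) s * x| ≤ C3 * |x| ^ 2 :=
    fun s => abs_le_pow_succ_of_hasDerivAt (n := 1) hC3
      (fun x => ((d1 s x).sub_const (deriv g s)).sub (by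
        simpa using (hasDerivAt_id x).const_mul (deriv (deriv g) s))) (by simp) (e2 s)
  have f3 : ∀ s x, |g (s + x) - g s - deriv g s * x - deriv (deriv g) s * x ^ 2 / 2|
      ≤ C3 * |x| ^ 3 := fun s =>
    abs_le_pow_succ_of_hasDerivAt (n := 2) hC3
      (fun x => (((d0 s x).sub_const (g s)).sub (by
        simpa using (hasDerivAt_id x).const_mul (deriv g s))).sub (by
          have := ((hasDerivAt_pow 2 x).const_mul (deriv (deriv g) s)).div_const 2
          exact this.congr_deriv (by norm_num; ring))) (by simp) (f2 s)
  refine ⟨C1 + C2 + C3, by positivity, ⟨fun s x => (e0 s x).trans ?_,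
    fun s x => (f1 s x).trans ?_, fun s x => (f3 s x).trans ?_⟩⟩
  · rw [pow_one]; gcongr; linarith
  · gcongr; linarith
  · gcongr; linarith

theorem TaylorBound.scale {g g₁ g₂ : ℝ → ℝ} {C : ℝ} (hC : 0 ≤ C) (h : TaylorBound g g₁ g₂ C)
    {M : ℝ} (hM : 1 ≤ M) (a : ℝ) :
    TaylorBound (fun x => M * g (M * x + a)) (fun x => M ^ 2 * g₁ (M * x + a))
      (fun x => M ^ 3 * g₂ (M * x + a)) (C * M ^ 4) := by
  have hM0 : 0 < M := by linarith
  refine ⟨fun s x => ?_, fun s x => ?_, fun s x => ?_⟩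
  · have := h.zero (M * s + a) (M * x)
    rw [show M * (s + x) + a = M * s + a + M * x by ring,
      show ∀ p q : ℝ, M * p - M * q = M * (p - q) by intros; ring, abs_mul, abs_of_pos hM0]
    rw [abs_mul, abs_of_pos hM0] at this
    calc _ ≤ M * (C * (M * |x|)) := by gcongr
      _ = C * M ^ 2 * |x| := by ring
      _ ≤ C * M ^ 4 * |x| := by gcongr; norm_num
  · have := h.one (M * s + a) (M * x)
    rw [show M * (s + x) + a = M * s + a + M * x by ring,
      show ∀ p q r : ℝ, M * p - M * q - M ^ 2 * r * x = M * (p - q - r * (M * x)) by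
        intros; ring, abs_mul, abs_of_pos hM0]
    rw [abs_mul, abs_of_pos hM0] at this
    calc _ ≤ M * (C * (M * |x|) ^ 2) := by gcongr
      _ = C * M ^ 3 * |x| ^ 2 := by ring
      _ ≤ C * M ^ 4 * |x| ^ 2 := by gcongr; norm_num
  · have := h.two (M * s + a) (M * x)
    rw [show M * (s + x) + a = M * s + a + M * x by ring,
      show ∀ p q r t : ℝ, M * p - M * q - M ^ 2 * r * x - M ^ 3 * t * x ^ 2 / 2
        = M * (p - q - r * (M * x) - t * (M * x) ^ 2 / 2) by
        intros; ring, abs_mul, abs_of_pos hM0]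
    rw [abs_mul, abs_of_pos hM0] at this
    calc _ ≤ M * (C * (M * |x|) ^ 3) := by gcongr
      _ = C * M ^ 4 * |x| ^ 3 := by ring

/-- For `|b - a| ≤ 1` this is the exponential series. For larger differences both exponentials are
at most 1 and the cube dominates, so nonnegativity of `a` and `b` makes the estimate global. -/
theorem abs_exp_neg_sub_le {a b : ℝ} (ha : 0 ≤ a) (hb : 0 ≤ b) :
    |Real.exp (-b) - Real.exp (-a) * (1 - (b - a) + (b - a) ^ 2 / 2)| ≤ |b - a| ^ 3 := by
  have hea : Real.exp (-a) ≤ 1 := Real.exp_le_one_iff.2 (by linarith)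
  have heb : Real.exp (-b) ≤ 1 := Real.exp_le_one_iff.2 (by linarith)
  have pa := Real.exp_pos (-a)
  have pb := Real.exp_pos (-b)
  obtain ⟨δ, rfl⟩ : ∃ δ, b = a + δ := ⟨b - a, by ring⟩
  rw [add_sub_cancel_left]
  have hab : Real.exp (-(a + δ)) = Real.exp (-a) * Real.exp (-δ) := by
    rw [← Real.exp_add]; congr 1; ring
  rcases le_total |δ| 1 with h | h
  · have hx := Real.exp_bound (x := -δ) (by simpa using h) (n := 3) (by norm_num)
    simp only [Finset.sum_range_succ, Finset.sum_range_zero, Nat.factorial] at hx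
    norm_num at hx
    rw [hab, ← mul_sub, abs_mul, abs_of_pos pa]
    have h3 : 0 ≤ |δ| ^ 3 := by positivity
    have e : Real.exp (-δ) - (1 - δ + δ ^ 2 / 2) = Real.exp (-δ) - (1 + -δ + δ ^ 2 / 2) := by ring
    rw [e]
    calc _ ≤ 1 * |Real.exp (-δ) - (1 + -δ + δ ^ 2 / 2)| := by gcongr
      _ ≤ |δ| ^ 3 := by linarith
  · rcases le_abs.1 h with h1 | h1
    · rw [abs_of_pos (show 0 < δ by linarith)]
      have h3 : δ ^ 2 ≤ δ ^ 3 := by nlinarith [sq_nonneg δ]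
      have h4 : 1 ≤ δ ^ 2 := by nlinarith
      have h5 : 0 ≤ 1 - δ + δ ^ 2 / 2 := by nlinarith [sq_nonneg (δ - 1)]
      have h6 : Real.exp (-a) * (1 - δ + δ ^ 2 / 2) ≤ 1 * (1 - δ + δ ^ 2 / 2) := by gcongr
      have h7 : 0 ≤ Real.exp (-a) * (1 - δ + δ ^ 2 / 2) := by positivity
      rw [abs_le]; constructor <;> nlinarith
    · obtain ⟨r, rfl⟩ : ∃ r, δ = -r := ⟨-δ, by ring⟩
      have hr : 1 ≤ r := by linarith
      rw [abs_neg, abs_of_pos (show 0 < r by linarith)]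
      have h3 : 1 ≤ r ^ 3 := one_le_pow₀ hr
      have hq := Real.quadratic_le_exp_of_nonneg (show 0 ≤ r by linarith)
      rw [neg_neg] at hab
      have h6 : Real.exp (-a) * (1 + r + r ^ 2 / 2) ≤ Real.exp (-a) * Real.exp r := by gcongr
      have h7 : 0 ≤ Real.exp (-a) * (1 + r + r ^ 2 / 2) := by positivity
      rw [show Real.exp (-a) * (1 - -r + (-r) ^ 2 / 2) = Real.exp (-a) * (1 + r + r ^ 2 / 2) by ring]
      rw [abs_le]; constructor <;> linarith

theorem TaylorBound.abs_deriv_le {g g₁ g₂ : ℝ → ℝ} {C : ℝ} (h : TaylorBound g g₁ g₂ C) (s : ℝ) :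
    |g₁ s| ≤ 2 * C := by
  have h0 := h.zero s 1
  have h1 := h.one s 1
  simp only [abs_one, mul_one, one_pow] at h0 h1
  rw [abs_le] at *
  constructor <;> linarith

/-- The second-order expansion of `exp (-∑ g (x i))`. -/
theorem abs_exp_neg_sum_taylor_le {ι : Type*} [Fintype ι] [DecidableEq ι] {g g₁ g₂ : ℝ → ℝ}
    {C : ℝ} (hC : 0 ≤ C)
    (h : TaylorBound g g₁ g₂ C) (hg : ∀ x, 0 ≤ g x) (A : Finset ι) :
    ∃ D, 0 ≤ D ∧ ∀ s x : ι → ℝ,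
      |Real.exp (-∑ i ∈ A, g (s i + x i)) - Real.exp (-∑ i ∈ A, g (s i))
        - ∑ i ∈ A, -(Real.exp (-∑ i ∈ A, g (s i)) * g₁ (s i)) * x i
        - ∑ i ∈ A, ∑ j ∈ A, (Real.exp (-∑ i ∈ A, g (s i)) *
            (g₁ (s i) * g₁ (s j) - if i = j then g₂ (s i) else 0)) / 2 * (x i * x j)|
        ≤ D * ‖x‖ ^ 3 := by
  obtain ⟨n, hn⟩ : ∃ n : ℝ, n = A.card := ⟨_, rfl⟩
  have hn0 : 0 ≤ n := by rw [hn]; positivity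
  refine ⟨(C * n) ^ 3 + C * n + C * n * (3 * (C * n)) / 2, by positivity, fun s x => ?_⟩
  set a := ∑ i ∈ A, g (s i) with ha
  set b := ∑ i ∈ A, g (s i + x i) with hb
  set p := ∑ i ∈ A, g₁ (s i) * x i with hp
  set q := ∑ i ∈ A, g₂ (s i) * x i ^ 2 / 2 with hq
  set r := ‖x‖ with hr
  have hr0 : 0 ≤ r := norm_nonneg x
  have hxi : ∀ i, |x i| ≤ r := fun i => norm_le_pi_norm x i
  have bound : ∀ (f : ι → ℝ) (c : ℝ), (∀ i ∈ A, |f i| ≤ c) → |∑ i ∈ A, f i| ≤ n * c := by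
    intro f c hf
    refine (Finset.abs_sum_le_sum_abs _ _).trans ((Finset.sum_le_sum hf).trans ?_)
    simp [hn]
  have b0 : |b - a| ≤ n * (C * r) := by
    rw [ha, hb, ← Finset.sum_sub_distrib]
    refine bound _ _ fun i _ => (h.zero _ _).trans ?_
    have := hxi i; gcongr
  have b1 : |b - a - p| ≤ n * (C * r ^ 2) := by
    rw [ha, hb, hp, ← Finset.sum_sub_distrib, ← Finset.sum_sub_distrib]
    refine bound _ _ fun i _ => (h.one _ _).trans ?_
    have := hxi i; gcongr
  have b2 : |b - a - p - q| ≤ n * (C * r ^ 3) := by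
    rw [ha, hb, hp, hq, ← Finset.sum_sub_distrib, ← Finset.sum_sub_distrib,
      ← Finset.sum_sub_distrib]
    refine bound _ _ fun i _ => (h.two _ _).trans ?_
    have := hxi i; gcongr
  have b3 : |p| ≤ n * (2 * C * r) := by
    refine bound _ _ fun i _ => ?_
    rw [abs_mul]
    have := hxi i
    have := h.abs_deriv_le (s i)
    gcongr
  have ha0 : 0 ≤ a := Finset.sum_nonneg fun i _ => hg _
  have hb0 : 0 ≤ b := Finset.sum_nonneg fun i _ => hg _
  have hE := abs_exp_neg_sub_le ha0 hb0
  have hea : Real.exp (-a) ≤ 1 := Real.exp_le_one_iff.2 (by linarith)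
  have pa := Real.exp_pos (-a)
  have e1 : ∑ i ∈ A, -(Real.exp (-a) * g₁ (s i)) * x i = -Real.exp (-a) * p := by
    rw [hp, Finset.mul_sum]
    exact Finset.sum_congr rfl fun i _ => by ring
  have e2 : ∑ i ∈ A, ∑ j ∈ A, (Real.exp (-a) *
      (g₁ (s i) * g₁ (s j) - if i = j then g₂ (s i) else 0)) / 2 * (x i * x j)
      = Real.exp (-a) * (p ^ 2 / 2 - q) := by
    have : p ^ 2 = ∑ i ∈ A, ∑ j ∈ A, (g₁ (s i) * x i) * (g₁ (s j) * x j) := by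
      rw [sq, hp, Finset.sum_mul_sum]
    have hq' : q = ∑ i ∈ A, ∑ j ∈ A, (if i = j then g₂ (s i) * x i ^ 2 / 2 else 0) := by
      rw [hq]
      exact Finset.sum_congr rfl fun i hi => by simp [hi]
    rw [this, hq', Finset.sum_div, ← Finset.sum_sub_distrib, Finset.mul_sum]
    refine Finset.sum_congr rfl fun i _ => ?_
    rw [Finset.sum_div, ← Finset.sum_sub_distrib, Finset.mul_sum]
    refine Finset.sum_congr rfl fun j _ => ?_
    split_ifs with hij
    · subst hij; ring
    · ring
  rw [e1, e2]
  -- The expansion in `b - a` is replaced by one in the linear part `p` and quadratic part `q`. The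
  -- error from `(b - a) ^ 2` versus `p ^ 2` factors as a second-order times a first-order quantity,
  -- hence is cubic.
  have key : Real.exp (-b) - Real.exp (-a) - -Real.exp (-a) * p - Real.exp (-a) * (p ^ 2 / 2 - q)
      = (Real.exp (-b) - Real.exp (-a) * (1 - (b - a) + (b - a) ^ 2 / 2))
        + Real.exp (-a) * (-(b - a - p - q) + (b - a - p) * (b - a + p) / 2) := by ring
  have b4 : |b - a + p| ≤ n * (3 * C * r) := (abs_add_le _ _).trans (by linarith)
  have b5 : |-(b - a - p - q) + (b - a - p) * (b - a + p) / 2|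
      ≤ n * (C * r ^ 3) + (n * (C * r ^ 2)) * (n * (3 * C * r)) / 2 := by
    refine (abs_add_le _ _).trans ?_
    rw [abs_neg, abs_div, abs_mul, abs_two]
    gcongr
  rw [key]
  calc _ ≤ |b - a| ^ 3 + 1 * (n * (C * r ^ 3) + (n * (C * r ^ 2)) * (n * (3 * C * r)) / 2) := by
        refine (abs_add_le _ _).trans (add_le_add hE ?_)
        rw [abs_mul, abs_of_pos pa]
        gcongr
    _ ≤ (n * (C * r)) ^ 3 + 1 * (n * (C * r ^ 3) + (n * (C * r ^ 2)) * (n * (3 * C * r)) / 2) := by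
        gcongr
    _ = _ := by ring
-- Slepian's inequality by Lindeberg replacement
section Slepian

variable {ι : Type*} [Fintype ι]

/-- Writing `(a, b) = c (cos θ, sin θ)`, this is rotation invariance of the product of two copies of
a centered Gaussian law. It makes the laws scaled by `√t` a convolution semigroup in `t`. -/
theorem prod_map_smul_add_smul (μ : Measure (ι → ℝ)) [IsGaussian μ]
    (h0 : ∫ x, x ∂μ = 0) {a b c : ℝ} (hc : 0 ≤ c) (h : a ^ 2 + b ^ 2 = c ^ 2) :
    (μ.map (fun x => a • x)) ∗ (μ.map (fun x => b • x)) = μ.map (fun x => c • x) := by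
  have hconv : (μ.map (fun x => a • x)) ∗ (μ.map (fun x => b • x))
      = (μ.prod μ).map (fun p => a • p.1 + b • p.2) := by
    rw [Measure.conv, Measure.map_prod_map _ _ (by fun_prop) (by fun_prop),
      Measure.map_map (by fun_prop) (by fun_prop)]
    rfl
  rw [hconv]
  rcases hc.eq_or_lt with rfl | hc
  · have ha : a = 0 := by nlinarith [sq_nonneg a, sq_nonneg b]
    have hb : b = 0 := by nlinarith [sq_nonneg a, sq_nonneg b]
    simp [ha, hb, Measure.map_const]
  · obtain ⟨θ, h1, h2⟩ : ∃ θ : ℝ, a = c * Real.cos θ ∧ b = c * Real.sin θ := by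
      have hn : ‖(⟨a, b⟩ : ℂ)‖ = c := by
        rw [Complex.norm_def, Complex.normSq_mk, ← sq, ← sq, h, Real.sqrt_sq hc.le]
      have hz : (⟨a, b⟩ : ℂ) ≠ 0 := by
        rw [← norm_pos_iff, hn]; exact hc
      refine ⟨Complex.arg ⟨a, b⟩, ?_, ?_⟩
      · rw [Complex.cos_arg hz, hn]; field_simp
      · rw [Complex.sin_arg, hn]; field_simp
    have := IsGaussian.map_rotation_eq_self (μ := μ) (by simpa using h0) θ
    have e : (fun p : (ι → ℝ) × (ι → ℝ) => a • p.1 + b • p.2)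
        = (fun x => c • x) ∘ Prod.fst ∘ (ContinuousLinearMap.rotation θ) := by
      funext p
      simp [ContinuousLinearMap.rotation_apply, h1, h2, smul_add, smul_smul]
    rw [e, ← Measure.map_map (by fun_prop) (by fun_prop),
      ← Measure.map_map (by fun_prop) (by fun_prop), this, Measure.map_fst_prod]
    simp

theorem integrable_eval_of_isGaussian (μ : Measure (ι → ℝ)) [IsGaussian μ] (i : ι) :
    Integrable (fun x => x i) μ :=
  IsGaussian.integrable_dual μ (ContinuousLinearMap.proj (R := ℝ) (φ := fun _ : ι => ℝ) i)

theorem integrable_eval_mul_eval_of_isGaussian (μ : Measure (ι → ℝ)) [IsGaussian μ] (i j : ι) :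
    Integrable (fun x => x i * x j) μ :=
  (IsGaussian.memLp_dual μ (ContinuousLinearMap.proj (R := ℝ) (φ := fun _ : ι => ℝ) i)
    2 (by simp)).integrable_mul (IsGaussian.memLp_dual μ
      (ContinuousLinearMap.proj (R := ℝ) (φ := fun _ : ι => ℝ) j) 2 (by simp))

theorem integrable_norm_pow_of_isGaussian (μ : Measure (ι → ℝ)) [IsGaussian μ] :
    Integrable (fun x => ‖x‖ ^ 3) μ :=
  (IsGaussian.memLp_id μ 3 (by simp)).integrable_norm_pow (by norm_num)

/-- Centering kills the first-order term, so up to order `r ^ 3` the law of the increment enters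
only through its covariances. -/
theorem abs_integral_sub_le_of_taylor (μ : Measure (ι → ℝ)) [IsGaussian μ]
    (h0 : ∀ i, ∫ x, x i ∂μ = 0) {F : (ι → ℝ) → ℝ} (hF : Measurable F)
    (hF1 : ∀ x, |F x| ≤ 1) {A : Finset ι} {D : ℝ} {s : ι → ℝ} {G : ι → ℝ} {H : ι → ι → ℝ}
    (hT : ∀ x, |F (s + x) - F s - ∑ i ∈ A, G i * x i - ∑ i ∈ A, ∑ j ∈ A, H i j * (x i * x j)|
      ≤ D * ‖x‖ ^ 3) {r : ℝ} (hr : 0 ≤ r) :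
    |∫ x, F (s + r • x) ∂μ - F s - r ^ 2 * ∑ i ∈ A, ∑ j ∈ A, H i j * ∫ x, x i * x j ∂μ|
      ≤ r ^ 3 * (D * ∫ x, ‖x‖ ^ 3 ∂μ) := by
  have i1 : Integrable (fun x => F (s + r • x)) μ :=
    Integrable.of_bound (hF.comp (by fun_prop : Measurable fun x : ι → ℝ => s + r • x)).aestronglyMeasurable 1 (Eventually.of_forall fun x => by simpa using hF1 _)
  have i2 : Integrable (fun x : ι → ℝ => ∑ i ∈ A, G i * (r * x i)) μ :=
    integrable_finsetSum _ fun i _ =>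
      ((integrable_eval_of_isGaussian μ i).const_mul r).const_mul _
  have i3 : Integrable (fun x : ι → ℝ =>
      ∑ i ∈ A, ∑ j ∈ A, H i j * (r ^ 2 * (x i * x j))) μ :=
    integrable_finsetSum _ fun i _ => integrable_finsetSum _ fun j _ =>
      ((integrable_eval_mul_eval_of_isGaussian μ i j).const_mul _).const_mul _
  have e2 : ∫ x : ι → ℝ, ∑ i ∈ A, G i * (r * x i) ∂μ = 0 := by
    rw [integral_finsetSum _ fun i _ =>
      ((integrable_eval_of_isGaussian μ i).const_mul r).const_mul _]
    refine Finset.sum_eq_zero fun i _ => ?_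
    rw [integral_const_mul, integral_const_mul, h0]; simp
  have e3 : ∫ x : ι → ℝ, ∑ i ∈ A, ∑ j ∈ A, H i j * (r ^ 2 * (x i * x j)) ∂μ
      = r ^ 2 * ∑ i ∈ A, ∑ j ∈ A, H i j * ∫ x, x i * x j ∂μ := by
    rw [integral_finsetSum _ fun i _ => integrable_finsetSum _ fun j _ =>
      ((integrable_eval_mul_eval_of_isGaussian μ i j).const_mul _).const_mul _, Finset.mul_sum]
    refine Finset.sum_congr rfl fun i _ => ?_
    rw [integral_finsetSum _ fun j _ =>
      ((integrable_eval_mul_eval_of_isGaussian μ i j).const_mul _).const_mul _, Finset.mul_sum]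
    refine Finset.sum_congr rfl fun j _ => ?_
    rw [integral_const_mul, integral_const_mul]; ring
  have e : ∫ x, F (s + r • x) ∂μ - F s - r ^ 2 * ∑ i ∈ A, ∑ j ∈ A, H i j * ∫ x, x i * x j ∂μ
      = ∫ x, (F (s + r • x) - F s - ∑ i ∈ A, G i * (r * x i)
          - ∑ i ∈ A, ∑ j ∈ A, H i j * (r ^ 2 * (x i * x j))) ∂μ := by
    have j1 : Integrable (fun x => F (s + r • x) - F s) μ := i1.sub (integrable_const _)
    have j2 : Integrable (fun x => F (s + r • x) - F s - ∑ i ∈ A, G i * (r * x i)) μ := j1.sub i2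
    rw [integral_sub j2 i3, integral_sub j1 i2, integral_sub i1 (integrable_const _), e2, e3]
    simp
  rw [e]
  have := norm_integral_le_of_norm_le (μ := μ)
    (((integrable_norm_pow_of_isGaussian μ).const_mul D).const_mul (r ^ 3))
    (f := fun x => F (s + r • x) - F s - ∑ i ∈ A, G i * (r * x i)
          - ∑ i ∈ A, ∑ j ∈ A, H i j * (r ^ 2 * (x i * x j)))
    (Eventually.of_forall fun x => by
      have := hT (r • x)
      rw [norm_smul, Real.norm_of_nonneg hr] at this
      simp only [Pi.smul_apply, smul_eq_mul] at this
      have hs : ∀ i j, r * x i * (r * x j) = r ^ 2 * (x i * x j) := by intros; ring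
      simp only [hs] at this
      rw [Real.norm_eq_abs]
      linarith [this])
  rw [Real.norm_eq_abs, integral_const_mul, integral_const_mul] at this
  exact this

/-- Covariance domination between two centered Gaussian measures with equal variances. -/
structure CovDominates (μ ν : Measure (ι → ℝ)) : Prop where
  left_centered : ∀ i, ∫ x, x i ∂μ = 0
  right_centered : ∀ i, ∫ x, x i ∂ν = 0
  variance_eq : ∀ i, ∫ x, x i * x i ∂μ = ∫ x, x i * x i ∂ν
  cov_le : ∀ i j, i ≠ j → ∫ x, x i * x j ∂ν ≤ ∫ x, x i * x j ∂μ

theorem integral_eq_zero_of_eval (μ : Measure (ι → ℝ)) [IsGaussian μ]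
    (h0 : ∀ i, ∫ x, x i ∂μ = 0) : ∫ x, x ∂μ = 0 := by
  ext i
  have := (ContinuousLinearMap.proj (R := ℝ) (φ := fun _ : ι => ℝ) i).integral_comp_comm
    (IsGaussian.integrable_id (μ := μ))
  simp only [id, ContinuousLinearMap.proj_apply] at this
  rw [← this, h0]; rfl

/-- Each exchange of a small piece of `ν` for one of `μ` changes the integral by a second-order term
of the right sign and a cubic error. Diagonal second derivatives may have any sign because the
variances agree. -/
theorem CovDominates.integral_le (μ ν : Measure (ι → ℝ)) [IsGaussian μ] [IsGaussian ν]
    (h : CovDominates μ ν) {F : (ι → ℝ) → ℝ} (hF : Measurable F)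
    (hF1 : ∀ x, |F x| ≤ 1) {A : Finset ι} {D : ℝ}
    {G : (ι → ℝ) → ι → ℝ} {H : (ι → ℝ) → ι → ι → ℝ}
    (hT : ∀ s x, |F (s + x) - F s - ∑ i ∈ A, G s i * x i
      - ∑ i ∈ A, ∑ j ∈ A, H s i j * (x i * x j)| ≤ D * ‖x‖ ^ 3)
    (hH : ∀ s i j, i ≠ j → 0 ≤ H s i j) :
    ∫ x, F x ∂ν ≤ ∫ x, F x ∂μ := by
  set E : ℝ := D * ∫ x, ‖x‖ ^ 3 ∂μ + D * ∫ x, ‖x‖ ^ 3 ∂ν with hE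
  have int : ∀ (ρ : Measure (ι → ℝ)) [IsProbabilityMeasure ρ], Integrable F ρ := fun ρ _ =>
    Integrable.of_bound (by fun_prop) 1 (Eventually.of_forall fun x => by simpa using hF1 _)
  have pm : ∀ (ρ : Measure (ι → ℝ)) [IsProbabilityMeasure ρ] (r : ℝ),
      IsProbabilityMeasure (ρ.map (fun x => r • x)) := fun ρ _ r =>
    Measure.isProbabilityMeasure_map (by fun_prop)
  -- One exchange: `ρ` is the law of the independent pieces left untouched, and conditioning on it
  -- reduces to the Taylor estimate at a fixed base point.
  have step : ∀ (ρ : Measure (ι → ℝ)) [IsProbabilityMeasure ρ] (r : ℝ), 0 ≤ r →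
      ∫ x, F x ∂(ρ ∗ ν.map (fun x => r • x)) ≤
        ∫ x, F x ∂(ρ ∗ μ.map (fun x => r • x)) + r ^ 3 * E := by
    intro ρ _ r hr
    have := pm μ r
    have := pm ν r
    have cv : ∀ (τ : Measure (ι → ℝ)) [IsProbabilityMeasure τ],
        ∫ x, F x ∂(ρ ∗ τ.map (fun x => r • x)) = ∫ s, ∫ x, F (s + r • x) ∂τ ∂ρ := by
      intro τ _
      have := pm τ r
      rw [integral_conv (int _)]
      congr 1; ext s
      have hm : AEStronglyMeasurable (fun x => F (s + x)) (τ.map (fun x => r • x)) :=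
        (hF.comp (by fun_prop : Measurable fun x : ι → ℝ => s + x)).aestronglyMeasurable
      rw [integral_map (by fun_prop) hm]
    have ci : ∀ (τ : Measure (ι → ℝ)) [IsProbabilityMeasure τ],
        Integrable (fun s => ∫ x, F (s + r • x) ∂τ) ρ := by
      intro τ _
      have : Integrable (fun p : (ι → ℝ) × (ι → ℝ) => F (p.1 + r • p.2)) (ρ.prod τ) :=
        Integrable.of_bound (hF.comp (by fun_prop : Measurable
          fun p : (ι → ℝ) × (ι → ℝ) => p.1 + r • p.2)).aestronglyMeasurable 1 (Eventually.of_forall fun x => by simpa using hF1 _)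
      exact this.integral_prod_left
    have key : ∀ s, ∫ x, F (s + r • x) ∂ν ≤ ∫ x, F (s + r • x) ∂μ + r ^ 3 * E := by
      intro s
      have h1 := abs_le.1 (abs_integral_sub_le_of_taylor μ h.left_centered hF hF1 (hT s) hr)
      have h2 := abs_le.1 (abs_integral_sub_le_of_taylor ν h.right_centered hF hF1 (hT s) hr)
      have h3 : ∑ i ∈ A, ∑ j ∈ A, H s i j * ∫ x, x i * x j ∂ν
          ≤ ∑ i ∈ A, ∑ j ∈ A, H s i j * ∫ x, x i * x j ∂μ := by
        refine Finset.sum_le_sum fun i _ => Finset.sum_le_sum fun j _ => ?_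
        rcases eq_or_ne i j with rfl | hij
        · rw [h.variance_eq]
        · exact mul_le_mul_of_nonneg_left (h.cov_le i j hij) (hH s i j hij)
      have h4 := mul_le_mul_of_nonneg_left h3 (sq_nonneg r)
      rw [hE, mul_add]
      linarith [h1.1, h2.2]
    rw [cv, cv]
    have := integral_mono (ci ν) ((ci μ).add (integrable_const _)) key
    simpa [integral_add (ci μ) (integrable_const _)] using this
  have main : ∀ n : ℕ, 0 < n → ∫ x, F x ∂ν ≤ ∫ x, F x ∂μ + E * (√(1 / (n : ℝ))) := by
    intro n hn
    have hn' : (0 : ℝ) < n := by exact_mod_cast hn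
    let m : ℝ → Measure (ι → ℝ) := fun t => μ.map (fun x => √t • x)
    let k : ℝ → Measure (ι → ℝ) := fun t => ν.map (fun x => √t • x)
    have hm : ∀ t, IsProbabilityMeasure (m t) := fun t => pm μ _
    have hk : ∀ t, IsProbabilityMeasure (k t) := fun t => pm ν _
    have am : ∀ s t, 0 ≤ s → 0 ≤ t → m s ∗ m t = m (s + t) := fun s t hs ht =>
      prod_map_smul_add_smul μ (integral_eq_zero_of_eval μ h.left_centered) (Real.sqrt_nonneg _)
        (by rw [Real.sq_sqrt hs, Real.sq_sqrt ht, Real.sq_sqrt (by positivity)])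
    have ak : ∀ s t, 0 ≤ s → 0 ≤ t → k s ∗ k t = k (s + t) := fun s t hs ht =>
      prod_map_smul_add_smul ν (integral_eq_zero_of_eval ν h.right_centered) (Real.sqrt_nonneg _)
        (by rw [Real.sq_sqrt hs, Real.sq_sqrt ht, Real.sq_sqrt (by positivity)])
    -- After `j` exchanges the law is `m (j / n) ∗ k ((n - j) / n)`, which runs from `ν` to `μ`.
    have ind : ∀ j : ℕ, j ≤ n → ∫ x, F x ∂ν ≤
        ∫ x, F x ∂(m (j / n) ∗ k ((n - j) / n)) + j * (√(1 / (n : ℝ)) ^ 3 * E) := by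
      intro j
      induction j with
      | zero =>
        intro _
        have h1 : k ((n - (0 : ℕ)) / n) = ν := by simp [k, hn'.ne']
        have h2 : m ((0 : ℕ) / n) = Measure.dirac 0 := by
          simp [m, Measure.map_const]
        rw [h1, h2]
        simp
      | succ j ih =>
        intro hj
        have hj' : (j : ℝ) + 1 ≤ n := by exact_mod_cast hj
        have h1 : 0 ≤ (j : ℝ) / n := by positivity
        have h2 : 0 ≤ ((n : ℝ) - (j + 1)) / n := div_nonneg (by linarith) hn'.le
        have h3 : 0 ≤ 1 / (n : ℝ) := by positivity
        have s1 : (m (j / n) ∗ k ((n - (j + 1)) / n)) ∗ k (1 / n) = m (j / n) ∗ k ((n - j) / n) := by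
          rw [Measure.conv_assoc, ak _ _ h2 h3]
          congr 2; field_simp; ring
        have s2 : (m (j / n) ∗ k ((n - (j + 1)) / n)) ∗ m (1 / n)
            = m ((j + 1) / n) ∗ k ((n - (j + 1)) / n) := by
          rw [Measure.conv_assoc, Measure.conv_comm (k _), ← Measure.conv_assoc, am _ _ h1 h3]
          congr 2; field_simp
        have := step (m (j / n) ∗ k ((n - (j + 1)) / n)) (√(1 / n)) (Real.sqrt_nonneg _)
        have h5 := ih (by omega)
        push_cast
        rw [← s2]
        rw [← s1] at h5
        simp only [m, k] at h5 this ⊢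
        linarith
    have := ind n le_rfl
    have h1 : k ((n - (n : ℝ)) / n) = Measure.dirac 0 := by simp [k, Measure.map_const]
    have h2 : m ((n : ℝ) / n) = μ := by simp [m, hn'.ne']
    rw [h1, h2] at this
    -- There are `n` errors of size `n ^ (-3/2)`, so the total tends to zero.
    have e : (n : ℝ) * (√(1 / (n : ℝ)) ^ 3 * E) = E * √(1 / (n : ℝ)) := by
      have : √(1 / (n : ℝ)) ^ 2 = 1 / n := Real.sq_sqrt (by positivity)
      rw [pow_succ, this]; field_simp
    rw [e] at this
    simpa using this
  have lim : Tendsto (fun n : ℕ => ∫ x, F x ∂μ + E * (√(1 / (n : ℝ)))) atTop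
      (𝓝 (∫ x, F x ∂μ + E * √0)) := by
    refine tendsto_const_nhds.add (tendsto_const_nhds.mul ?_)
    exact (Real.continuous_sqrt.tendsto 0).comp tendsto_one_div_atTop_nhds_zero_nat
  simp only [Real.sqrt_zero, mul_zero, add_zero] at lim
  exact ge_of_tendsto lim (eventually_atTop.2 ⟨1, fun n hn => main n hn⟩)

/-- **Slepian's inequality** for the maximum over a finite set. -/
theorem CovDominates.measureReal_exists_le [DecidableEq ι] (μ ν : Measure (ι → ℝ)) [IsGaussian μ]
    [IsGaussian ν]
    (h : CovDominates μ ν) (A : Finset ι) (l : ℝ) :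
    μ.real {x | ∃ i ∈ A, l ≤ x i} ≤ ν.real {x | ∃ i ∈ A, l ≤ x i} := by
  obtain ⟨C, hC, hg⟩ := exists_taylorBound (g := Real.smoothTransition)
    Real.smoothTransition.contDiff (fun x hx => Real.smoothTransition.zero_of_nonpos hx)
    (fun x hx => Real.smoothTransition.one_of_one_le hx)
  -- The penalty `g M` equals `M + 1` for `x ≥ l` and vanishes for `x ≤ l - 1 / (M + 1)`. Hence `exp
  -- (-∑ g)` tends to the indicator that all coordinates in `A` are below `l`, with the closed
  -- inequality `l ≤ x i` treated exactly.
  let g : ℕ → ℝ → ℝ := fun M x => (M + 1 : ℝ) *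
    Real.smoothTransition ((M + 1 : ℝ) * x + (1 - (M + 1 : ℝ) * l))
  let F : ℕ → (ι → ℝ) → ℝ := fun M x => Real.exp (-∑ i ∈ A, g M (x i))
  have g0 : ∀ M x, 0 ≤ g M x := fun M x => mul_nonneg (by positivity) (Real.smoothTransition.nonneg _)
  have hFm : ∀ M, Measurable (F M) := fun M => by
    have := Real.smoothTransition.continuous
    have : Continuous (F M) := by fun_prop
    exact this.measurable
  have hF1 : ∀ M x, |F M x| ≤ 1 := fun M x => by
    rw [abs_of_pos (Real.exp_pos _), Real.exp_le_one_iff, neg_nonpos]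
    exact Finset.sum_nonneg fun i _ => g0 _ _
  have hle : ∀ M, ∫ x, F M x ∂ν ≤ ∫ x, F M x ∂μ := by
    intro M
    have hsc := hg.scale hC (M := (M + 1 : ℝ)) (by simp) (1 - (M + 1 : ℝ) * l)
    obtain ⟨D, hD, hT⟩ := abs_exp_neg_sum_taylor_le (ι := ι) (by positivity) hsc (g0 M) A
    refine CovDominates.integral_le μ ν h (hFm M) (hF1 M) hT fun s i j hij => ?_
    simp only [if_neg hij, sub_zero]
    -- The mixed second derivatives of `exp (-∑ g)` are `exp (-∑ g) * g' * g'`, nonnegative because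
    -- `g` is monotone.
    have hd : ∀ x, 0 ≤ deriv Real.smoothTransition x := fun x =>
      Real.smoothTransition.monotone.deriv_nonneg
    have := hd ((M + 1 : ℝ) * s i + (1 - (M + 1 : ℝ) * l))
    have := hd ((M + 1 : ℝ) * s j + (1 - (M + 1 : ℝ) * l))
    positivity
  have hlim : ∀ (ρ : Measure (ι → ℝ)) [IsProbabilityMeasure ρ],
      Tendsto (fun M => ∫ x, F M x ∂ρ) atTop (𝓝 (ρ.real {x | ∃ i ∈ A, l ≤ x i}ᶜ)) := by
    intro ρ _
    have hS : MeasurableSet {x : ι → ℝ | ∃ i ∈ A, l ≤ x i} := by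
      have : {x : ι → ℝ | ∃ i ∈ A, l ≤ x i} = ⋃ i ∈ A, {x | l ≤ x i} := by ext; simp
      rw [this]
      exact Finset.measurableSet_biUnion _ fun i _ =>
        measurableSet_le measurable_const (measurable_pi_apply i)
    rw [← integral_indicator_one hS.compl]
    refine tendsto_integral_of_dominated_convergence (fun _ => 1)
      (fun M => (hFm M).aestronglyMeasurable) (integrable_const _)
      (fun M => Eventually.of_forall fun x => by simpa using hF1 M x)
      (Eventually.of_forall fun x => ?_)
    by_cases hx : ∃ i ∈ A, l ≤ x i
    · rw [Set.indicator_of_notMem (by simpa using hx)]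
      obtain ⟨i, hi, hli⟩ := hx
      have hb : ∀ M : ℕ, F M x ≤ Real.exp (-(M : ℝ)) := by
        intro M
        rw [Real.exp_le_exp, neg_le_neg_iff]
        have h1 : g M (x i) = M + 1 := by
          have : (1 : ℝ) ≤ (M + 1 : ℝ) * x i + (1 - (M + 1 : ℝ) * l) := by nlinarith
          simp only [g, Real.smoothTransition.one_of_one_le this, mul_one]
        have h2 := Finset.single_le_sum (f := fun i => g M (x i)) (fun i _ => g0 M (x i)) hi
        simp only [h1] at h2
        linarith
      exact squeeze_zero (fun M => (Real.exp_pos _).le) hb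
        (Real.tendsto_exp_neg_atTop_nhds_zero.comp tendsto_natCast_atTop_atTop)
    · rw [Set.indicator_of_mem (by simpa using hx)]
      push Not at hx
      have hev : ∀ᶠ M : ℕ in atTop, ∀ i ∈ A, g M (x i) = 0 := by
        rw [Filter.eventually_all_finset]
        intro i hi
        have hpos : 0 < l - x i := by linarith [hx i hi]
        filter_upwards [(tendsto_natCast_atTop_atTop (R := ℝ)).eventually_ge_atTop (1 / (l - x i))]
          with M hM
        rw [div_le_iff₀ hpos] at hM
        have : (M + 1 : ℝ) * x i + (1 - (M + 1 : ℝ) * l) ≤ 0 := by nlinarith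
        simp only [g, Real.smoothTransition.zero_of_nonpos this, mul_zero]
      refine Tendsto.congr' ?_ tendsto_const_nhds
      filter_upwards [hev] with M hM
      simp [F, Finset.sum_congr rfl hM]
  have hfin := le_of_tendsto_of_tendsto' (hlim ν) (hlim μ) hle
  have hS : MeasurableSet {x : ι → ℝ | ∃ i ∈ A, l ≤ x i} := by
    have : {x : ι → ℝ | ∃ i ∈ A, l ≤ x i} = ⋃ i ∈ A, {x | l ≤ x i} := by ext; simp
    rw [this]
    exact Finset.measurableSet_biUnion _ fun i _ =>
      measurableSet_le measurable_const (measurable_pi_apply i)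
  rw [probReal_compl_eq_one_sub hS, probReal_compl_eq_one_sub hS] at hfin
  linarith

end Slepian

/-! ### The Gaussian branching random walk and its one-generation recursion -/

noncomputable section BranchingRandomWalk

variable (C : Type) [Fintype C] (v K : ℝ≥0)

/-- The joint law, over the leaves at depth `k`, of a Gaussian branching random walk with branching
set `C`, step variance `v` and variance `K` for the variable at the root of a depth-zero tree. -/
def brwLaw : (k : ℕ) → Measure ((Fin k → C) → ℝ)
  | 0 => (gaussianReal 0 K).map (fun x _ => x)
  | k + 1 => (Measure.pi fun _ : C => (gaussianReal 0 v).prod (brwLaw k)).map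
      (fun f l => (f (l 0)).1 + (f (l 0)).2 (Fin.tail l))

variable {C}

/-- The covariance of the branching random walk at two leaves. -/
def brwCov [DecidableEq C] : (k : ℕ) → (Fin k → C) → (Fin k → C) → ℝ
  | 0, _, _ => K
  | k + 1, l, l' => if l 0 = l' 0 then v + brwCov k (Fin.tail l) (Fin.tail l') else 0

variable (C)

theorem measurable_eval_mul_eval {ι : Type*} (l l' : ι) :
    Measurable fun y : ι → ℝ => y l * y l' :=
  (measurable_pi_apply l).mul (measurable_pi_apply l')

theorem isGaussian_pi {E : Type*} [NormedAddCommGroup E] [NormedSpace ℝ E]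
    [MeasurableSpace E] [BorelSpace E] [SecondCountableTopology E] [CompleteSpace E]
    (μ : C → Measure E) [∀ c, IsGaussian (μ c)] : IsGaussian (Measure.pi μ) := by
  have h1 : ∀ c, HasGaussianLaw (fun f : C → E => f c) (Measure.pi μ) := fun c => by
    refine ⟨?_⟩
    rw [show (fun f : C → E => f c) = Function.eval c from rfl, (measurePreserving_eval μ c).map_eq]
    infer_instance
  have h2 : iIndepFun (fun c (f : C → E) => f c) (Measure.pi μ) :=
    iIndepFun_pi (X := fun _ => id) (fun _ => aemeasurable_id)
  have := (iIndepFun.hasGaussianLaw h1 h2).isGaussian_map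
  rwa [show (fun (ω : C → E) (x : C) => ω x) = id from rfl, Measure.map_id] at this

instance isGaussian_brwLaw (k : ℕ) : IsGaussian (brwLaw C v K k) := by
  induction k with
  | zero =>
    rw [brwLaw]
    let L : ℝ →L[ℝ] ((Fin 0 → C) → ℝ) := ContinuousLinearMap.pi fun _ => ContinuousLinearMap.id ℝ ℝ
    exact isGaussian_map L
  | succ k ih =>
    rw [brwLaw]
    have := isGaussian_pi C (fun _ : C => (gaussianReal 0 v).prod (brwLaw C v K k))
    let L : (C → ℝ × ((Fin k → C) → ℝ)) →L[ℝ] ((Fin (k + 1) → C) → ℝ) :=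
      ContinuousLinearMap.pi fun l =>
        (ContinuousLinearMap.fst ℝ ℝ ((Fin k → C) → ℝ)
          + (ContinuousLinearMap.proj (R := ℝ) (φ := fun _ : Fin k → C => ℝ) (Fin.tail l)).comp
            (ContinuousLinearMap.snd ℝ ℝ ((Fin k → C) → ℝ))).comp
          (ContinuousLinearMap.proj (R := ℝ) (φ := fun _ : C => ℝ × ((Fin k → C) → ℝ)) (l 0))
    exact isGaussian_map L

theorem brwLaw_succ_map_eval (k : ℕ) (c : C) :
    (brwLaw C v K (k + 1)).map (fun x (l : Fin k → C) => x (Fin.cons c l : Fin (k + 1) → C))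
      = ((gaussianReal 0 v).prod (brwLaw C v K k)).map (fun p l => p.1 + p.2 l) := by
  have h := (measurePreserving_eval
    (fun _ : C => (gaussianReal 0 v).prod (brwLaw C v K k)) c).map_eq
  have e : ((Measure.pi fun _ : C => (gaussianReal 0 v).prod (brwLaw C v K k)).map
      (Function.eval c)).map (fun p l => p.1 + p.2 l)
      = ((gaussianReal 0 v).prod (brwLaw C v K k)).map (fun p l => p.1 + p.2 l) := by rw [h]
  rw [← e, brwLaw, Measure.map_map (by fun_prop) (by fun_prop),
    Measure.map_map (by fun_prop) (by fun_prop)]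
  rfl

theorem integral_brwLaw_succ (k : ℕ) (c : C) {f : ((Fin k → C) → ℝ) → ℝ} (hf : Measurable f) :
    ∫ x, f (fun l : Fin k → C => x (Fin.cons c l : Fin (k + 1) → C)) ∂(brwLaw C v K (k + 1))
      = ∫ p, f (fun l => p.1 + p.2 l) ∂((gaussianReal 0 v).prod (brwLaw C v K k)) := by
  have h := congrArg (fun ρ => ∫ x, f x ∂ρ) (brwLaw_succ_map_eval C v K k c)
  have hm : Measurable fun (x : (Fin (k + 1) → C) → ℝ) (l : Fin k → C) =>
      x (Fin.cons c l : Fin (k + 1) → C) := measurable_pi_lambda _ fun _ => measurable_pi_apply _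
  rwa [integral_map hm.aemeasurable hf.aestronglyMeasurable,
    integral_map (by fun_prop) hf.aestronglyMeasurable] at h

theorem integral_eval_brwLaw (k : ℕ) (l : Fin k → C) : ∫ x, x l ∂(brwLaw C v K k) = 0 := by
  induction k with
  | zero =>
    have hm : Measurable fun y : (Fin 0 → C) → ℝ => y l := measurable_pi_apply l
    rw [brwLaw, integral_map (by fun_prop) hm.aestronglyMeasurable]
    simp
  | succ k ih =>
    obtain ⟨c, m, rfl⟩ : ∃ c m, l = (Fin.cons c m : Fin (k + 1) → C) :=
      ⟨l 0, Fin.tail l, (Fin.cons_self_tail l).symm⟩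
    rw [integral_brwLaw_succ C v K k c (f := fun y => y m) (measurable_pi_apply m),
      integral_add, integral_fun_fst (f := fun x : ℝ => x),
      integral_fun_snd (f := fun y : (Fin k → C) → ℝ => y m), ih]
    · simp
    · exact (IsGaussian.integrable_id (μ := gaussianReal 0 v)).comp_fst _
    · exact (integrable_eval_of_isGaussian (brwLaw C v K k) _).comp_snd _

theorem integral_mul_self_gaussianReal : ∫ x, x * x ∂(gaussianReal 0 v) = v := by
  have := variance_id_gaussianReal (μ := 0) (v := v)
  rw [variance_eq_integral (by fun_prop)] at this
  simpa [sq] using this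

theorem integral_eval_mul_eval_brwLaw [DecidableEq C] (k : ℕ) (l l' : Fin k → C) :
    ∫ x, x l * x l' ∂(brwLaw C v K k) = brwCov v K k l l' := by
  induction k with
  | zero =>
    rw [brwLaw, integral_map (by fun_prop)
      (measurable_eval_mul_eval l l').aestronglyMeasurable, brwCov,
      integral_mul_self_gaussianReal]
  | succ k ih =>
    obtain ⟨c, m, rfl⟩ : ∃ c m, l = (Fin.cons c m : Fin (k + 1) → C) :=
      ⟨l 0, Fin.tail l, (Fin.cons_self_tail l).symm⟩
    obtain ⟨c', m', rfl⟩ : ∃ c m, l' = (Fin.cons c m : Fin (k + 1) → C) :=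
      ⟨l' 0, Fin.tail l', (Fin.cons_self_tail l').symm⟩
    rw [brwCov]
    simp only [Fin.cons_zero, Fin.tail_cons]
    split_ifs with hl
    · subst hl
      have hE : ∀ p : ℝ × ((Fin k → C) → ℝ), (p.1 + p.2 m) * (p.1 + p.2 m')
          = p.1 * p.1 + p.1 * p.2 m' + p.1 * p.2 m + p.2 m * p.2 m' := fun p => by ring
      have i0 : Integrable (fun x : ℝ => x) (gaussianReal 0 v) :=
        IsGaussian.integrable_id (μ := gaussianReal 0 v)
      have i1 : Integrable (fun x : ℝ => x * x) (gaussianReal 0 v) := by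
        have h2 : MemLp (fun x : ℝ => x) 2 (gaussianReal 0 v) :=
          IsGaussian.memLp_id (gaussianReal 0 v) 2 (by simp)
        exact h2.integrable_mul h2
      have i2 : ∀ l, Integrable (fun p : ℝ × ((Fin k → C) → ℝ) => p.1 * p.2 l)
          ((gaussianReal 0 v).prod (brwLaw C v K k)) := fun l =>
        i0.mul_prod (integrable_eval_of_isGaussian (brwLaw C v K k) l)
      have i3 := (integrable_eval_mul_eval_of_isGaussian (brwLaw C v K k) m m').comp_snd
        (gaussianReal 0 v)
      have i4 := i1.comp_fst (brwLaw C v K k)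
      have i5 : Integrable (fun p : ℝ × ((Fin k → C) → ℝ) => p.1 * p.1 + p.1 * p.2 m')
          ((gaussianReal 0 v).prod (brwLaw C v K k)) := i4.add (i2 m')
      have i6 : Integrable (fun p : ℝ × ((Fin k → C) → ℝ) => p.1 * p.1 + p.1 * p.2 m' + p.1 * p.2 m)
          ((gaussianReal 0 v).prod (brwLaw C v K k)) := i5.add (i2 m)
      rw [integral_brwLaw_succ C v K k c (f := fun y => y m * y m')
        (measurable_eval_mul_eval m m')]
      simp only [hE]
      rw [integral_add i6 i3, integral_add i5 (i2 _),
        integral_add i4 (i2 _), integral_fun_fst (f := fun x : ℝ => x * x),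
        integral_fun_snd (f := fun y : (Fin k → C) → ℝ => y m * y m'),
        ih, integral_prod_mul (fun x : ℝ => x) (fun y : (Fin k → C) → ℝ => y m),
        integral_prod_mul (fun x : ℝ => x) (fun y : (Fin k → C) → ℝ => y m'),
        integral_mul_self_gaussianReal]
      simp
    -- Leaves under different children are independent and centered, so their covariance is a
    -- product of vanishing means.
    · have z : ∀ c m, ∫ f : C → ℝ × ((Fin k → C) → ℝ), ((f c).1 + (f c).2 m)
            ∂(Measure.pi fun _ : C => (gaussianReal 0 v).prod (brwLaw C v K k)) = 0 := by
        intro c m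
        have := integral_eval_brwLaw C v K (k + 1) (Fin.cons c m)
        have hm : Measurable fun y : (Fin (k + 1) → C) → ℝ => y (Fin.cons c m) :=
          measurable_pi_apply _
        rw [brwLaw, integral_map (by fun_prop) hm.aestronglyMeasurable] at this
        simpa only [Fin.cons_zero, Fin.tail_cons] using this
      rw [brwLaw, integral_map (by fun_prop)
        (measurable_eval_mul_eval _ _).aestronglyMeasurable]
      simp only [Fin.cons_zero, Fin.tail_cons]
      have hi : iIndepFun (fun c (f : C → ℝ × ((Fin k → C) → ℝ)) => f c)
          (Measure.pi fun _ : C => (gaussianReal 0 v).prod (brwLaw C v K k)) :=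
        iIndepFun_pi (X := fun _ => id) (fun _ => aemeasurable_id)
      have h2 := (hi.indepFun hl).comp
        (φ := fun p : ℝ × ((Fin k → C) → ℝ) => p.1 + p.2 m)
        (ψ := fun p : ℝ × ((Fin k → C) → ℝ) => p.1 + p.2 m')
        (by fun_prop) (by fun_prop)
      have h3 := h2.integral_mul_eq_mul_integral
        (by exact Measurable.aestronglyMeasurable (by fun_prop))
        (by exact Measurable.aestronglyMeasurable (by fun_prop))
      simp only [Function.comp_def, Pi.mul_def] at h3
      rw [h3, z, zero_mul]

/-- The restriction of a set of leaves to the subtree of a child of the root. -/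
def subtree {C : Type} [Fintype C] [DecidableEq C] {k : ℕ} (A : Finset (Fin (k + 1) → C)) (c : C) :
    Finset (Fin k → C) :=
  Finset.univ.filter fun l => (Fin.cons c l : Fin (k + 1) → C) ∈ A

theorem sum_card_subtree [DecidableEq C] {k : ℕ} (A : Finset (Fin (k + 1) → C)) :
    ∑ c, (subtree A c).card = A.card := by
  rw [Finset.card_eq_sum_card_fiberwise (f := fun l => l 0) (t := Finset.univ) (by simp)]
  refine Finset.sum_congr rfl fun c _ => ?_
  refine Finset.card_bij (fun l _ => Fin.cons c l) ?_ ?_ ?_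
  · intro l hl
    simpa [subtree] using hl
  · intro l _ l' _ h
    simpa using congrArg (Fin.tail (α := fun _ : Fin (k + 1) => C)) h
  · intro l hl
    simp only [Finset.mem_filter] at hl
    refine ⟨Fin.tail l, ?_, ?_⟩
    · simp [subtree, ← hl.2, Fin.cons_self_tail, hl.1]
    · rw [← hl.2, Fin.cons_self_tail]

theorem measurableSet_exists_le {ι : Type*} (A : Finset ι) (l : ι → ℝ) :
    MeasurableSet {x : ι → ℝ | ∃ i ∈ A, l i ≤ x i} := by
  have : {x : ι → ℝ | ∃ i ∈ A, l i ≤ x i} = ⋃ i ∈ A, {x | l i ≤ x i} := by ext; simp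
  rw [this]
  exact Finset.measurableSet_biUnion _ fun i _ =>
    measurableSet_le measurable_const (measurable_pi_apply i)

theorem measureReal_prod_eq_integral {α β : Type*} [MeasurableSpace α] [MeasurableSpace β]
    (μ : Measure α) (ν : Measure β) [SFinite μ] [IsFiniteMeasure ν] {s : Set (α × β)}
    (hs : MeasurableSet s) : (μ.prod ν).real s = ∫ x, ν.real (Prod.mk x ⁻¹' s) ∂μ := by
  rw [measureReal_def, Measure.prod_apply hs]
  exact (integral_toReal (measurable_measure_prodMk_left hs).aemeasurable
    (Eventually.of_forall fun x => measure_lt_top _ _)).symm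

/-- The tail of the maximum of the branching random walk over a set of leaves. -/
def brwTail (k : ℕ) (A : Finset (Fin k → C)) (x : ℝ) : ℝ :=
  (brwLaw C v K k).real {y | ∃ l ∈ A, x ≤ y l}

theorem brwTail_nonneg (k : ℕ) (A : Finset (Fin k → C)) (x : ℝ) : 0 ≤ brwTail C v K k A x :=
  measureReal_nonneg

theorem brwTail_le_one (k : ℕ) (A : Finset (Fin k → C)) (x : ℝ) : brwTail C v K k A x ≤ 1 :=
  measureReal_le_one

theorem brwTail_antitone (k : ℕ) (A : Finset (Fin k → C)) : Antitone (brwTail C v K k A) :=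
  fun _ _ h => measureReal_mono (fun _ ⟨l, hl, hx⟩ => ⟨l, hl, h.trans hx⟩)

theorem brwTail_zero_le (A : Finset (Fin 0 → C)) (x : ℝ) :
    brwTail C v K 0 A x ≤ A.card * (gaussianReal 0 K).real (Set.Ici x) := by
  rcases A.eq_empty_or_nonempty with rfl | ⟨a, ha⟩
  · simp [brwTail]
  · have hA : A.card = 1 := by
      rw [Finset.card_eq_one]
      exact ⟨a, Finset.eq_singleton_iff_unique_mem.2 ⟨ha, fun _ _ => Subsingleton.elim _ _⟩⟩
    rw [hA, Nat.cast_one, one_mul, brwTail, brwLaw,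
      map_measureReal_apply (by fun_prop) (measurableSet_exists_le _ _)]
    exact measureReal_mono (fun y ⟨l, _, h⟩ => h)

/-- Union bound over the first generation only. Iterated alone it would give the first-moment bound;
the improvement comes from combining it at every generation with the trivial bound by 1. -/
theorem brwTail_succ_le [DecidableEq C] (k : ℕ) (A : Finset (Fin (k + 1) → C)) (x : ℝ) :
    brwTail C v K (k + 1) A x ≤
      ∑ c, ∫ g, brwTail C v K k (subtree A c) (x - g) ∂(gaussianReal 0 v) := by
  have hsub : {y : (Fin (k + 1) → C) → ℝ | ∃ l ∈ A, x ≤ y l} ⊆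
      ⋃ c ∈ (Finset.univ : Finset C),
        {y : (Fin (k + 1) → C) → ℝ | ∃ l ∈ subtree A c, x ≤ y (Fin.cons c l)} := by
    rintro y ⟨l, hl, hx⟩
    simp only [Finset.mem_univ, Set.iUnion_true, Set.mem_iUnion, Set.mem_ofPred_eq]
    exact ⟨l 0, Fin.tail l, by simpa [subtree, Fin.cons_self_tail] using hl,
      by simpa [Fin.cons_self_tail] using hx⟩
  refine (measureReal_mono hsub (measure_ne_top _ _)).trans ((measureReal_biUnion_finset_le _ _).trans ?_)
  refine Finset.sum_le_sum fun c _ => le_of_eq ?_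
  have h := brwLaw_succ_map_eval C v K k c
  have e1 : (brwLaw C v K (k + 1)).real
      {y : (Fin (k + 1) → C) → ℝ | ∃ l ∈ subtree A c, x ≤ y (Fin.cons c l)}
      = ((brwLaw C v K (k + 1)).map (fun x (l : Fin k → C) => x (Fin.cons c l))).real
        {y | ∃ l ∈ subtree A c, x ≤ y l} := by
    rw [map_measureReal_apply (by fun_prop) (measurableSet_exists_le _ _)]
    rfl
  rw [e1, h, map_measureReal_apply (by fun_prop) (measurableSet_exists_le _ _)]
  have hm : MeasurableSet ((fun (p : ℝ × ((Fin k → C) → ℝ)) l => p.1 + p.2 l) ⁻¹'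
      {y | ∃ l ∈ subtree A c, x ≤ y l}) := by
    exact (by fun_prop : Measurable (fun (p : ℝ × ((Fin k → C) → ℝ)) l => p.1 + p.2 l))
      (measurableSet_exists_le _ _)
  rw [measureReal_prod_eq_integral _ _ hm]
  refine integral_congr_ae (Eventually.of_forall fun g => ?_)
  simp only [brwTail]
  congr 1
  ext y
  simp [add_comm]

end BranchingRandomWalk

/-! ### Comparison of the field with the branching random walk -/

section Embedding

/-- The binary digits of the coordinates of a point, most significant digit first, as a leaf of the
tree of depth `k`. -/
def digits {d : ℕ} : (k : ℕ) → (Fin d → ℕ) → Fin k → (Fin d → Bool)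
  | 0, _ => Fin.elim0
  | k + 1, u => (Fin.cons (fun i => decide (2 ^ k ≤ u i)) (digits k fun i => u i % 2 ^ k) :
      Fin (k + 1) → (Fin d → Bool))

theorem brwCov_self {C : Type} [Fintype C] [DecidableEq C] (v K : ℝ≥0) (k : ℕ) (l : Fin k → C) :
    brwCov v K k l l = k * v + K := by
  induction k with
  | zero => simp [brwCov]
  | succ k ih => simp only [brwCov, if_true, ih]; push_cast; ring

theorem norm_toLp_le_of_abs_le {d : ℕ} {x : Fin d → ℝ} {r : ℝ} (hr : 0 ≤ r)
    (h : ∀ i, |x i| ≤ r) : ‖(WithLp.toLp 2 x : EuclideanSpace ℝ (Fin d))‖ ≤ √d * r := by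
  rw [EuclideanSpace.norm_eq]
  have : ∑ i, ‖x i‖ ^ 2 ≤ d * r ^ 2 := by
    calc ∑ i, ‖x i‖ ^ 2 ≤ ∑ _i : Fin d, r ^ 2 := by
          refine Finset.sum_le_sum fun i _ => ?_
          have := h i
          rw [Real.norm_eq_abs]; gcongr
      _ = d * r ^ 2 := by simp
  calc _ ≤ √(d * r ^ 2) := Real.sqrt_le_sqrt this
    _ = √d * r := by rw [Real.sqrt_mul (by positivity), Real.sqrt_sq hr]

/-- If two points separate with `j` levels left, they share a dyadic cube of side `2 ^ j`, so their
distance is at most `√d * 2 ^ j`, while the covariance deficit is `j log 2 + K`. The term `log d /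
2` in `K` pays for `√d`, and `2 α₀` for the additive constant. Nearby points that separate early in
the tree are harmless, since only this direction is needed. -/
theorem posLog_add_le_sub_brwCov {d : ℕ} (hd : 1 ≤ d) {α₀ : ℝ} {v K : ℝ≥0}
    (hv : (v : ℝ) = Real.log 2) (hK : (K : ℝ) = Real.log d / 2 + 2 * α₀) (k : ℕ)
    (u w : Fin d → ℕ) (hu : ∀ i, u i < 2 ^ k) (hw : ∀ i, w i < 2 ^ k) (huw : u ≠ w) :
    Real.posLog ‖(WithLp.toLp 2 (fun i => (u i : ℝ) - (w i : ℝ)) : EuclideanSpace ℝ (Fin d))‖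
      + 2 * α₀ ≤ k * v + K - brwCov v K k (digits k u) (digits k w) := by
  have hlogd : 0 ≤ Real.log d := Real.log_natCast_nonneg d
  induction k generalizing u w with
  | zero =>
    exfalso; apply huw; funext i
    have := hu i; have := hw i
    simp only [pow_zero, Nat.lt_one_iff] at *; omega
  | succ k ih =>
    simp only [brwCov, digits, Fin.cons_zero, Fin.tail_cons]
    split_ifs with h
    · have htop : ∀ i, (2 ^ k ≤ u i ↔ 2 ^ k ≤ w i) := fun i => by
        simpa using congrFun h i
      have hmod : ∀ n : ℕ, n < 2 ^ (k + 1) → n % 2 ^ k = if 2 ^ k ≤ n then n - 2 ^ k else n := by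
        intro n hn
        rw [pow_succ] at hn
        split_ifs with hn'
        · rw [Nat.mod_eq_sub_mod hn', Nat.mod_eq_of_lt (by omega)]
        · exact Nat.mod_eq_of_lt (by omega)
      have hsub : ∀ i, ((u i % 2 ^ k : ℕ) : ℝ) - ((w i % 2 ^ k : ℕ) : ℝ) = (u i : ℝ) - (w i : ℝ) := by
        intro i
        rw [hmod _ (hu i), hmod _ (hw i)]
        by_cases h1 : 2 ^ k ≤ u i
        · have h2 := (htop i).1 h1
          rw [if_pos h1, if_pos h2, Nat.cast_sub h1, Nat.cast_sub h2]; ring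
        · have h2 := fun h => h1 ((htop i).2 h)
          rw [if_neg h1, if_neg h2]
      have hne : (fun i => u i % 2 ^ k) ≠ fun i => w i % 2 ^ k := by
        intro he; apply huw; funext i
        have h1 := hsub i
        have h2 : u i % 2 ^ k = w i % 2 ^ k := congrFun he i
        rw [h2, sub_self] at h1
        exact_mod_cast (sub_eq_zero.1 h1.symm)
      have := ih (fun i => u i % 2 ^ k) (fun i => w i % 2 ^ k)
        (fun i => Nat.mod_lt _ (by positivity)) (fun i => Nat.mod_lt _ (by positivity)) hne
      simp only [hsub] at this
      push_cast
      linarith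
    · rw [sub_zero, hK, hv]
      have hd' : (1 : ℝ) ≤ d := by exact_mod_cast hd
      have hb : ‖(WithLp.toLp 2 (fun i => (u i : ℝ) - (w i : ℝ)) : EuclideanSpace ℝ (Fin d))‖
          ≤ √d * 2 ^ (k + 1) := by
        refine norm_toLp_le_of_abs_le (by positivity) fun i => ?_
        have h1 : (u i : ℝ) < 2 ^ (k + 1) := by exact_mod_cast hu i
        have h2 : (w i : ℝ) < 2 ^ (k + 1) := by exact_mod_cast hw i
        have h3 : (0 : ℝ) ≤ u i := by positivity
        have h4 : (0 : ℝ) ≤ w i := by positivity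
        rw [abs_le]; constructor <;> linarith
      have h1 : (1 : ℝ) ≤ √d * 2 ^ (k + 1) :=
        one_le_mul_of_one_le_of_one_le (Real.one_le_sqrt.2 hd') (one_le_pow₀ (by norm_num))
      have h2 := Real.posLog_le_posLog (norm_nonneg _) hb
      rw [Real.posLog_eq_log (x := √d * 2 ^ (k + 1)) (by rwa [abs_of_pos (by linarith)]),
        Real.log_mul (by positivity) (by positivity), Real.log_sqrt (by positivity),
        Real.log_pow] at h2
      linarith

/-- The leaf at depth `k` associated with a point of the box. -/
def leaf {d N : ℕ} (k : ℕ) (u : Box d N) : Fin k → (Fin d → Bool) :=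
  digits k fun i => (u i : ℕ)

theorem posLog_eucDist_le {d : ℕ} (hd : 1 ≤ d) {α₀ : ℝ} {v K : ℝ≥0}
    (hv : (v : ℝ) = Real.log 2) (hK : (K : ℝ) = Real.log d / 2 + 2 * α₀) {k N : ℕ}
    (hN : N ≤ 2 ^ k) {u w : Box d N} (huw : u ≠ w) :
    Real.posLog (eucDist u w) + 2 * α₀ ≤ k * v + K - brwCov v K k (leaf k u) (leaf k w) := by
  refine posLog_add_le_sub_brwCov hd hv hK k _ _ (fun i => (u i).2.trans_le hN)
    (fun i => (w i).2.trans_le hN) fun h => huw ?_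
  funext i
  exact Fin.ext (congrFun h i)

theorem half_le_gaussianReal_Ici_zero (v : ℝ≥0) : 1 / 2 ≤ (gaussianReal 0 v).real (Set.Ici 0) := by
  have h1 : (gaussianReal 0 v).real (Set.Iic 0) = (gaussianReal 0 v).real (Set.Ici 0) := by
    have h : (gaussianReal 0 v).map (fun x => -x) = gaussianReal 0 v := by
      rw [gaussianReal_map_neg, neg_zero]
    conv_lhs => rw [← h]
    rw [map_measureReal_apply (by fun_prop) measurableSet_Iic]
    congr 1
    ext x; simp
  have h2 : (1 : ℝ) ≤ (gaussianReal 0 v).real (Set.Iic 0) + (gaussianReal 0 v).real (Set.Ici 0) := by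
    rw [← probReal_univ (μ := gaussianReal 0 v), ← Set.Iic_union_Ici (a := (0 : ℝ))]
    exact measureReal_union_le _ _
  linarith

theorem sq_sqrt_sub_sqrt_le {x y : ℝ} (hx : 0 ≤ x) (hy : 0 ≤ y) : (√x - √y) ^ 2 ≤ |x - y| := by
  have h1 := Real.sq_sqrt hx
  have h2 := Real.sq_sqrt hy
  have h3 := Real.sqrt_nonneg x
  have h4 := Real.sqrt_nonneg y
  rcases le_total x y with h | h
  · have := Real.sqrt_le_sqrt h
    rw [abs_of_nonpos (by linarith)]; nlinarith
  · have := Real.sqrt_le_sqrt h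
    rw [abs_of_nonneg (by linarith)]; nlinarith

/-- A common Gaussian with vertex-dependent weights tops up all variances to that of a BRW leaf,
after which Slepian's inequality applies. -/
theorem measureReal_exists_le_le_two_mul_brwTail {d : ℕ} (hd : 1 ≤ d) {α₀ : ℝ} (hα₀ : 0 < α₀)
    {v K : ℝ≥0} (hv : (v : ℝ) = Real.log 2) (hK : (K : ℝ) = Real.log d / 2 + 2 * α₀) {k N : ℕ}
    (hN : N ≤ 2 ^ k) (hN1 : 1 ≤ N)
    {Ω : Type*} [MeasurableSpace Ω] {P : Measure Ω} [IsProbabilityMeasure P]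
    {φ : Box d N → Ω → ℝ} (hG : IsCenteredGaussianField φ P) (hL : IsLogBounded α₀ φ P)
    (A : Finset (Box d N)) (r : ℝ) :
    P.real {ω | ∃ u ∈ A, r ≤ φ u ω}
      ≤ 2 * brwTail (Fin d → Bool) v K k (A.image (leaf k)) r := by
  have hφm : ∀ u, AEMeasurable (φ u) P := hG.gaussian.aemeasurable
  have hφM : AEMeasurable (fun ω u => φ u ω) P := aemeasurable_pi_lambda _ hφm
  set μ : Measure (Box d N → ℝ) := P.map (fun ω u => φ u ω) with hμ
  have hμG : IsGaussian μ := by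
    have h1 := (hG.gaussian.hasGaussianLaw Finset.univ).isGaussian_map
    let L : (↥(Finset.univ : Finset (Box d N)) → ℝ) →L[ℝ] (Box d N → ℝ) :=
      ContinuousLinearMap.pi fun u =>
        ContinuousLinearMap.proj (R := ℝ) (φ := fun _ : ↥(Finset.univ : Finset (Box d N)) => ℝ)
          ⟨u, Finset.mem_univ u⟩
    have h2 : IsGaussian
        ((P.map fun ω => (Finset.univ : Finset (Box d N)).restrict (φ · ω)).map L) :=
      isGaussian_map L
    have hm : AEMeasurable (fun ω => (Finset.univ : Finset (Box d N)).restrict (φ · ω)) P :=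
      aemeasurable_pi_lambda _ fun u => hφm u
    rwa [AEMeasurable.map_map_of_aemeasurable (by fun_prop) hm] at h2
  have hmap : ∀ f : (Box d N → ℝ) → ℝ, Measurable f → ∫ x, f x ∂μ = ∫ ω, f (fun u => φ u ω) ∂P :=
    fun f hf => integral_map hφM hf.aestronglyMeasurable
  have hc : ∀ u, ∫ x, x u ∂μ = 0 := fun u => by
    rw [hmap (fun x => x u) (measurable_pi_apply u), hG.centered]
  have hvar : ∀ u, ∫ x, x u * x u ∂μ = variance (φ u) P := fun u => by
    rw [hmap (fun x => x u * x u) (measurable_eval_mul_eval u u),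
      variance_of_integral_eq_zero (hφm u) (hG.centered u)]
    simp [sq]
  have hinc : ∀ u w, ∫ ω, (φ u ω - φ w ω) ^ 2 ∂P
      = variance (φ u) P + variance (φ w) P - 2 * ∫ x, x u * x w ∂μ := fun u w => by
    have hm : Measurable fun x : Box d N → ℝ => (x u - x w) ^ 2 :=
      ((measurable_pi_apply u).sub (measurable_pi_apply w)).pow_const 2
    rw [← hmap (fun x => (x u - x w) ^ 2) hm, ← hvar, ← hvar]
    have e : ∀ x : Box d N → ℝ, (x u - x w) ^ 2 = x u * x u + x w * x w - 2 * (x u * x w) :=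
      fun x => by ring
    simp only [e]
    have i := integrable_eval_mul_eval_of_isGaussian μ
    have i' : Integrable (fun x : Box d N → ℝ => x u * x u + x w * x w) μ := (i u u).add (i w w)
    rw [integral_sub i' ((i u w).const_mul 2), integral_add (i u u) (i w w),
      integral_const_mul]
  set V : ℝ := k * v + K with hV
  have hlogN : Real.log N ≤ k * v := by
    rw [hv, ← Real.log_pow]
    refine Real.log_le_log (by exact_mod_cast hN1) ?_
    exact_mod_cast hN
  have hgap : ∀ u, 0 ≤ V - variance (φ u) P := fun u => by
    have := hL.variance_le u
    have := Real.log_natCast_nonneg d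
    rw [hV, hK]; linarith
  -- The weight that raises the variance at `u` exactly to `V`; the missing variance is nonnegative
  -- by the variance hypothesis.
  let a : Box d N → ℝ := fun u => √(V - variance (φ u) P)
  let T : (Box d N → ℝ) × ℝ →L[ℝ] (Box d N → ℝ) :=
    ContinuousLinearMap.fst ℝ (Box d N → ℝ) ℝ +
      (ContinuousLinearMap.pi fun u => a u • ContinuousLinearMap.id ℝ ℝ).comp
        (ContinuousLinearMap.snd ℝ (Box d N → ℝ) ℝ)
  have hT : ∀ p u, T p u = p.1 u + a u * p.2 := fun p u => by simp [T]
  set ρ : Measure (Box d N → ℝ) := (μ.prod (gaussianReal 0 1)).map T with hρ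
  let R : ((Fin k → (Fin d → Bool)) → ℝ) →L[ℝ] (Box d N → ℝ) :=
    ContinuousLinearMap.pi fun u =>
      ContinuousLinearMap.proj (R := ℝ) (φ := fun _ : Fin k → (Fin d → Bool) => ℝ) (leaf k u)
  set ν : Measure (Box d N → ℝ) := (brwLaw (Fin d → Bool) v K k).map R with hν
  have hρG : IsGaussian ρ := isGaussian_map T
  have hνG : IsGaussian ν := isGaussian_map R
  have g0 : ∫ x, x ∂(gaussianReal 0 1) = 0 := by simp
  have i0 : Integrable (fun x : ℝ => x) (gaussianReal 0 1) :=
    IsGaussian.integrable_id (μ := gaussianReal 0 1)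
  have i1 : Integrable (fun x : ℝ => x * x) (gaussianReal 0 1) := by
    have h2 : MemLp (fun x : ℝ => x) 2 (gaussianReal 0 1) :=
      IsGaussian.memLp_id (gaussianReal 0 1) 2 (by simp)
    exact h2.integrable_mul h2
  have hρcov : ∀ u w, ∫ x, x u * x w ∂ρ = ∫ x, x u * x w ∂μ + a u * a w := by
    intro u w
    rw [hρ, integral_map (by fun_prop) (measurable_eval_mul_eval u w).aestronglyMeasurable]
    have e : ∀ p : (Box d N → ℝ) × ℝ, T p u * T p w
        = p.1 u * p.1 w + a w * (p.1 u * p.2) + a u * (p.1 w * p.2) + a u * a w * (p.2 * p.2) :=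
      fun p => by rw [hT, hT]; ring
    simp only [e]
    have j1 := (integrable_eval_mul_eval_of_isGaussian μ u w).comp_fst (gaussianReal 0 1)
    have j2 : ∀ u c, Integrable (fun p : (Box d N → ℝ) × ℝ => c * (p.1 u * p.2))
        (μ.prod (gaussianReal 0 1)) := fun u c =>
      ((integrable_eval_of_isGaussian μ u).mul_prod i0).const_mul c
    have j3 : Integrable (fun p : (Box d N → ℝ) × ℝ => a u * a w * (p.2 * p.2))
        (μ.prod (gaussianReal 0 1)) := (i1.comp_snd μ).const_mul _
    have j4 : Integrable (fun p : (Box d N → ℝ) × ℝ => p.1 u * p.1 w + a w * (p.1 u * p.2))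
        (μ.prod (gaussianReal 0 1)) := j1.add (j2 u _)
    have j5 : Integrable (fun p : (Box d N → ℝ) × ℝ => p.1 u * p.1 w + a w * (p.1 u * p.2)
        + a u * (p.1 w * p.2)) (μ.prod (gaussianReal 0 1)) := j4.add (j2 w _)
    rw [integral_add j5 j3, integral_add j4 (j2 w _), integral_add j1 (j2 u _),
      integral_const_mul, integral_const_mul, integral_const_mul,
      integral_fun_fst (f := fun x : Box d N → ℝ => x u * x w),
      integral_fun_snd (f := fun x : ℝ => x * x),
      integral_prod_mul (fun x : Box d N → ℝ => x u) (fun x : ℝ => x),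
      integral_prod_mul (fun x : Box d N → ℝ => x w) (fun x : ℝ => x), g0,
      integral_mul_self_gaussianReal]
    simp
  have hρc : ∀ u, ∫ x, x u ∂ρ = 0 := by
    intro u
    have hm : Measurable fun x : Box d N → ℝ => x u := measurable_pi_apply u
    rw [hρ, integral_map (by fun_prop) hm.aestronglyMeasurable]
    simp only [hT]
    rw [integral_add ((integrable_eval_of_isGaussian μ u).comp_fst _)
      ((i0.comp_snd μ).const_mul _), integral_const_mul,
      integral_fun_fst (f := fun x : Box d N → ℝ => x u), integral_fun_snd (f := fun x : ℝ => x),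
      g0, hc]
    simp
  have hνcov : ∀ u w, ∫ x, x u * x w ∂ν = brwCov v K k (leaf k u) (leaf k w) := by
    intro u w
    rw [hν, integral_map (by fun_prop) (measurable_eval_mul_eval u w).aestronglyMeasurable,
      ← integral_eval_mul_eval_brwLaw]
    rfl
  have hνc : ∀ u, ∫ x, x u ∂ν = 0 := by
    intro u
    have hm : Measurable fun x : Box d N → ℝ => x u := measurable_pi_apply u
    rw [hν, integral_map (by fun_prop) hm.aestronglyMeasurable]
    exact integral_eval_brwLaw _ v K k (leaf k u)
  -- In `2 (a u) (a w) = a u ^ 2 + a w ^ 2 - (a u - a w) ^ 2` the last square is at most the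
  -- absolute difference of the variances. This is compensated by the variance-difference term in
  -- the increment hypothesis, leaving the modified covariance at least `V - log₊ |u - w| - 2 α₀`.
  have hdom : CovDominates ρ ν := by
    refine ⟨hρc, hνc, fun u => ?_, fun u w huw => ?_⟩
    · rw [hρcov, hνcov, brwCov_self, hvar, Real.mul_self_sqrt (hgap u)]
      rw [hV]; ring
    · rw [hρcov, hνcov]
      have h1 := posLog_eucDist_le hd hv hK hN huw
      have h2 := hL.increment_le u w
      rw [hinc, abs_sub_comm] at h2
      simp only [mul_comm (_ : ℝ) ((_ : Box d N → ℝ) u)] at h2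
      have h3 := sq_sqrt_sub_sqrt_le (hgap u) (hgap w)
      have h4 := Real.sq_sqrt (hgap u)
      have h5 := Real.sq_sqrt (hgap w)
      rw [show V - variance (φ u) P - (V - variance (φ w) P)
        = -(variance (φ u) P - variance (φ w) P) by ring, abs_neg] at h3
      have h6 : (a u - a w) ^ 2 = a u ^ 2 - 2 * (a u * a w) + a w ^ 2 := by ring
      simp only [a] at h6 ⊢
      linarith
  have hS := hdom.measureReal_exists_le ρ ν A r
  have hνA : ν.real {x | ∃ u ∈ A, r ≤ x u}
      = brwTail (Fin d → Bool) v K k (A.image (leaf k)) r := by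
    rw [hν, map_measureReal_apply (by fun_prop) (measurableSet_exists_le _ _), brwTail]
    congr 1
    ext x
    simp [R]
  have hμA : P.real {ω | ∃ u ∈ A, r ≤ φ u ω} = μ.real {x | ∃ u ∈ A, r ≤ x u} := by
    rw [hμ, measureReal_def, measureReal_def,
      Measure.map_apply_of_aemeasurable hφM (measurableSet_exists_le _ _)]
    rfl
  -- When the common Gaussian is nonnegative, the added term can only raise the field, and it is
  -- independent of the field.
  have hρA : μ.real {x | ∃ u ∈ A, r ≤ x u} * (1 / 2) ≤ ρ.real {x | ∃ u ∈ A, r ≤ x u} := by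
    have e : ρ.real {x | ∃ u ∈ A, r ≤ x u}
        = (μ.prod (gaussianReal 0 1)).real (T ⁻¹' {x | ∃ u ∈ A, r ≤ x u}) :=
      map_measureReal_apply (by fun_prop) (measurableSet_exists_le _ _)
    rw [e]
    calc _ ≤ μ.real {x | ∃ u ∈ A, r ≤ x u} * (gaussianReal 0 1).real (Set.Ici 0) := by
          gcongr; exact half_le_gaussianReal_Ici_zero 1
      _ = (μ.prod (gaussianReal 0 1)).real ({x | ∃ u ∈ A, r ≤ x u} ×ˢ Set.Ici 0) :=
          (measureReal_prod_prod _ _).symm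
      _ ≤ _ := by
          refine measureReal_mono ?_
          rintro ⟨x, g⟩ ⟨⟨u, hu, hx⟩, hg⟩
          refine ⟨u, hu, ?_⟩
          simp only at hx
          rw [hT]
          have : 0 ≤ a u * g := mul_nonneg (Real.sqrt_nonneg _) hg
          simp only
          linarith
  rw [hμA, ← hνA]
  linarith

end Embedding

/-! ### The profile inequality in three regimes of distance from the origin -/

section Profile

theorem exp_sub_one_le_two_mul {x : ℝ} (h0 : 0 ≤ x) (h1 : x ≤ 1) : Real.exp x - 1 ≤ 2 * x := by
  have h2 := Real.abs_exp_sub_one_le (x := x) (by rwa [abs_of_nonneg h0])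
  rw [abs_of_nonneg h0] at h2
  exact (le_abs_self _).trans h2

/-- The inequality for one shift step of the profile, far from the boundary. -/
theorem profile_step_far {v E A κ qt qs t ε y : ℝ} (hv : 0 < v) (hE : 0 < E) (hA : 0 < A)
    (hκ : 0 < κ) (hq : qt ≤ qs) (hqs : 0 ≤ qs) (hqs2 : qs ≤ 2) (ht : 1 ≤ t) (hε : 0 ≤ ε)
    (hεE : ε ≤ 2 * E / (t + 1)) (hεy : ε ≤ y) (hy0 : 0 < y) (hyE : 48 * E ≤ y)
    (hyt : 192 * v * t ≤ y ^ 2)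
    (hexp : Real.exp (-(y ^ 2 / (8 * v * (t + 1)))) * (96 * A * E) ≤ κ) :
    A * qt * y * Real.exp (-(y ^ 2 / (2 * v * (t + 1))))
        + κ * Real.exp (3 / (2 * t)) * Real.exp (-(y ^ 2 / (2 * v * (2 * t + 1))))
      ≤ A * qs * (y + ε) * Real.exp (-((y + ε) ^ 2 / (2 * v * (t + 1))))
        + κ * Real.exp (-((y + ε) ^ 2 / (4 * v * (t + 1)))) := by
  obtain ⟨s, hs⟩ : ∃ s, s = t + 1 := ⟨_, rfl⟩
  simp only [← hs] at hεE hexp ⊢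
  have hs0 : 0 < s := by linarith
  have hts : s ≤ 2 * t := by linarith
  set w := (2 * y * ε + ε ^ 2) / (2 * v * s) with hw
  have hw0 : 0 ≤ w := by positivity
  have hw1 : w ≤ 3 * y * E / (v * s ^ 2) := by
    have h1 : 2 * y * ε + ε ^ 2 ≤ 3 * y * ε := by nlinarith
    have h2 : 3 * y * ε ≤ 3 * y * (2 * E / s) := by gcongr
    calc w ≤ (3 * y * (2 * E / s)) / (2 * v * s) := by rw [hw]; gcongr; linarith
      _ = 3 * y * E / (v * s ^ 2) := by field_simp
  set b := Real.exp (-(y ^ 2 / (2 * v * s))) with hb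
  set b' := Real.exp (-((y + ε) ^ 2 / (2 * v * s))) with hb'
  set e1 := Real.exp (-(y ^ 2 / (2 * v * (2 * t + 1)))) with he1
  have b0 : 0 < b := Real.exp_pos _
  have b'0 : 0 < b' := Real.exp_pos _
  have e10 : 0 < e1 := Real.exp_pos _
  have hbw : b * (1 - w) ≤ b' := by
    have : b' = b * Real.exp (-w) := by
      rw [hb, hb', ← Real.exp_add]; congr 1; rw [hw]; field_simp; ring
    rw [this]
    gcongr
    linarith [Real.add_one_le_exp (-w)]
  -- the exponent gained by the second term
  set D := y ^ 2 / (2 * v * (2 * t + 1)) - (y + ε) ^ 2 / (4 * v * s) - 3 / (2 * t) with hD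
  have hD1 : y ^ 2 / (16 * v * s ^ 2) ≤ D := by
    have h1 : y ^ 2 / (2 * v * (2 * t + 1)) - y ^ 2 / (4 * v * s) ≥ y ^ 2 / (8 * v * s ^ 2) := by
      have : y ^ 2 / (2 * v * (2 * t + 1)) - y ^ 2 / (4 * v * s)
          = y ^ 2 / (4 * v * s * (2 * t + 1)) := by
        rw [hs]; field_simp; ring
      rw [this, ge_iff_le]
      apply div_le_div_of_nonneg_left (by positivity) (by positivity)
      have : 4 * v * s * (2 * t + 1) ≤ 4 * v * s * (2 * s) := by gcongr; linarith
      calc _ ≤ _ := this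
        _ = _ := by ring
    have h2 : (y + ε) ^ 2 / (4 * v * s) = y ^ 2 / (4 * v * s) + w / 2 := by
      rw [hw]; field_simp; ring
    have h3 : w / 2 ≤ y ^ 2 / (32 * v * s ^ 2) := by
      calc w / 2 ≤ (3 * y * E / (v * s ^ 2)) / 2 := by gcongr
        _ = y * (48 * E) / (32 * v * s ^ 2) := by field_simp; norm_num
        _ ≤ y * y / (32 * v * s ^ 2) := by gcongr
        _ = _ := by rw [← sq]
    have h4 : 3 / (2 * t) ≤ y ^ 2 / (32 * v * s ^ 2) := by
      rw [div_le_div_iff₀ (by positivity) (by positivity)]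
      have h5 : s ^ 2 ≤ 4 * t ^ 2 := by nlinarith
      have h6 : v * s ^ 2 ≤ v * (4 * t ^ 2) := by gcongr
      have h7 : 192 * v * t * (2 * t) ≤ y ^ 2 * (2 * t) := by gcongr
      nlinarith
    have h5 : y ^ 2 / (8 * v * s ^ 2) = y ^ 2 / (16 * v * s ^ 2)
        + (y ^ 2 / (32 * v * s ^ 2) + y ^ 2 / (32 * v * s ^ 2)) := by field_simp; norm_num
    rw [hD]; linarith
  have hD0 : 0 ≤ D := le_trans (by positivity) hD1
  have hG2 : e1 * D ≤ Real.exp (-((y + ε) ^ 2 / (4 * v * s))) - Real.exp (3 / (2 * t)) * e1 := by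
    have : Real.exp (-((y + ε) ^ 2 / (4 * v * s))) = Real.exp (3 / (2 * t)) * e1 * Real.exp D := by
      rw [he1, ← Real.exp_add, ← Real.exp_add]; congr 1; rw [hD]; ring
    rw [this]
    have h1 : 1 ≤ Real.exp (3 / (2 * t)) := Real.one_le_exp (by positivity)
    have h2 := Real.add_one_le_exp D
    calc e1 * D = 1 * e1 * D := by ring
      _ ≤ Real.exp (3 / (2 * t)) * e1 * (Real.exp D - 1) := by gcongr; linarith
      _ = _ := by ring
  -- Far out, the main Gaussian is exponentially smaller than the correction, whose variance is
  -- about twice as large. The loss `w` of the main term can therefore be charged to the gain `D` of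
  -- the correction.
  have hbe : b ≤ e1 * Real.exp (-(y ^ 2 / (8 * v * s))) := by
    rw [hb, he1, ← Real.exp_add, Real.exp_le_exp]
    have : y ^ 2 / (2 * v * s) - y ^ 2 / (2 * v * (2 * t + 1)) = y ^ 2 * t / (2 * v * s * (2 * t + 1)) := by
      rw [hs]; field_simp; ring
    have h2 : y ^ 2 / (8 * v * s) ≤ y ^ 2 * t / (2 * v * s * (2 * t + 1)) := by
      rw [div_le_div_iff₀ (by positivity) (by positivity)]
      have : 0 ≤ y ^ 2 * v * s := by positivity
      nlinarith
    linarith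
  have hmain : A * qs * (y * b * w) ≤ κ * (e1 * D) := by
    calc A * qs * (y * b * w)
        ≤ A * 2 * (y * (e1 * Real.exp (-(y ^ 2 / (8 * v * s)))) * (3 * y * E / (v * s ^ 2))) := by
          gcongr
      _ = (Real.exp (-(y ^ 2 / (8 * v * s))) * (96 * A * E)) * (e1 * (y ^ 2 / (16 * v * s ^ 2))) := by
          field_simp; norm_num
      _ ≤ κ * (e1 * D) := by gcongr
  have h1 : A * qt * y * b ≤ A * qs * y * b := by gcongr
  have h2 : A * qs * (y * (b * (1 - w))) ≤ A * qs * (y * b') := by gcongr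
  have h3 : 0 ≤ A * qs * ε * b' := by positivity
  have h4 := mul_le_mul_of_nonneg_left hG2 hκ.le
  linarith

/-- The inequality for one shift step of the profile, at moderate distance from the boundary. -/
theorem profile_step_near {v A κ qt qs t ε y : ℝ} (hv : 0 < v)
    (hκ : 0 < κ) (ht : 2 ≤ t) (hε : 0 ≤ ε) (hy0 : 0 ≤ y)
    (h : κ * (3 / t + (2 * y * ε + ε ^ 2) / (4 * v * (t + 1)))
      ≤ A * qs * (y + ε) * Real.exp (-((y + ε) ^ 2 / (2 * v * (t + 1))))
        - A * qt * y * Real.exp (-(y ^ 2 / (2 * v * (t + 1))))) :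
    A * qt * y * Real.exp (-(y ^ 2 / (2 * v * (t + 1))))
        + κ * Real.exp (3 / (2 * t)) * Real.exp (-(y ^ 2 / (2 * v * (2 * t + 1))))
      ≤ A * qs * (y + ε) * Real.exp (-((y + ε) ^ 2 / (2 * v * (t + 1))))
        + κ * Real.exp (-((y + ε) ^ 2 / (4 * v * (t + 1)))) := by
  set e := Real.exp (-(y ^ 2 / (4 * v * (t + 1)))) with he
  set w := (2 * y * ε + ε ^ 2) / (4 * v * (t + 1)) with hw
  have hw0 : 0 ≤ w := by positivity
  have he0 : 0 < e := Real.exp_pos _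
  have he1 : e ≤ 1 := Real.exp_le_one_iff.2 (by rw [neg_nonpos]; positivity)
  have h1 : Real.exp (-(y ^ 2 / (2 * v * (2 * t + 1)))) ≤ e := by
    rw [he, Real.exp_le_exp, neg_le_neg_iff]
    apply div_le_div_of_nonneg_left (by positivity) (by positivity)
    nlinarith
  have h2 : e * (1 - w) ≤ Real.exp (-((y + ε) ^ 2 / (4 * v * (t + 1)))) := by
    have : Real.exp (-((y + ε) ^ 2 / (4 * v * (t + 1)))) = e * Real.exp (-w) := by
      rw [he, ← Real.exp_add]; congr 1; rw [hw]; field_simp; ring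
    rw [this]; gcongr; linarith [Real.add_one_le_exp (-w)]
  have h3 : Real.exp (3 / (2 * t)) - 1 ≤ 2 * (3 / (2 * t)) :=
    exp_sub_one_le_two_mul (by positivity) (by rw [div_le_one (by positivity)]; linarith)
  have h4 : 2 * (3 / (2 * t)) = 3 / t := by field_simp
  rw [h4] at h3
  have h5 : Real.exp (3 / (2 * t)) * Real.exp (-(y ^ 2 / (2 * v * (2 * t + 1))))
      - Real.exp (-((y + ε) ^ 2 / (4 * v * (t + 1)))) ≤ 3 / t + w := by
    have h6 : Real.exp (3 / (2 * t)) * Real.exp (-(y ^ 2 / (2 * v * (2 * t + 1))))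
      ≤ Real.exp (3 / (2 * t)) * e := by gcongr
    have h7 : 0 ≤ 3 / t := by positivity
    have h9 : 1 ≤ Real.exp (3 / (2 * t)) := Real.one_le_exp (by positivity)
    have h8 : e * (Real.exp (3 / (2 * t)) - 1 + w) ≤ 1 * (3 / t + w) := by
      gcongr
    linarith
  have := mul_le_mul_of_nonneg_left h5 hκ.le
  linarith

/-- Lower bound for the increment of the main term of the profile under a shift. -/
theorem sub_le_shift_main_term {v A qt qs s ε y : ℝ} (hv : 0 < v) (hA : 0 ≤ A) (hqs : 0 ≤ qs)
    (hs : 0 < s) (hy0 : 0 ≤ y) :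
    A * (qs * (ε * Real.exp (-((y + ε) ^ 2 / (2 * v * s)))
        - y * Real.exp (-(y ^ 2 / (2 * v * s))) * ((2 * y * ε + ε ^ 2) / (2 * v * s)))
        + (qs - qt) * (y * Real.exp (-(y ^ 2 / (2 * v * s)))))
      ≤ A * qs * (y + ε) * Real.exp (-((y + ε) ^ 2 / (2 * v * s)))
        - A * qt * y * Real.exp (-(y ^ 2 / (2 * v * s))) := by
  set b := Real.exp (-(y ^ 2 / (2 * v * s))) with hb
  set b' := Real.exp (-((y + ε) ^ 2 / (2 * v * s))) with hb'
  set w := (2 * y * ε + ε ^ 2) / (2 * v * s) with hw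
  have hbw : b * (1 - w) ≤ b' := by
    have : b' = b * Real.exp (-w) := by
      rw [hb, hb', ← Real.exp_add]; congr 1; rw [hw]; field_simp; ring
    rw [this]
    gcongr
    linarith [Real.add_one_le_exp (-w)]
  have h2 : A * qs * (y * (b * (1 - w))) ≤ A * qs * (y * b') := by gcongr
  linarith

/-- For `y` at most a small multiple of `√t`, the linear factor gains from the displacement `ε ≥ E /
(t + 1)`. The gain, at least `3 A ε / 8`, beats the order `1 / t` growth of the correction once `A`
is large relative to `κ` and `κ / E`. -/
theorem profile_step_near_boundary {v E A κ qt qs t ε y : ℝ} (hv : 0 < v) (hE : 0 < E)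
    (hκ : 0 < κ) (hq : qt ≤ qs) (hqs : 1 ≤ qs) (ht : 2 ≤ t) (hεE : E / (t + 1) ≤ ε)
    (hε1 : ε ≤ 1) (hy0 : 0 ≤ y) (hyt : y ^ 2 ≤ v * (t + 1) / 8) (htv : 4 ≤ v * (t + 1))
    (hAE : 20 * κ ≤ A * E) (hAκ : 2 * κ ≤ A) :
    A * qt * y * Real.exp (-(y ^ 2 / (2 * v * (t + 1))))
        + κ * Real.exp (3 / (2 * t)) * Real.exp (-(y ^ 2 / (2 * v * (2 * t + 1))))
      ≤ A * qs * (y + ε) * Real.exp (-((y + ε) ^ 2 / (2 * v * (t + 1))))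
        + κ * Real.exp (-((y + ε) ^ 2 / (4 * v * (t + 1)))) := by
  have hA : 0 < A := by linarith
  have hε0 : 0 ≤ ε := le_trans (by positivity) hεE
  refine profile_step_near hv hκ ht hε0 hy0 (le_trans ?_
    (sub_le_shift_main_term hv hA.le (by linarith) (by linarith) hy0))
  obtain ⟨s, hs⟩ : ∃ s, s = t + 1 := ⟨_, rfl⟩
  simp only [← hs] at hεE hyt htv ⊢
  have hs0 : 0 < s := by linarith
  obtain ⟨x, hx⟩ : ∃ x, x = v * s := ⟨_, rfl⟩
  have e1 : 2 * v * s = 2 * x := by rw [hx]; ring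
  have e2 : 4 * v * s = 4 * x := by rw [hx]; ring
  rw [e1, e2]
  rw [← hx] at hyt htv
  have hx0 : 0 < x := by linarith
  set b := Real.exp (-(y ^ 2 / (2 * x))) with hb
  have hb0 : 0 < b := Real.exp_pos _
  have hb1 : b ≤ 1 := Real.exp_le_one_iff.2 (by rw [neg_nonpos]; positivity)
  have hy2 : 2 * y ≤ y ^ 2 + 1 := by nlinarith [sq_nonneg (y - 1)]
  have h1 : y * ((2 * y * ε + ε ^ 2) / (2 * x)) ≤ ε / 4 := by
    have : 2 * y ^ 2 + y * ε ≤ x / 2 := by nlinarith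
    calc _ = ε * (2 * y ^ 2 + y * ε) / (2 * x) := by ring
      _ ≤ ε * (x / 2) / (2 * x) := by gcongr
      _ = ε / 4 := by field_simp; norm_num
  have h2 : y * b * ((2 * y * ε + ε ^ 2) / (2 * x)) ≤ ε / 4 := by
    have h3 : 0 ≤ y * ((2 * y * ε + ε ^ 2) / (2 * x)) := by positivity
    calc _ = b * (y * ((2 * y * ε + ε ^ 2) / (2 * x))) := by ring
      _ ≤ 1 * (ε / 4) := by gcongr
      _ = _ := one_mul _
  have h3 : 5 / 8 ≤ Real.exp (-((y + ε) ^ 2 / (2 * x))) := by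
    have h4 := Real.add_one_le_exp (-((y + ε) ^ 2 / (2 * x)))
    have h5 : (y + ε) ^ 2 / (2 * x) ≤ 3 / 8 := by
      rw [div_le_iff₀ (by positivity)]
      nlinarith [sq_nonneg (y - ε)]
    linarith
  have h4 : (2 * y * ε + ε ^ 2) / (4 * x) ≤ ε / 6 := by
    rw [div_le_iff₀ (by positivity)]
    have : 2 * y + ε ≤ 2 * x / 3 := by nlinarith
    calc 2 * y * ε + ε ^ 2 = ε * (2 * y + ε) := by ring
      _ ≤ ε * (2 * x / 3) := by gcongr
      _ = _ := by ring
  have h5 : 3 / t ≤ 5 / s := by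
    rw [div_le_div_iff₀ (by linarith) hs0]; linarith
  have h6 : 3 * ε / 8 ≤ ε * Real.exp (-((y + ε) ^ 2 / (2 * x)))
      - y * b * ((2 * y * ε + ε ^ 2) / (2 * x)) := by
    have : ε * (5 / 8) ≤ ε * Real.exp (-((y + ε) ^ 2 / (2 * x))) := by gcongr
    linarith
  have h7 : 3 * ε / 8 ≤ qs * (ε * Real.exp (-((y + ε) ^ 2 / (2 * x)))
      - y * b * ((2 * y * ε + ε ^ 2) / (2 * x))) := by
    calc 3 * ε / 8 = 1 * (3 * ε / 8) := by ring
      _ ≤ _ := by gcongr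
  have h8 : 0 ≤ (qs - qt) * (y * b) := mul_nonneg (by linarith) (by positivity)
  calc κ * (3 / t + (2 * y * ε + ε ^ 2) / (4 * x)) ≤ κ * (5 / s + ε / 6) := by gcongr
    _ = (20 * κ) / (4 * s) + 2 * κ * ε / 12 := by field_simp; ring
    _ ≤ (A * E) / (4 * s) + A * ε / 12 := by gcongr
    _ = A / 4 * (E / s) + A * ε / 12 := by field_simp
    _ ≤ A / 4 * ε + A * ε / 12 := by gcongr
    _ ≤ A * (3 * ε / 8) := by nlinarith [mul_nonneg hA.le hε0]
    _ ≤ _ := by gcongr; linarith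

/-- For `y` of order `√t` the displacement may lower the main term, so the gain comes from the
growth `ρ` of the coefficient, multiplied by `y ≥ √(v (t + 1) / 8)` and by the lower bound `β` of
the Gaussian factor. -/
theorem profile_step_middle {v E A κ ρ β M qt qs t ε y : ℝ} (hv : 0 < v) (hE : 0 < E)
    (hA : 0 < A) (hκ : 0 < κ) (hρ : qt + ρ ≤ qs) (hρ0 : 0 ≤ ρ) (hqs : 0 ≤ qs) (hqs2 : qs ≤ 2)
    (ht : 2 ≤ t) (hε0 : 0 ≤ ε) (hεE : ε ≤ 2 * E / (t + 1))
    (hεy : ε ≤ y) (hy1 : 1 ≤ y) (hyt : v * (t + 1) / 8 ≤ y ^ 2) (hyM : y ^ 2 ≤ M * (t + 1))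
    (hβ : β = Real.exp (-(M / (2 * v))))
    (hρt : 6 * A * E * M / v + κ * (6 + 3 * M * E / v) ≤ A * β * (ρ * (t + 1) * √(v * (t + 1) / 8))) :
    A * qt * y * Real.exp (-(y ^ 2 / (2 * v * (t + 1))))
        + κ * Real.exp (3 / (2 * t)) * Real.exp (-(y ^ 2 / (2 * v * (2 * t + 1))))
      ≤ A * qs * (y + ε) * Real.exp (-((y + ε) ^ 2 / (2 * v * (t + 1))))
        + κ * Real.exp (-((y + ε) ^ 2 / (4 * v * (t + 1)))) := by
  have hy0 : 0 ≤ y := by linarith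
  refine profile_step_near hv hκ ht hε0 hy0 (le_trans ?_
    (sub_le_shift_main_term hv hA.le hqs (by linarith) hy0))
  obtain ⟨s, hs⟩ : ∃ s, s = t + 1 := ⟨_, rfl⟩
  simp only [← hs] at hεE hyt hyM hρt ⊢
  have hs0 : 0 < s := by linarith
  have hM : 0 ≤ M := by
    by_contra hM
    nlinarith [sq_nonneg y]
  set b := Real.exp (-(y ^ 2 / (2 * v * s))) with hb
  have hb0 : 0 < b := Real.exp_pos _
  have hb1 : b ≤ 1 := Real.exp_le_one_iff.2 (by rw [neg_nonpos]; positivity)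
  have hbβ : β ≤ b := by
    rw [hβ, hb, Real.exp_le_exp, neg_le_neg_iff, div_le_div_iff₀ (by positivity) (by positivity)]
    nlinarith
  have hβ0 : 0 < β := by rw [hβ]; exact Real.exp_pos _
  have h1 : y * ((2 * y * ε + ε ^ 2) / (2 * v * s)) ≤ 3 * E * M / v / s := by
    have h2 : 2 * y * ε + ε ^ 2 ≤ 3 * y * ε := by nlinarith
    calc _ ≤ y * (3 * y * ε / (2 * v * s)) := by gcongr
      _ = ε * (3 * y ^ 2) / (2 * v * s) := by ring
      _ ≤ 2 * E / s * (3 * (M * s)) / (2 * v * s) := by gcongr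
      _ = _ := by field_simp
  have h2 : (2 * y * ε + ε ^ 2) / (4 * v * s) ≤ 3 * E * M / v / s := by
    have h3 : 0 ≤ (2 * y * ε + ε ^ 2) / (2 * v * s) := by positivity
    calc (2 * y * ε + ε ^ 2) / (4 * v * s) = (2 * y * ε + ε ^ 2) / (2 * v * s) / 2 := by
          field_simp; ring
      _ ≤ y * ((2 * y * ε + ε ^ 2) / (2 * v * s)) := by nlinarith
      _ ≤ _ := h1
  have h3 : 3 / t ≤ 6 / s := by
    rw [div_le_div_iff₀ (by linarith) hs0]; linarith
  have h4 : √(v * s / 8) ≤ y := Real.sqrt_le_iff.2 ⟨hy0, hyt⟩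
  have h5 : ρ * (√(v * s / 8) * β) ≤ (qs - qt) * (y * b) := by
    have : ρ ≤ qs - qt := by linarith
    have : 0 ≤ qs - qt := by linarith
    gcongr
  have h6 : qs * (y * b * ((2 * y * ε + ε ^ 2) / (2 * v * s))) ≤ 2 * (3 * E * M / v / s) := by
    have h3 : 0 ≤ y * ((2 * y * ε + ε ^ 2) / (2 * v * s)) := by positivity
    calc _ = qs * b * (y * ((2 * y * ε + ε ^ 2) / (2 * v * s))) := by ring
      _ ≤ 2 * 1 * (3 * E * M / v / s) := by gcongr
      _ = _ := by ring
  have h7 : 0 ≤ qs * (ε * Real.exp (-((y + ε) ^ 2 / (2 * v * s)))) := by positivity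
  have h8 : (6 * A * E * M / v + κ * (6 + 3 * M * E / v)) / s ≤ A * (ρ * (√(v * s / 8) * β)) := by
    rw [div_le_iff₀ hs0]
    calc _ ≤ _ := hρt
      _ = _ := by ring
  calc κ * (3 / t + (2 * y * ε + ε ^ 2) / (4 * v * s)) ≤ κ * (6 / s + 3 * E * M / v / s) := by gcongr
    _ = (6 * A * E * M / v + κ * (6 + 3 * M * E / v)) / s - A * (2 * (3 * E * M / v / s)) := by
        field_simp; ring
    _ ≤ A * (ρ * (√(v * s / 8) * β)) - A * (2 * (3 * E * M / v / s)) := by gcongr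
    _ = A * (ρ * (√(v * s / 8) * β) - (2 * (3 * E * M / v / s))) := by ring
    _ ≤ _ := by gcongr; linarith

/-- The slowly increasing coefficient of the main term of the profile. -/
noncomputable def profileCoef (t : ℝ) : ℝ := 2 - t ^ (-(1 / 4) : ℝ)

theorem profileCoef_le_two {t : ℝ} (ht : 0 ≤ t) : profileCoef t ≤ 2 := by
  have := Real.rpow_nonneg ht (-(1 / 4) : ℝ)
  unfold profileCoef; linarith

theorem one_le_profileCoef {t : ℝ} (ht : 1 ≤ t) : 1 ≤ profileCoef t := by
  have := Real.rpow_le_one_of_one_le_of_nonpos ht (show (-(1 / 4) : ℝ) ≤ 0 by norm_num)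
  unfold profileCoef; linarith

/-- The increment is of order `t ^ (-5/4)`: summable, so the coefficient stays bounded, yet
multiplied by `y` of order `√t` it gives `t ^ (-3/4)`, which dominates the `1 / t` losses of the
middle regime. -/
theorem profileCoef_add_le {t : ℝ} (ht : 0 < t) :
    profileCoef t + 1 / 4 * ((t + 1) ^ (-(1 / 4) : ℝ) / (t + 1)) ≤ profileCoef (t + 1) := by
  have h1 : t = (t + 1) * (t / (t + 1)) := by field_simp
  have h2 : t ^ (-(1 / 4) : ℝ) = (t + 1) ^ (-(1 / 4) : ℝ) * (t / (t + 1)) ^ (-(1 / 4) : ℝ) := by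
    conv_lhs => rw [h1]
    exact Real.mul_rpow (by positivity) (by positivity)
  have h3 : 1 + 1 / 4 * (1 / (t + 1)) ≤ (t / (t + 1)) ^ (-(1 / 4) : ℝ) := by
    rw [Real.rpow_def_of_pos (by positivity)]
    have h4 := Real.log_le_sub_one_of_pos (show 0 < t / (t + 1) by positivity)
    have h5 : t / (t + 1) - 1 = -(1 / (t + 1)) := by field_simp; ring
    have h6 := Real.add_one_le_exp (Real.log (t / (t + 1)) * -(1 / 4))
    linarith
  have h4 : 0 < (t + 1) ^ (-(1 / 4) : ℝ) := Real.rpow_pos_of_pos (by positivity) _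
  have h5 := mul_le_mul_of_nonneg_left h3 h4.le
  rw [← h2] at h5
  unfold profileCoef
  have h6 : (t + 1) ^ (-(1 / 4) : ℝ) * (1 + 1 / 4 * (1 / (t + 1)))
      = (t + 1) ^ (-(1 / 4) : ℝ) + 1 / 4 * ((t + 1) ^ (-(1 / 4) : ℝ) / (t + 1)) := by ring
  linarith

-- The regimes meet at `y² = v (t + 1) / 8` and `y² = M (t + 1)`. They use respectively the
-- displacement of the linear factor, the growth of the coefficient, and the spreading of the wide
-- correction.
set_option maxHeartbeats 800000 in
theorem exists_profile_step {v E A κ : ℝ} (hv : 0 < v) (hE : 0 < E) (hκ : 0 < κ)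
    (hAE : 20 * κ ≤ A * E) (hAκ : 2 * κ ≤ A) :
    ∃ T : ℝ, 2 ≤ T ∧ ∀ t, T ≤ t → ∀ ε, E / (t + 1) ≤ ε → ε ≤ 2 * E / (t + 1) → ∀ y, 0 ≤ y →
    A * profileCoef t * y * Real.exp (-(y ^ 2 / (2 * v * (t + 1))))
        + κ * Real.exp (3 / (2 * t)) * Real.exp (-(y ^ 2 / (2 * v * (2 * t + 1))))
      ≤ A * profileCoef (t + 1) * (y + ε) * Real.exp (-((y + ε) ^ 2 / (2 * v * (t + 1))))
        + κ * Real.exp (-((y + ε) ^ 2 / (4 * v * (t + 1)))) := by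
  have hA : 0 < A := by linarith
  set X := 96 * A * E / κ with hX
  have hX0 : 0 < X := by positivity
  -- The first two terms and the last supply the three lower bounds on `y` in the far regime; the
  -- last makes the exponential there at most `exp (-X)`, and `X * exp (-X) ≤ 1`.
  obtain ⟨M, hM⟩ : ∃ M, M = 192 * v + (48 * E) ^ 2 + 1 + 8 * v * X := ⟨_, rfl⟩
  have hM0 : 0 < M := by rw [hM]; positivity
  have hM1 : 192 * v ≤ M := by
    have : 0 ≤ (48 * E) ^ 2 + 1 + 8 * v * X := by positivity
    linarith
  have hM2 : (48 * E) ^ 2 ≤ M := by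
    have : 0 ≤ 192 * v + 1 + 8 * v * X := by positivity
    linarith
  have hM3 : 8 * v * X ≤ M := by
    have : 0 ≤ 192 * v + (48 * E) ^ 2 + 1 := by positivity
    linarith
  set β := Real.exp (-(M / (2 * v))) with hβ
  have hβ0 : 0 < β := Real.exp_pos _
  set C := 6 * A * E * M / v + κ * (6 + 3 * M * E / v) with hC
  set D := A * β * (1 / 4 * √(v / 8)) with hD
  have hD0 : 0 < D := by positivity
  -- In the middle regime the scaled gain is `D * (t + 1) ^ (1/4)`, which must exceed the constant
  -- `C`.
  obtain ⟨T₁, hT₁⟩ := eventually_atTop.1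
    ((tendsto_rpow_atTop (show (0 : ℝ) < 1 / 4 by norm_num)).eventually_ge_atTop (C / D))
  refine ⟨2 + 8 / v + 2 * E + |T₁|, ?_, fun t ht ε hε1 hε2 y hy => ?_⟩
  · have := abs_nonneg T₁
    have : 0 ≤ 8 / v := by positivity
    linarith
  have h8v : 0 < 8 / v := by positivity
  have habs := abs_nonneg T₁
  have habs' := le_abs_self T₁
  have ht2 : 2 ≤ t := by linarith
  have hs0 : 0 < t + 1 := by linarith
  have hvs : 8 ≤ v * (t + 1) := by
    have : 8 / v ≤ t + 1 := by linarith
    rw [div_le_iff₀ hv] at this; linarith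
  have hε0 : 0 ≤ ε := le_trans (by positivity) hε1
  have hεle : ε ≤ 1 := hε2.trans (by rw [div_le_one hs0]; linarith)
  have hq := profileCoef_add_le (t := t) (by linarith)
  have hρ0 : 0 ≤ 1 / 4 * ((t + 1) ^ (-(1 / 4) : ℝ) / (t + 1)) := by positivity
  have hqs1 := one_le_profileCoef (t := t + 1) (by linarith)
  have hqs2 := profileCoef_le_two (t := t + 1) (by linarith)
  rcases le_total (y ^ 2) (v * (t + 1) / 8) with hy1 | hy1
  · exact profile_step_near_boundary hv hE hκ (by linarith) hqs1 ht2 hε1 hεle hy hy1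
      (by linarith) hAE hAκ
  have hy1' : 1 ≤ y := by
    by_contra h
    push Not at h
    nlinarith
  rcases le_total (y ^ 2) (M * (t + 1)) with hy2 | hy2
  · refine profile_step_middle hv hE hA hκ hq hρ0 (by linarith) hqs2 ht2 hε0 hε2 (by linarith)
      hy1' hy1 hy2 hβ ?_
    have h1 : (t + 1) ^ (-(1 / 4) : ℝ) * √(t + 1) = (t + 1) ^ (1 / 4 : ℝ) := by
      rw [Real.sqrt_eq_rpow, ← Real.rpow_add hs0]; norm_num
    have h2 : √(v * (t + 1) / 8) = √(v / 8) * √(t + 1) := by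
      rw [← Real.sqrt_mul (by positivity)]; congr 1; ring
    have h3 : 1 / 4 * ((t + 1) ^ (-(1 / 4) : ℝ) / (t + 1)) * (t + 1) * √(v * (t + 1) / 8)
        = 1 / 4 * √(v / 8) * (t + 1) ^ (1 / 4 : ℝ) := by
      rw [h2, ← h1]; field_simp
    rw [h3, ← mul_assoc]
    have h4 := hT₁ (t + 1) (by linarith)
    rw [div_le_iff₀ hD0] at h4
    rw [← hC, ← hD]
    linarith
  · have hMt : M * t ≤ y ^ 2 := by linarith
    have hy192 : 192 * v * t ≤ y ^ 2 := by
      have : 192 * v * t ≤ M * t := by gcongr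
      linarith
    have hyE : 48 * E ≤ y := by
      have h2 : (48 * E) ^ 2 ≤ y ^ 2 := by
        calc (48 * E) ^ 2 ≤ M * 1 := by linarith
          _ ≤ M * t := by gcongr; linarith
          _ ≤ y ^ 2 := hMt
      exact (sq_le_sq₀ (by positivity) hy).1 h2
    refine profile_step_far hv hE hA hκ (by linarith) (by linarith) hqs2 (by linarith) hε0 hε2
      (by linarith) (by linarith) hyE hy192 ?_
    have h1 : X ≤ y ^ 2 / (8 * v * (t + 1)) := by
      rw [le_div_iff₀ (by positivity)]
      calc X * (8 * v * (t + 1)) = 8 * v * X * (t + 1) := by ring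
        _ ≤ M * (t + 1) := by gcongr
        _ ≤ y ^ 2 := hy2
    have h2 : Real.exp (-(y ^ 2 / (8 * v * (t + 1)))) ≤ Real.exp (-X) := by
      rw [Real.exp_le_exp]; linarith
    have h3 : Real.exp (-X) * X ≤ 1 := by
      have h4 := Real.add_one_le_exp X
      have h5 := Real.exp_pos (-X)
      have h6 : Real.exp (-X) * Real.exp X = 1 := by rw [← Real.exp_add]; simp
      nlinarith
    have h4 : 96 * A * E = X * κ := by rw [hX]; field_simp
    rw [h4]
    calc _ ≤ Real.exp (-X) * (X * κ) := by gcongr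
      _ = Real.exp (-X) * X * κ := by ring
      _ ≤ 1 * κ := by gcongr
      _ = κ := one_mul κ

end Profile

/-! ### Gaussian convolutions and exponential tilting -/

section GaussianConvolution

theorem gaussianPDFReal_tilt (x c : ℝ) (v : ℝ≥0) (hv : v ≠ 0) (u : ℝ) :
    gaussianPDFReal (x + c * v) v u * Real.exp (c * (x - u))
      = Real.exp (-(c ^ 2 * v / 2)) * gaussianPDFReal x v u := by
  have hv' : (v : ℝ) ≠ 0 := by exact_mod_cast hv
  simp only [gaussianPDFReal]
  rw [mul_assoc, ← Real.exp_add, mul_left_comm, ← Real.exp_add]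
  congr 2
  field_simp
  ring

/-- Cameron–Martin: the exponential weight removes the drift `c v` per step at the price `exp (-c² v
/ 2)`. -/
theorem integral_exp_mul_gaussianReal_tilt (x c : ℝ) (v : ℝ≥0) (hv : v ≠ 0) (f : ℝ → ℝ) :
    ∫ u, Real.exp (c * (x - u)) * f u ∂(gaussianReal (x + c * v) v)
      = Real.exp (-(c ^ 2 * v / 2)) * ∫ u, f u ∂(gaussianReal x v) := by
  rw [integral_gaussianReal_eq_integral_smul hv, integral_gaussianReal_eq_integral_smul hv,
    ← integral_const_mul]
  refine integral_congr_ae (ae_of_all _ fun u => ?_)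
  simp only [smul_eq_mul]
  rw [← mul_assoc, gaussianPDFReal_tilt x c v hv u, mul_assoc]

/-- The product of a Gaussian density and a Gaussian exponential is again a Gaussian density. -/
theorem gaussianPDFReal_mul_exp (y : ℝ) (v s : ℝ≥0) (hv : v ≠ 0) (hs : s ≠ 0) (u : ℝ) :
    gaussianPDFReal y v u * Real.exp (-(u ^ 2 / (2 * s)))
      = √(s / (s + v)) * Real.exp (-(y ^ 2 / (2 * (s + v))))
        * gaussianPDFReal (y * s / (s + v)) (s * v / (s + v)) u := by
  have hv' : 0 < (v : ℝ) := by exact_mod_cast pos_iff_ne_zero.2 hv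
  have hs' : 0 < (s : ℝ) := by exact_mod_cast pos_iff_ne_zero.2 hs
  simp only [gaussianPDFReal, NNReal.coe_div, NNReal.coe_mul, NNReal.coe_add]
  have h1 : √((s : ℝ) / (s + v)) * (√(2 * Real.pi * (s * v / (s + v))))⁻¹
      = (√(2 * Real.pi * v))⁻¹ := by
    rw [← Real.sqrt_inv, ← Real.sqrt_inv, ← Real.sqrt_mul (by positivity)]
    congr 1
    field_simp
  have h2 : Real.exp (-(u - y) ^ 2 / (2 * v)) * Real.exp (-(u ^ 2 / (2 * s)))
      = Real.exp (-(y ^ 2 / (2 * (s + v))))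
        * Real.exp (-(u - y * s / (s + v)) ^ 2 / (2 * (s * v / (s + v)))) := by
    rw [← Real.exp_add, ← Real.exp_add]
    congr 1
    field_simp
    ring
  rw [mul_assoc, h2, ← h1]
  ring

theorem nnreal_mul_div_add_ne_zero {s v : ℝ≥0} (hv : v ≠ 0) (hs : s ≠ 0) :
    s * v / (s + v) ≠ 0 := by
  have : 0 < s * v / (s + v) := by
    have hv' := pos_iff_ne_zero.2 hv
    have hs' := pos_iff_ne_zero.2 hs
    positivity
  exact this.ne'

theorem integral_exp_neg_sq_gaussianReal (y : ℝ) (v s : ℝ≥0) (hv : v ≠ 0) (hs : s ≠ 0) :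
    ∫ u, Real.exp (-(u ^ 2 / (2 * s))) ∂(gaussianReal y v)
      = √(s / (s + v)) * Real.exp (-(y ^ 2 / (2 * (s + v)))) := by
  rw [integral_gaussianReal_eq_integral_smul hv]
  simp only [smul_eq_mul, gaussianPDFReal_mul_exp y v s hv hs]
  rw [integral_const_mul, integral_gaussianPDFReal_eq_one _ (nnreal_mul_div_add_ne_zero hv hs),
    mul_one]

/-- Beyond the normalization `√(s / (s + v))`, the factor `u` contributes the mean `y s / (s + v)`
of the tilted Gaussian. The total power of `s / (s + v)` is 3/2. -/
theorem integral_mul_exp_neg_sq_gaussianReal (y : ℝ) (v s : ℝ≥0) (hv : v ≠ 0) (hs : s ≠ 0) :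
    ∫ u, u * Real.exp (-(u ^ 2 / (2 * s))) ∂(gaussianReal y v)
      = √(s / (s + v)) * (s / (s + v)) * (y * Real.exp (-(y ^ 2 / (2 * (s + v))))) := by
  rw [integral_gaussianReal_eq_integral_smul hv]
  have h : ∀ u, gaussianPDFReal y v u • (u * Real.exp (-(u ^ 2 / (2 * s))))
      = (√(s / (s + v)) * Real.exp (-(y ^ 2 / (2 * (s + v)))))
        * (gaussianPDFReal (y * s / (s + v)) (s * v / (s + v)) u • u) := fun u => by
    rw [smul_eq_mul, smul_eq_mul, mul_left_comm, gaussianPDFReal_mul_exp y v s hv hs]; ring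
  simp only [h]
  rw [integral_const_mul,
    ← integral_gaussianReal_eq_integral_smul (nnreal_mul_div_add_ne_zero hv hs),
    integral_id_gaussianReal]
  ring

theorem integrable_exp_neg_sq_gaussianReal (y : ℝ) (v : ℝ≥0) {s : ℝ} (hs : 0 ≤ s) :
    Integrable (fun u => Real.exp (-(u ^ 2 / s))) (gaussianReal y v) := by
  refine (integrable_const (1 : ℝ)).mono' (by fun_prop) (ae_of_all _ fun u => ?_)
  rw [Real.norm_of_nonneg (Real.exp_nonneg _)]
  exact Real.exp_le_one_iff.2 (by rw [neg_nonpos]; positivity)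

theorem integrable_mul_exp_neg_sq_gaussianReal (y : ℝ) (v : ℝ≥0) {s : ℝ} (hs : 0 ≤ s) :
    Integrable (fun u => u * Real.exp (-(u ^ 2 / s))) (gaussianReal y v) := by
  have h : Integrable (fun u : ℝ => u) (gaussianReal y v) :=
    (memLp_id_gaussianReal 1).integrable le_rfl
  refine h.norm.mono' (by fun_prop) (ae_of_all _ fun u => ?_)
  rw [norm_mul, Real.norm_of_nonneg (Real.exp_nonneg _)]
  exact mul_le_of_le_one_right (norm_nonneg _)
    (Real.exp_le_one_iff.2 (by rw [neg_nonpos]; positivity))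

end GaussianConvolution

/-! ### The capped profile and its Gaussian averages -/

noncomputable section Barrier

/-- The Gaussian profile: a main term solving the heat equation with absorption at the origin, and
a wider correction. -/
def profile (v A κ t u : ℝ) : ℝ :=
  A * profileCoef t * u * Real.exp (-(u ^ 2 / (2 * (v * t))))
    + κ * Real.exp (-(u ^ 2 / (2 * (2 * v * t))))

/-- The profile capped by the exponential `exp (c * u)`. -/
def cappedProfile (c v A κ t u : ℝ) : ℝ :=
  if u < 0 then Real.exp (c * u) else min (Real.exp (c * u)) (profile v A κ t u)

variable {c v A κ t : ℝ}

theorem cappedProfile_le_exp (u : ℝ) : cappedProfile c v A κ t u ≤ Real.exp (c * u) := by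
  unfold cappedProfile
  split_ifs
  · exact le_rfl
  · exact min_le_left _ _

theorem profile_nonneg (hA : 0 ≤ A) (hκ : 0 ≤ κ) (ht : 1 ≤ t) {u : ℝ} (hu : 0 ≤ u) :
    0 ≤ profile v A κ t u := by
  have := one_le_profileCoef ht
  unfold profile
  positivity

theorem cappedProfile_nonneg (hA : 0 ≤ A) (hκ : 0 ≤ κ) (ht : 1 ≤ t) (u : ℝ) :
    0 ≤ cappedProfile c v A κ t u := by
  unfold cappedProfile
  split_ifs with h
  · exact Real.exp_nonneg _
  · exact le_min (Real.exp_nonneg _) (profile_nonneg hA hκ ht (not_lt.1 h))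

theorem cappedProfile_eq_exp_or (u : ℝ) : cappedProfile c v A κ t u = Real.exp (c * u) ∨
    (0 ≤ u ∧ profile v A κ t u < Real.exp (c * u)
      ∧ cappedProfile c v A κ t u = profile v A κ t u) := by
  unfold cappedProfile
  split_ifs with h
  · exact Or.inl rfl
  · rcases le_or_gt (Real.exp (c * u)) (profile v A κ t u) with h1 | h1
    · exact Or.inl (min_eq_left h1)
    · exact Or.inr ⟨not_lt.1 h, h1, min_eq_right h1.le⟩

theorem measurable_profile : Measurable (profile v A κ t) := by
  unfold profile
  fun_prop

theorem measurable_cappedProfile : Measurable (cappedProfile c v A κ t) := by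
  unfold cappedProfile
  refine Measurable.ite measurableSet_Iio (by fun_prop) ?_
  exact (by fun_prop : Measurable fun u => Real.exp (c * u)).min measurable_profile

theorem integrable_profile (y : ℝ) (w : ℝ≥0) (hv : 0 ≤ v) (ht : 0 ≤ t) :
    Integrable (profile v A κ t) (gaussianReal y w) := by
  have h1 := (integrable_mul_exp_neg_sq_gaussianReal y w
    (show 0 ≤ 2 * (v * t) by positivity)).const_mul (A * profileCoef t)
  have h2 := (integrable_exp_neg_sq_gaussianReal y w
    (show 0 ≤ 2 * (2 * v * t) by positivity)).const_mul κ
  refine (h1.add h2).congr (ae_of_all _ fun u => ?_)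
  simp only [Pi.add_apply, profile]
  ring

theorem integrable_cappedProfile (y : ℝ) (w : ℝ≥0) (hA : 0 ≤ A) (hκ : 0 ≤ κ) (ht : 1 ≤ t) :
    Integrable (cappedProfile c v A κ t) (gaussianReal y w) := by
  refine (integrable_exp_mul_gaussianReal c).mono' measurable_cappedProfile.aestronglyMeasurable
    (ae_of_all _ fun u => ?_)
  rw [Real.norm_of_nonneg (cappedProfile_nonneg hA hκ ht u)]
  exact cappedProfile_le_exp u

theorem integral_profile (y : ℝ) (v : ℝ≥0) (hv : v ≠ 0) (ht : 0 < t) :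
    ∫ u, profile v A κ t u ∂(gaussianReal y v)
      = A * profileCoef t * (√(t / (t + 1)) * (t / (t + 1))
          * (y * Real.exp (-(y ^ 2 / (2 * v * (t + 1))))))
        + κ * (√(2 * t / (2 * t + 1)) * Real.exp (-(y ^ 2 / (2 * v * (2 * t + 1))))) := by
  lift t to ℝ≥0 using ht.le
  have ht' : 0 < t := by exact_mod_cast ht
  have hv0 : 0 < v := pos_iff_ne_zero.2 hv
  have hvr : (0 : ℝ) < v := by exact_mod_cast hv0
  have h1 := integral_mul_exp_neg_sq_gaussianReal y v (v * t) hv (by positivity)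
  have h2 := integral_exp_neg_sq_gaussianReal y v (2 * v * t) hv (by positivity)
  have i1 := (integrable_mul_exp_neg_sq_gaussianReal y v
    (show 0 ≤ 2 * ((v : ℝ) * t) by positivity)).const_mul (A * profileCoef t)
  have i2 := (integrable_exp_neg_sq_gaussianReal y v
    (show 0 ≤ 2 * (2 * (v : ℝ) * t) by positivity)).const_mul κ
  simp only [profile]
  simp only [mul_assoc] at i1 i2 ⊢
  rw [integral_add i1 i2]
  simp only [integral_const_mul]
  push_cast at h1 h2
  simp only [mul_assoc] at h1 h2
  rw [h1, h2]
  have e1 : (v : ℝ) * t / (v * t + v) = t / (t + 1) := by field_simp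
  have e2 : 2 * ((v : ℝ) * t) / (2 * (v * t) + v) = 2 * t / (2 * t + 1) := by field_simp
  have e3 : (v : ℝ) * t + v = v * (t + 1) := by ring
  have e4 : 2 * ((v : ℝ) * t) + v = v * (2 * t + 1) := by ring
  rw [e1, e2, e3, e4]

/-- Capping the profile lowers its Gaussian averages at points away from the origin. -/
theorem integral_cappedProfile_le (y : ℝ) (v : ℝ≥0) (hv : v ≠ 0) (hc : 0 ≤ c) (hκ : 0 ≤ κ)
    (hA : 1 ≤ A) (hAc : 8 * Real.exp (2 * c) ≤ A) (ht : 1 ≤ t) (hvt : 8 ≤ v * t)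
    (hy : 13 * (v : ℝ) + 2 ≤ y) :
    ∫ u, cappedProfile c v A κ t u ∂(gaussianReal y v)
      ≤ ∫ u, profile v A κ t u ∂(gaussianReal y v) := by
  have hvr : (0 : ℝ) < v := by exact_mod_cast pos_iff_ne_zero.2 hv
  have im : Integrable (cappedProfile c v A κ t) (gaussianReal y v) :=
    integrable_cappedProfile y v (by linarith) hκ ht
  have ig : Integrable (profile v A κ t) (gaussianReal y v) :=
    integrable_profile y v hvr.le (by linarith)
  rw [← sub_nonneg, ← integral_sub ig im]
  have idiff := ig.sub im
  rw [integral_gaussianReal_eq_integral_smul hv]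
  set p := gaussianPDFReal y v 0 with hp
  have hp0 : 0 ≤ p := gaussianPDFReal_nonneg _ _ _
  let f : ℝ → ℝ := fun u => p * ((Set.Icc 1 2).indicator (fun _ => A / 2) u
    - (Set.Iic 0).indicator (fun u => (1 + 2 * A) * Real.exp (12 * u)) u)
  have if1 : Integrable ((Set.Icc (1 : ℝ) 2).indicator (fun _ => A / 2)) :=
    (integrable_indicator_iff measurableSet_Icc).2 (by simp)
  have if2 : Integrable ((Set.Iic (0 : ℝ)).indicator (fun u => (1 + 2 * A) * Real.exp (12 * u))) :=
    (integrable_indicator_iff measurableSet_Iic).2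
      ((integrableOn_exp_mul_Iic (by norm_num) 0).const_mul _)
  have iF : Integrable f := (if1.sub if2).const_mul p
  have hf : 0 ≤ ∫ u, f u := by
    simp only [f]
    rw [integral_const_mul, integral_sub if1 if2, integral_indicator measurableSet_Icc,
      integral_indicator measurableSet_Iic, integral_const_mul, integral_exp_mul_Iic (by norm_num)]
    refine mul_nonneg hp0 ?_
    simp
    norm_num
    linarith
  refine hf.trans (integral_mono iF ?_ fun u => ?_)
  · have := idiff
    rw [gaussianReal_of_var_ne_zero _ hv, integrable_withDensity_iff_integrable_smul'
      (measurable_gaussianPDF _ _) (ae_of_all _ fun _ => gaussianPDF_lt_top)] at this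
    simpa [toReal_gaussianPDF] using this
  · have hratio : gaussianPDFReal y v u = p * Real.exp (y * u / v - u ^ 2 / (2 * v)) := by
      rw [hp]
      simp only [gaussianPDFReal]
      rw [mul_assoc _ (Real.exp _) (Real.exp _), ← Real.exp_add]
      congr 2
      field_simp
      ring
    simp only [f, smul_eq_mul]
    rw [hratio, mul_assoc]
    refine mul_le_mul_of_nonneg_left ?_ hp0
    have hq1 := one_le_profileCoef ht
    have hq2 := profileCoef_le_two (t := t) (by linarith)
    rcases le_or_gt u 0 with hu | hu
    · rw [Set.indicator_of_notMem (by simp; intro h; linarith), Set.indicator_of_mem (by exact hu)]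
      have hm : cappedProfile c v A κ t u ≤ 1 :=
        (cappedProfile_le_exp u).trans (Real.exp_le_one_iff.2 (mul_nonpos_of_nonneg_of_nonpos hc hu))
      have hg : 2 * A * u ≤ profile v A κ t u := by
        have h1 : Real.exp (-(u ^ 2 / (2 * (v * t)))) ≤ 1 :=
          Real.exp_le_one_iff.2 (by rw [neg_nonpos]; positivity)
        have h2 : 0 ≤ κ * Real.exp (-(u ^ 2 / (2 * (2 * v * t)))) := by positivity
        have h3 : A * profileCoef t * Real.exp (-(u ^ 2 / (2 * (v * t)))) ≤ A * 2 * 1 := by gcongr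
        have h4 := mul_le_mul_of_nonpos_right h3 hu
        unfold profile
        linarith
      have h1 : 1 - u ≤ Real.exp (-u) := by linarith [Real.add_one_le_exp (-u)]
      have h2 : -((1 + 2 * A) * Real.exp (-u)) ≤ profile v A κ t u - cappedProfile c v A κ t u := by
        have : (1 + 2 * A) * (1 - u) ≤ (1 + 2 * A) * Real.exp (-u) := by gcongr
        nlinarith
      -- From `y ≥ 13 v`. One of the 13 units absorbs the linear growth of the profile, leaving `exp
      -- (12 u)`; its integral gives a loss `(1 + 2 A) / 12`, at most `A / 2`.
      have h3 : Real.exp (y * u / v - u ^ 2 / (2 * v)) ≤ Real.exp (13 * u) := by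
        rw [Real.exp_le_exp]
        have h4 : 0 ≤ u ^ 2 / (2 * v) := by positivity
        have h5 : y * u / v ≤ 13 * u := by
          rw [div_le_iff₀ hvr]
          nlinarith
        linarith
      have h4 : Real.exp (12 * u) = Real.exp (13 * u) * Real.exp (-u) := by
        rw [← Real.exp_add]; congr 1; ring
      calc 0 - (1 + 2 * A) * Real.exp (12 * u)
          = Real.exp (13 * u) * -((1 + 2 * A) * Real.exp (-u)) := by rw [h4]; ring
        _ ≤ Real.exp (y * u / v - u ^ 2 / (2 * v)) * -((1 + 2 * A) * Real.exp (-u)) :=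
            mul_le_mul_of_nonpos_right h3 (by rw [neg_nonpos]; positivity)
        _ ≤ _ := by gcongr
    · rw [Set.indicator_of_notMem (s := Set.Iic 0) (by simpa using hu), sub_zero]
      have hm : cappedProfile c v A κ t u ≤ profile v A κ t u := by
        unfold cappedProfile
        rw [if_neg (not_lt.2 hu.le)]
        exact min_le_right _ _
      by_cases hu2 : u ∈ Set.Icc (1 : ℝ) 2
      · rw [Set.indicator_of_mem hu2]
        have h1 : cappedProfile c v A κ t u ≤ A / 8 := by
          have h2 : Real.exp (c * u) ≤ Real.exp (2 * c) := by
            rw [Real.exp_le_exp]; nlinarith [hu2.2]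
          linarith [cappedProfile_le_exp (c := c) (v := v) (A := A) (κ := κ) (t := t) u]
        have h2 : 3 / 4 * A ≤ profile v A κ t u := by
          have h3 : 3 / 4 ≤ Real.exp (-(u ^ 2 / (2 * (v * t)))) := by
            have h4 : u ^ 2 / (2 * (v * t)) ≤ 1 / 4 := by
              rw [div_le_iff₀ (by positivity)]
              nlinarith [hu2.1, hu2.2]
            linarith [Real.add_one_le_exp (-(u ^ 2 / (2 * (v * t))))]
          have h4 : A * 1 * 1 * (3 / 4)
              ≤ A * profileCoef t * u * Real.exp (-(u ^ 2 / (2 * (v * t)))) := by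
            gcongr
            exact hu2.1
          have h5 : 0 ≤ κ * Real.exp (-(u ^ 2 / (2 * (2 * v * t)))) := by positivity
          unfold profile
          linarith
        have h3 : 1 ≤ Real.exp (y * u / v - u ^ 2 / (2 * v)) := by
          apply Real.one_le_exp
          have : y * u / v - u ^ 2 / (2 * v) = u * (2 * y - u) / (2 * v) := by field_simp
          rw [this]
          have : 0 ≤ 2 * y - u := by linarith [hu2.2]
          positivity
        nlinarith
      · rw [Set.indicator_of_notMem hu2]
        exact mul_nonneg (Real.exp_nonneg _) (by linarith)

end Barrier

/-! ### The displaced barrier is a supersolution -/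

noncomputable section Supersolution

/-- The logarithmic displacement `3 / (2 c) * log t` of the barrier. -/
def logShift (c t : ℝ) : ℝ := 3 / (2 * c) * Real.log t

theorem le_logShift_sub {c t : ℝ} (hc : 0 < c) (ht : 0 < t) :
    3 / (2 * c) / (t + 1) ≤ logShift c (t + 1) - logShift c t := by
  have h1 := Real.log_le_sub_one_of_pos (show 0 < t / (t + 1) by positivity)
  rw [Real.log_div (by positivity) (by positivity)] at h1
  have h5 : t / (t + 1) - 1 = -(1 / (t + 1)) := by field_simp; ring
  have h2 : 1 / (t + 1) ≤ Real.log (t + 1) - Real.log t := by linarith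
  unfold logShift
  rw [← mul_sub, div_eq_mul_one_div (3 / (2 * c))]
  gcongr

theorem logShift_sub_le {c t : ℝ} (hc : 0 < c) (ht : 0 < t) :
    logShift c (t + 1) - logShift c t ≤ 3 / (2 * c) / t := by
  have h1 := Real.log_le_sub_one_of_pos (show 0 < (t + 1) / t by positivity)
  rw [Real.log_div (by positivity) (by positivity)] at h1
  have h5 : (t + 1) / t - 1 = 1 / t := by field_simp; ring
  unfold logShift
  rw [← mul_sub, div_eq_mul_one_div (3 / (2 * c))]
  gcongr
  linarith

/-- The displacement is defined so that its exponential gain cancels exactly the decay `(t / (t +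
1)) ^ (3/2)` of the odd heat solution. -/
theorem exp_mul_logShift_sub {c t : ℝ} (hc : 0 < c) (ht : 0 < t) :
    Real.exp (c * (logShift c (t + 1) - logShift c t)) * (√(t / (t + 1)) * (t / (t + 1))) = 1 := by
  have h0 : 0 < t / (t + 1) := by positivity
  have h1 : √(t / (t + 1)) * (t / (t + 1))
      = Real.exp (3 / 2 * (Real.log t - Real.log (t + 1))) := by
    rw [← Real.log_div (by positivity) (by positivity), Real.sqrt_eq_rpow,
      Real.rpow_def_of_pos h0]
    nth_rw 2 [← Real.exp_log h0]
    rw [← Real.exp_add]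
    congr 1
    ring
  rw [h1, ← Real.exp_add, Real.exp_eq_one_iff]
  unfold logShift
  field_simp
  ring

/-- The profile exceeds the exponential near the origin. -/
theorem exp_le_profile {c v A κ t y y₁ : ℝ} (hc : 0 ≤ c) (hv : 0 < v) (hy : 0 ≤ y)
    (hyy₁ : y ≤ y₁) (hκ : 2 * Real.exp c ≤ κ) (hA : 2 * Real.exp (c * y₁) ≤ A) (hA0 : 0 < A)
    (ht : y₁ ^ 2 ≤ v * t) (ht0 : 0 ≤ t) : Real.exp (c * y) ≤ profile v A κ (t + 1) y := by
  have hκ0 : 0 < κ := lt_of_lt_of_le (by positivity) hκ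
  have hyy : y ^ 2 ≤ v * t := (pow_le_pow_left₀ hy hyy₁ 2).trans ht
  have hhalf : ∀ w, v * (t + 1) ≤ w → 1 / 2 ≤ Real.exp (-(y ^ 2 / (2 * w))) := fun w hw => by
    have h1 : y ^ 2 / (2 * w) ≤ 1 / 2 := by
      rw [div_le_iff₀ (by nlinarith)]
      nlinarith
    linarith [Real.add_one_le_exp (-(y ^ 2 / (2 * w)))]
  have h1 := hhalf (v * (t + 1)) le_rfl
  have h2 := hhalf (2 * v * (t + 1)) (by nlinarith)
  have hq := one_le_profileCoef (t := t + 1) (by linarith)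
  have g1 : 0 ≤ A * profileCoef (t + 1) * y * Real.exp (-(y ^ 2 / (2 * (v * (t + 1))))) := by
    positivity
  have g2 : 0 ≤ κ * Real.exp (-(y ^ 2 / (2 * (2 * v * (t + 1))))) := by positivity
  unfold profile
  rcases le_total y 1 with hy1 | hy1
  · have h3 : Real.exp (c * y) ≤ Real.exp c := by rw [Real.exp_le_exp]; nlinarith
    have h4 : κ * (1 / 2) ≤ κ * Real.exp (-(y ^ 2 / (2 * (2 * v * (t + 1))))) := by gcongr
    linarith
  · have h3 : Real.exp (c * y) ≤ Real.exp (c * y₁) := by rw [Real.exp_le_exp]; gcongr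
    have h4 : A * 1 * 1 * (1 / 2)
        ≤ A * profileCoef (t + 1) * y * Real.exp (-(y ^ 2 / (2 * (v * (t + 1))))) := by gcongr
    linarith

-- The inequality is needed only where the profile lies below the exponential, since elsewhere the
-- trivial bound by 1 on probabilities suffices. For large constants this forces `y` away from the
-- origin, where capping lowers the Gaussian average and `exists_profile_step` applies.
set_option maxHeartbeats 400000 in
theorem exists_supersolution_step {c : ℝ} (hc : 0 < c) (v : ℝ≥0) (hv : v ≠ 0) :
    ∃ A κ T : ℝ, 1 ≤ A ∧ 1 ≤ κ ∧ 1 ≤ T ∧ ∀ t, T ≤ t → ∀ y,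
      0 ≤ y → profile v A κ (t + 1) y < Real.exp (c * y) →
      Real.exp (c * (logShift c (t + 1) - logShift c t)) * ∫ u, cappedProfile c v A κ t u
          ∂(gaussianReal (y - (logShift c (t + 1) - logShift c t)) v)
        ≤ profile v A κ (t + 1) y := by
  have hvr : (0 : ℝ) < v := by exact_mod_cast pos_iff_ne_zero.2 hv
  obtain ⟨E, hE⟩ : ∃ E, E = 3 / (2 * c) := ⟨_, rfl⟩
  have hE0 : 0 < E := by rw [hE]; positivity
  obtain ⟨κ, hκ⟩ : ∃ κ, κ = 2 * Real.exp c := ⟨_, rfl⟩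
  have hκ2 : 2 ≤ κ := by rw [hκ]; linarith [Real.one_le_exp hc.le]
  -- One more than the threshold `13 v + 2` of `integral_cappedProfile_le`, to leave room for a
  -- displacement `ε ≤ 1`.
  obtain ⟨y₁, hy₁⟩ : ∃ y₁ : ℝ, y₁ = 13 * v + 3 := ⟨_, rfl⟩
  have hy₁0 : 0 < y₁ := by rw [hy₁]; positivity
  -- After the 1, the terms serve in turn the capping lemma, the dominance of the profile over the
  -- exponential up to `y₁`, and the two conditions on `A` in `exists_profile_step`.
  obtain ⟨A, hA⟩ : ∃ A, A = 1 + 8 * Real.exp (2 * c) + 2 * Real.exp (c * y₁) + 20 * κ / E + 2 * κ :=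
    ⟨_, rfl⟩
  have p1 : 0 ≤ 8 * Real.exp (2 * c) := by positivity
  have p2 : 0 ≤ 2 * Real.exp (c * y₁) := by positivity
  have p3 : 0 ≤ 20 * κ / E := by positivity
  have hA0 : 0 < A := by linarith
  obtain ⟨T, hT2, hT⟩ := exists_profile_step hvr hE0 (show 0 < κ by linarith)
    (show 20 * κ ≤ A * E by
      rw [← div_le_iff₀ hE0]; linarith) (show 2 * κ ≤ A by linarith)
  refine ⟨A, κ, T + 8 / v + E + y₁ ^ 2 / v, by linarith, by linarith, ?_, fun t ht y hy hlt => ?_⟩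
  · have : 0 ≤ 8 / (v : ℝ) := by positivity
    have : 0 ≤ y₁ ^ 2 / (v : ℝ) := by positivity
    linarith
  have q1 : 0 ≤ 8 / (v : ℝ) := by positivity
  have q2 : 0 ≤ y₁ ^ 2 / (v : ℝ) := by positivity
  have ht0 : 0 < t := by linarith
  have hvt : 8 ≤ v * t := by
    have : 8 / (v : ℝ) ≤ t := by linarith
    rw [div_le_iff₀ hvr] at this; linarith
  have hvy : y₁ ^ 2 ≤ v * t := by
    have : y₁ ^ 2 / (v : ℝ) ≤ t := by linarith
    rw [div_le_iff₀ hvr] at this; linarith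
  have hinv := exp_mul_logShift_sub hc ht0
  have hε1 := le_logShift_sub hc ht0
  have hε2 := logShift_sub_le hc ht0
  set ε := logShift c (t + 1) - logShift c t with hε
  rw [← hE] at hε1 hε2
  have hεle : ε ≤ 1 := hε2.trans (by rw [div_le_one ht0]; linarith)
  have hε3 : ε ≤ 2 * E / (t + 1) := by
    refine hε2.trans ?_
    rw [div_le_div_iff₀ ht0 (by positivity)]
    nlinarith
  have hylarge : y₁ ≤ y := by
    by_contra hcon
    exact absurd hlt (not_lt.2 (exp_le_profile hc.le hvr hy (not_le.1 hcon).le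
      (by linarith) (by linarith) (by linarith) hvy ht0.le))
  have hy0 : 13 * (v : ℝ) + 2 ≤ y - ε := by linarith
  have hstep := hT t (by linarith) ε hε1 hε3 (y - ε) (by linarith)
  rw [sub_add_cancel] at hstep
  calc Real.exp (c * ε) * ∫ u, cappedProfile c v A κ t u ∂(gaussianReal (y - ε) v)
      ≤ Real.exp (c * ε) * ∫ u, profile v A κ t u ∂(gaussianReal (y - ε) v) := by
        refine mul_le_mul_of_nonneg_left ?_ (Real.exp_nonneg _)
        exact integral_cappedProfile_le _ v hv hc.le (by linarith) (by linarith) (by linarith)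
          (by linarith) hvt hy0
    _ = A * profileCoef t * (y - ε) * Real.exp (-((y - ε) ^ 2 / (2 * v * (t + 1))))
        * (Real.exp (c * ε) * (√(t / (t + 1)) * (t / (t + 1))))
        + κ * (Real.exp (c * ε) * √(2 * t / (2 * t + 1)))
          * Real.exp (-((y - ε) ^ 2 / (2 * v * (2 * t + 1)))) := by
        rw [integral_profile _ v hv ht0]; ring
    _ ≤ A * profileCoef t * (y - ε) * Real.exp (-((y - ε) ^ 2 / (2 * v * (t + 1))))
        + κ * Real.exp (3 / (2 * t)) * Real.exp (-((y - ε) ^ 2 / (2 * v * (2 * t + 1)))) := by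
        rw [hinv, mul_one]
        have h1 : √(2 * t / (2 * t + 1)) ≤ 1 := by
          rw [Real.sqrt_le_one, div_le_one (by positivity)]; linarith
        have h2 : Real.exp (c * ε) ≤ Real.exp (3 / (2 * t)) := by
          rw [Real.exp_le_exp]
          calc c * ε ≤ c * (E / t) := by gcongr
            _ = 3 / (2 * t) := by rw [hE]; field_simp
        have h3 : Real.exp (c * ε) * √(2 * t / (2 * t + 1)) ≤ Real.exp (3 / (2 * t)) * 1 := by
          gcongr
        rw [mul_one] at h3
        gcongr
    _ ≤ _ := hstep
    _ = profile v A κ (t + 1) y := by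
        unfold profile
        ring_nf

end Supersolution

/-! ### The tilted recursion and its comparison with the barrier -/

noncomputable section TiltedTail

variable (C : Type) [Fintype C] (v K : ℝ≥0)

/-- The exponentially tilted tail of the maximum of the branching random walk. -/
def tiltedTail (c : ℝ) (k : ℕ) (A : Finset (Fin k → C)) (x : ℝ) : ℝ :=
  Real.exp (c * x) * brwTail C v K k A (c * k * v + x)

variable {C} {v} {K}

theorem tiltedTail_nonneg (c : ℝ) (k : ℕ) (A : Finset (Fin k → C)) (x : ℝ) :
    0 ≤ tiltedTail C v K c k A x :=
  mul_nonneg (Real.exp_nonneg _) (brwTail_nonneg C v K k A _)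

theorem tiltedTail_le_exp (c : ℝ) (k : ℕ) (A : Finset (Fin k → C)) (x : ℝ) :
    tiltedTail C v K c k A x ≤ Real.exp (c * x) :=
  mul_le_of_le_one_right (Real.exp_nonneg _) (brwTail_le_one C v K k A _)

/-- At the critical slope the tilting cost `exp (-c² v / 2)` is the reciprocal of the number of
children, so the union bound becomes an average of driftless Gaussian convolutions. -/
theorem tiltedTail_succ_le [DecidableEq C] (hv : v ≠ 0) {c : ℝ}
    (hcard : Real.exp (c ^ 2 * v / 2) = Fintype.card C) (k : ℕ) (A : Finset (Fin (k + 1) → C))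
    (x : ℝ) :
    tiltedTail C v K c (k + 1) A x
      ≤ (Fintype.card C : ℝ)⁻¹ *
        ∑ a, ∫ u, tiltedTail C v K c k (subtree A a) u ∂(gaussianReal x v) := by
  have key : ∀ a, Real.exp (c * x) * ∫ g, brwTail C v K k (subtree A a) (c * (k + 1 : ℕ) * v + x - g)
        ∂(gaussianReal 0 v)
      = (Fintype.card C : ℝ)⁻¹ * ∫ u, tiltedTail C v K c k (subtree A a) u ∂(gaussianReal x v) := by
    intro a
    have hm : Measurable fun u => brwTail C v K k (subtree A a) (c * k * v + u) :=
      (brwTail_antitone C v K k (subtree A a)).measurable.comp (measurable_const_add _)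
    have h1 : ∫ g, brwTail C v K k (subtree A a) (c * (k + 1 : ℕ) * v + x - g) ∂(gaussianReal 0 v)
        = ∫ u, brwTail C v K k (subtree A a) (c * k * v + u) ∂(gaussianReal (x + c * v) v) := by
      have h2 := gaussianReal_map_const_sub (μ := 0) (v := v) (x + c * v)
      rw [sub_zero] at h2
      rw [← h2, integral_map (by fun_prop) hm.aestronglyMeasurable]
      congr 1 with g
      congr 1
      push_cast
      ring
    rw [h1, ← integral_const_mul]
    have h3 := integral_exp_mul_gaussianReal_tilt x c v hv (tiltedTail C v K c k (subtree A a))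
    rw [Real.exp_neg, hcard] at h3
    rw [← h3]
    congr 1 with u
    unfold tiltedTail
    rw [← mul_assoc, ← Real.exp_add]
    congr 2
    ring
  calc tiltedTail C v K c (k + 1) A x
      ≤ Real.exp (c * x) * ∑ a, ∫ g, brwTail C v K k (subtree A a)
          (c * (k + 1 : ℕ) * v + x - g) ∂(gaussianReal 0 v) :=
        mul_le_mul_of_nonneg_left (brwTail_succ_le C v K k A _) (Real.exp_nonneg _)
    _ = _ := by rw [Finset.mul_sum, Finset.mul_sum]; exact Finset.sum_congr rfl fun a _ => key a

theorem gaussianReal_Ici_le {x : ℝ} (hx : 0 ≤ x) (K : ℝ≥0) (hK : K ≠ 0) :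
    (gaussianReal 0 K).real (Set.Ici x) ≤ Real.exp (-(x ^ 2 / (2 * K))) := by
  have hK' : 0 < (K : ℝ) := by exact_mod_cast pos_iff_ne_zero.2 hK
  have h := measure_ge_le_exp_mul_mgf (μ := gaussianReal 0 K) (X := fun u => u) x
    (t := x / K) (by positivity) (integrable_exp_mul_gaussianReal _)
  rw [mgf_gaussianReal (μ := 0) (v := K) (by simp), ← Real.exp_add] at h
  refine (le_of_eq rfl).trans (h.trans (le_of_eq ?_))
  congr 1
  field_simp
  ring

/-- The initial condition of the supersolution. -/
theorem exp_mul_gaussianReal_Ici_le {c A κ b t : ℝ} (hc : 0 < c) (hv : v ≠ 0) (hK : K ≠ 0)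
    (hA : 0 ≤ A) (hκ : 1 ≤ κ) (ht : 1 ≤ t) (htK : 2 * K ≤ v * t) (hbt : b ^ 2 ≤ t)
    {x : ℝ} (hY : 0 ≤ x - (c * K + 1 / (2 * c * v)) + b) :
    Real.exp (c * x) * (gaussianReal 0 K).real (Set.Ici x)
      ≤ Real.exp (c * (c * K + 1 / (2 * c * v)))
        * profile v A κ t (x - (c * K + 1 / (2 * c * v)) + b) := by
  have hK' : 0 < (K : ℝ) := by exact_mod_cast pos_iff_ne_zero.2 hK
  have hv' : 0 < (v : ℝ) := by exact_mod_cast pos_iff_ne_zero.2 hv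
  have hl : 0 ≤ c * K + 1 / (2 * c * v) := by positivity
  set Y := x - (c * K + 1 / (2 * c * v)) + b with hYdef
  have hq := one_le_profileCoef ht
  have hprof : Real.exp (-(Y ^ 2 / (2 * (2 * v * t)))) ≤ profile v A κ t Y := by
    have h1 : 0 ≤ A * profileCoef t * Y * Real.exp (-(Y ^ 2 / (2 * (v * t)))) := by positivity
    have h2 : 1 * Real.exp (-(Y ^ 2 / (2 * (2 * v * t))))
      ≤ κ * Real.exp (-(Y ^ 2 / (2 * (2 * v * t)))) := by gcongr
    unfold profile
    linarith
  -- The two parts of the displacement `l`: `c² K` pays for completing the square in `c x - x² / (4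
  -- K)`, and `1 / (2 v)` for the shift `b`, using `b² ≤ t`. The other half of the Gaussian exponent
  -- dominates that of the wide correction because `2 K ≤ v t`.
  have hce : c * (c * K + 1 / (2 * c * v)) = c ^ 2 * K + 1 / (2 * v) := by field_simp
  rw [hce]
  refine le_trans ?_ (mul_le_mul_of_nonneg_left hprof (Real.exp_nonneg _))
  rw [← Real.exp_add]
  rcases le_total x 0 with hx | hx
  · have h1 : Real.exp (c * x) * (gaussianReal 0 K).real (Set.Ici x) ≤ 1 * 1 := by
      gcongr
      · exact Real.exp_le_one_iff.2 (mul_nonpos_of_nonneg_of_nonpos hc.le hx)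
      · exact measureReal_le_one
    refine h1.trans ?_
    rw [one_mul]
    apply Real.one_le_exp
    have h2 : Y ^ 2 ≤ t := (pow_le_pow_left₀ hY (by linarith : Y ≤ b) 2).trans hbt
    have h3 : Y ^ 2 / (2 * (2 * v * t)) ≤ 1 / (2 * v) := by
      rw [div_le_div_iff₀ (by positivity) (by positivity)]
      nlinarith
    have : 0 ≤ c ^ 2 * K := by positivity
    linarith
  · refine (mul_le_mul_of_nonneg_left (gaussianReal_Ici_le hx K hK) (Real.exp_nonneg _)).trans ?_
    rw [← Real.exp_add, Real.exp_le_exp]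
    have h1 : c * x - x ^ 2 / (4 * K) ≤ c ^ 2 * K := by
      have : c ^ 2 * K - (c * x - x ^ 2 / (4 * K)) = (x - 2 * c * K) ^ 2 / (4 * K) := by
        field_simp; ring
      have : 0 ≤ (x - 2 * c * K) ^ 2 / (4 * K) := by positivity
      linarith
    have h2 : Y ^ 2 ≤ 2 * x ^ 2 + 2 * b ^ 2 := by
      have : Y ^ 2 ≤ (x + b) ^ 2 := pow_le_pow_left₀ hY (by linarith) 2
      nlinarith [sq_nonneg (x - b)]
    have h3 : Y ^ 2 / (2 * (2 * v * t)) ≤ x ^ 2 / (4 * K) + 1 / (2 * v) := by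
      calc Y ^ 2 / (2 * (2 * v * t)) ≤ (2 * x ^ 2 + 2 * t) / (2 * (2 * v * t)) := by
            gcongr; linarith
        _ = x ^ 2 / (2 * (v * t)) + 1 / (2 * v) := by field_simp
        _ ≤ x ^ 2 / (2 * (2 * K)) + 1 / (2 * v) := by gcongr
        _ = _ := by ring
    have h4 : x ^ 2 / (2 * K) = x ^ 2 / (4 * K) + x ^ 2 / (4 * K) := by field_simp; ring
    linarith

/-- Where the barrier equals its cap, the shift by `b` raises it by `exp (c b)`. This is exactly
compensated by the term `exp (-c b)` of the prefactor, whatever the set of leaves. -/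
theorem exp_le_mul_cappedProfile_of_eq {c δ b l r x m : ℝ} (hδ : 0 ≤ δ)
    (hm : m = Real.exp (c * (x + r - l + b))) :
    Real.exp (c * x) ≤ (Real.exp (-(c * b)) + δ) * Real.exp (c * (l - r)) * m := by
  have h1 : Real.exp (c * x)
      = Real.exp (-(c * b)) * Real.exp (c * (l - r)) * Real.exp (c * (x + r - l + b)) := by
    rw [← Real.exp_add, ← Real.exp_add]; congr 1; ring
  rw [h1, hm]
  gcongr
  linarith

/-- The tilted tail of the branching random walk lies below the shifted barrier. -/
theorem exists_tiltedTail_le [DecidableEq C] (hv : v ≠ 0) (hK : K ≠ 0) {c : ℝ} (hc : 0 < c)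
    (hcard : Real.exp (c ^ 2 * v / 2) = Fintype.card C) :
    ∃ A κ T l : ℝ, 1 ≤ A ∧ 1 ≤ κ ∧ 1 ≤ T ∧ 0 ≤ l ∧ ∀ b, 0 ≤ b → ∀ t, T + b ^ 2 ≤ t →
      ∀ (k : ℕ) (B : Finset (Fin k → C)) (x : ℝ),
      tiltedTail C v K c k B x
        ≤ (Real.exp (-(c * b)) + B.card / (Fintype.card C : ℝ) ^ k)
          * Real.exp (c * (l - (logShift c (k + t) - logShift c t)))
          * cappedProfile c v A κ (k + t) (x + (logShift c (k + t) - logShift c t) - l + b) := by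
  have hv' : 0 < (v : ℝ) := by exact_mod_cast pos_iff_ne_zero.2 hv
  obtain ⟨A, κ, T, hA, hκ, hT, hstep⟩ := exists_supersolution_step hc v hv
  refine ⟨A, κ, T + 2 * K / v, c * K + 1 / (2 * c * v), hA, hκ, ?_, by positivity,
    fun b hb t ht k => ?_⟩
  · have : 0 ≤ 2 * (K : ℝ) / v := by positivity
    linarith
  have hKv : 0 ≤ 2 * (K : ℝ) / v := by positivity
  have hb2 := sq_nonneg b
  have hcard0 : 0 < (Fintype.card C : ℝ) := by rw [← hcard]; exact Real.exp_pos _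
  set l := c * K + 1 / (2 * c * v) with hl
  induction k with
  | zero =>
    intro B x
    simp only [Nat.cast_zero, zero_add, sub_self, add_zero, sub_zero, pow_zero, div_one]
    rcases B.eq_empty_or_nonempty with rfl | hB
    · have h0 : brwTail C v K 0 ∅ (c * (0 : ℕ) * v + x) ≤ 0 := by
        simpa using brwTail_zero_le C v K ∅ (c * (0 : ℕ) * v + x)
      refine (mul_nonpos_of_nonneg_of_nonpos (Real.exp_nonneg _) h0).trans ?_
      have := cappedProfile_nonneg (c := c) (v := v) (t := t) (zero_le_one.trans hA)
        (zero_le_one.trans hκ) (by linarith) (x - l + b)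
      positivity
    · rcases cappedProfile_eq_exp_or (c := c) (v := v) (A := A) (κ := κ) (t := t) (x - l + b)
        with h | ⟨hY, -, h⟩
      · have := exp_le_mul_cappedProfile_of_eq (c := c) (δ := B.card) (b := b) (l := l) (r := 0)
          (x := x) (m := cappedProfile c v A κ t (x - l + b)) (by positivity) (by rw [add_zero]; exact h)
        rw [sub_zero] at this
        exact (tiltedTail_le_exp c 0 B x).trans this
      · rw [h]
        have hcardB : (B.card : ℝ) = 1 := by
          obtain ⟨a, ha⟩ := hB
          rw [Finset.card_eq_one.2
            ⟨a, Finset.eq_singleton_iff_unique_mem.2 ⟨ha, fun _ _ => Subsingleton.elim _ _⟩⟩]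
          simp
        have h1 := brwTail_zero_le C v K B x
        rw [hcardB, one_mul] at h1
        have h2 := exp_mul_gaussianReal_Ici_le (A := A) hc hv hK (zero_le_one.trans hA) hκ
          (t := t) (by linarith)
          (by
            have : 2 * (K : ℝ) / v ≤ t := by linarith
            rw [div_le_iff₀ hv'] at this
            linarith) (by linarith) hY
        have h3 := profile_nonneg (v := v) (t := t) (zero_le_one.trans hA)
          (zero_le_one.trans hκ) (by linarith) hY
        rw [hcardB]
        calc tiltedTail C v K c 0 B x = Real.exp (c * x) * brwTail C v K 0 B x := by
              simp [tiltedTail]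
          _ ≤ Real.exp (c * x) * (gaussianReal 0 K).real (Set.Ici x) := by gcongr
          _ ≤ 1 * Real.exp (c * l) * profile v A κ t (x - l + b) := by rw [one_mul]; exact h2
          _ ≤ _ := by
            gcongr
            linarith [Real.exp_pos (-(c * b))]
  | succ k ih =>
    intro B x
    obtain ⟨s, hs⟩ : ∃ s : ℝ, s = k + t := ⟨_, rfl⟩
    have hs' : ((k + 1 : ℕ) : ℝ) + t = s + 1 := by push_cast; rw [hs]; ring
    have hsT : T ≤ s := by
      have : (0 : ℝ) ≤ k := Nat.cast_nonneg k
      linarith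
    rw [hs']
    rw [← hs] at ih
    obtain ⟨r, hr⟩ : ∃ r, r = logShift c s - logShift c t := ⟨_, rfl⟩
    obtain ⟨ε, hε⟩ : ∃ ε, ε = logShift c (s + 1) - logShift c s := ⟨_, rfl⟩
    have hr' : logShift c (s + 1) - logShift c t = r + ε := by rw [hr, hε]; ring
    rw [hr']
    rw [← hr] at ih
    have hst := hstep s hsT
    rw [← hε] at hst
    -- At the cap the trivial bound suffices. Below it, the recursion, the induction hypothesis for
    -- every subtree and the supersolution inequality combine.
    rcases cappedProfile_eq_exp_or (c := c) (v := v) (A := A) (κ := κ) (t := s + 1)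
      (x + (r + ε) - l + b) with h | ⟨hY, hlt, h⟩
    · exact (tiltedTail_le_exp c _ B x).trans
        (exp_le_mul_cappedProfile_of_eq (by positivity) h)
    · rw [h]
      have hI := hst _ hY hlt
      have hbound : ∀ a, ∫ u, tiltedTail C v K c k (subtree B a) u ∂(gaussianReal x v)
          ≤ (Real.exp (-(c * b)) + (subtree B a).card / (Fintype.card C : ℝ) ^ k)
            * (Real.exp (c * (l - r)) * ∫ u, cappedProfile c v A κ s u
              ∂(gaussianReal (x + (r + ε) - l + b - ε) v)) := by
        intro a
        have e1 : x + (r + ε) - l + b - ε = x + (r - l + b) := by ring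
        have hint : Integrable (fun u => cappedProfile c v A κ s (u + (r - l + b)))
            (gaussianReal x v) := by
          have := integrable_cappedProfile (c := c) (v := v) (A := A) (κ := κ) (t := s)
            (x + (r - l + b)) v (by linarith) (by linarith) (by linarith)
          rw [← gaussianReal_map_add_const] at this
          exact (integrable_map_measure measurable_cappedProfile.aestronglyMeasurable
            (by fun_prop)).1 this
        rw [e1, ← gaussianReal_map_add_const,
          integral_map (by fun_prop) measurable_cappedProfile.aestronglyMeasurable, ← mul_assoc,
          ← integral_const_mul]
        refine integral_mono_of_nonneg (ae_of_all _ fun u => tiltedTail_nonneg c k _ u)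
          (hint.const_mul _) (ae_of_all _ fun u => ?_)
        have := ih (subtree B a) u
        have e2 : u + r - l + b = u + (r - l + b) := by ring
        rwa [e2] at this
      set I := ∫ u, cappedProfile c v A κ s u ∂(gaussianReal (x + (r + ε) - l + b - ε) v)
      refine (tiltedTail_succ_le hv hcard k B x).trans ?_
      calc (Fintype.card C : ℝ)⁻¹ *
            ∑ a, ∫ u, tiltedTail C v K c k (subtree B a) u ∂(gaussianReal x v)
          ≤ (Fintype.card C : ℝ)⁻¹ * ∑ a, (Real.exp (-(c * b))
              + (subtree B a).card / (Fintype.card C : ℝ) ^ k) * (Real.exp (c * (l - r)) * I) := by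
            gcongr with a
            exact hbound a
        _ = (Real.exp (-(c * b)) + B.card / (Fintype.card C : ℝ) ^ (k + 1))
            * (Real.exp (c * (l - r)) * I) := by
            -- The prefactor is affine in the number of leaves, and the subtrees partition the set,
            -- so averaging over children reproduces it at depth `k + 1`.
            rw [← Finset.sum_mul, Finset.sum_add_distrib, ← Finset.sum_div, ← Nat.cast_sum,
              sum_card_subtree, Finset.sum_const, Finset.card_univ, nsmul_eq_mul]
            field_simp
            ring
        _ = (Real.exp (-(c * b)) + B.card / (Fintype.card C : ℝ) ^ (k + 1))
            * Real.exp (c * (l - (r + ε))) * (Real.exp (c * ε) * I) := by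
            have : Real.exp (c * (l - r)) = Real.exp (c * (l - (r + ε))) * Real.exp (c * ε) := by
              rw [← Real.exp_add]; congr 1; ring
            rw [this]; ring
        _ ≤ _ := by gcongr

end TiltedTail

/-! ### From the tree to the box: scales, centering and density -/

section TailBounds

theorem setOf_le_maxOver {d N : ℕ} {Ω : Type*} (φ : Box d N → Ω → ℝ) (B : Finset (Box d N))
    (r : ℝ) : {ω | (r : EReal) ≤ maxOver φ B ω} = {ω | ∃ u ∈ B, r ≤ φ u ω} := by
  ext ω
  simp only [Set.mem_ofPred_eq, maxOver]
  rw [Finset.le_sup_iff (EReal.bot_lt_coe r)]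
  simp

theorem cappedProfile_le_mul_exp {c v A κ t u : ℝ} (hv : 0 < v) (hA : 0 ≤ A) (ht : 1 ≤ t)
    (hu : 0 ≤ u) :
    cappedProfile c v A κ t u ≤ (2 * A * u + κ) * Real.exp (-(u ^ 2 / (4 * v * t))) := by
  have hq := profileCoef_le_two (t := t) (by linarith)
  have h1 : cappedProfile c v A κ t u ≤ profile v A κ t u := by
    unfold cappedProfile
    rw [if_neg (not_lt.2 hu)]
    exact min_le_right _ _
  refine h1.trans ?_
  have h2 : Real.exp (-(u ^ 2 / (2 * (v * t)))) ≤ Real.exp (-(u ^ 2 / (4 * v * t))) := by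
    rw [Real.exp_le_exp, neg_le_neg_iff]
    apply div_le_div_of_nonneg_left (by positivity) (by positivity)
    nlinarith [mul_pos hv (show 0 < t by linarith)]
  have h3 : A * profileCoef t * u * Real.exp (-(u ^ 2 / (2 * (v * t))))
      ≤ A * 2 * u * Real.exp (-(u ^ 2 / (4 * v * t))) := by gcongr
  have h4 : 2 * (2 * v * t) = 4 * v * t := by ring
  unfold profile
  rw [h4]
  linarith

theorem cappedProfile_le_of_le {c v A κ t u w : ℝ} (hc : 0 ≤ c) (hv : 0 < v) (hA : 0 ≤ A)
    (hκ : 0 ≤ κ) (ht : 1 ≤ t) (hw : 0 ≤ w) (huw : u ≤ w) :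
    cappedProfile c v A κ t u ≤ 1 + 2 * A * w + κ := by
  rcases le_total u 0 with hu | hu
  · have := (cappedProfile_le_exp (c := c) (v := v) (A := A) (κ := κ) (t := t) u).trans
      (Real.exp_le_one_iff.2 (mul_nonpos_of_nonneg_of_nonpos hc hu))
    have : 0 ≤ 2 * A * w := by positivity
    linarith
  · have h1 : Real.exp (-(u ^ 2 / (4 * v * t))) ≤ 1 :=
      Real.exp_le_one_iff.2 (by rw [neg_nonpos]; positivity)
    have h2 := (cappedProfile_le_mul_exp (c := c) (κ := κ) hv hA ht hu).trans
      (mul_le_of_le_one_right (by positivity) h1)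
    have : 2 * A * u ≤ 2 * A * w := by gcongr
    linarith

/-- Dyadic scale of an integer. -/
theorem exists_dyadic_scale {N : ℕ} (hN : 2 ≤ N) : ∃ k : ℕ, N ≤ 2 ^ k ∧
    Real.log N ≤ k * Real.log 2 ∧ k * Real.log 2 ≤ Real.log N + Real.log 2 := by
  have hN0 : (0 : ℝ) < N := by exact_mod_cast (by omega : 0 < N)
  have h1 := Nat.le_pow_clog (b := 2) (by norm_num) N
  have h2 := (Nat.pow_pred_clog_lt_self (b := 2) (by norm_num) (x := N) (by omega)).le
  have h3 := Nat.clog_pos (b := 2) (by norm_num) hN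
  obtain ⟨m, hm⟩ : ∃ m, Nat.clog 2 N = m + 1 := ⟨_, (Nat.succ_pred_eq_of_pos h3).symm⟩
  rw [hm] at h1 h2
  simp only [Nat.pred_eq_sub_one, Nat.add_sub_cancel] at h2
  refine ⟨m + 1, h1, ?_, ?_⟩
  · rw [← Real.log_pow]
    exact Real.log_le_log hN0 (by exact_mod_cast h1)
  · have : (m : ℝ) * Real.log 2 ≤ Real.log N := by
      rw [← Real.log_pow]
      exact Real.log_le_log (by positivity) (by exact_mod_cast h2)
    push_cast
    linarith

theorem logShift_mul {c s t : ℝ} (hs : s ≠ 0) (ht : t ≠ 0) :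
    logShift c (s * t) = logShift c s + logShift c t := by
  unfold logShift
  rw [Real.log_mul hs ht, mul_add]

theorem logShift_mono {c s t : ℝ} (hc : 0 < c) (hs : 0 < s) (hst : s ≤ t) :
    logShift c s ≤ logShift c t := by
  unfold logShift
  gcongr

theorem logShift_nonneg {c t : ℝ} (hc : 0 < c) (ht : 1 ≤ t) : 0 ≤ logShift c t :=
  mul_nonneg (by positivity) (Real.log_nonneg ht)

/-- This is the criticality condition relating slope `√(2d)`, step variance `log 2` and `2 ^ d`
children. -/
theorem exp_sq_sqrt_two_mul_log_two (d : ℕ) :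
    Real.exp (√(2 * d) ^ 2 * Real.log 2 / 2) = Fintype.card (Fin d → Bool) := by
  rw [Real.sq_sqrt (by positivity)]
  have : 2 * (d : ℝ) * Real.log 2 / 2 = d * Real.log 2 := by ring
  rw [this, Real.exp_nat_mul, Real.exp_log (by norm_num)]
  simp

/-- Tail bound for the maximum over a set of vertices in terms of the barrier. -/
theorem exists_measureReal_exists_le (d : ℕ) (hd : 1 ≤ d) (α₀ : ℝ) (hα₀ : 0 < α₀) :
    ∃ A κ T l D₁ : ℝ, 1 ≤ A ∧ 1 ≤ κ ∧ 1 ≤ T ∧ 0 ≤ l ∧ 0 ≤ D₁ ∧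
      ∀ (N : ℕ), 2 ≤ N → ∀ (Ω : Type*) [MeasurableSpace Ω] (P : Measure Ω) [IsProbabilityMeasure P]
        (φ : Box d N → Ω → ℝ), IsCenteredGaussianField φ P → IsLogBounded α₀ φ P →
        ∀ b, 0 ≤ b → ∃ t D : ℝ, 1 ≤ t ∧ t ≤ 2 * Real.logb 2 N + (T + b ^ 2) ∧ D ≤ D₁ ∧
          -(√(2 * d) * Real.log 2 + logShift √(2 * d) (T + b ^ 2)) ≤ D ∧
          ∀ (B : Finset (Box d N)) (w : ℝ),
            P.real {ω | ((centering d N + w : ℝ) : EReal) ≤ maxOver φ B ω}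
              ≤ 2 * (Real.exp (-(√(2 * d) * b)) + B.card / Fintype.card (Box d N))
                * Real.exp (√(2 * d) * (l - D - w))
                * cappedProfile √(2 * d) (Real.log 2) A κ t (w + D - l + b) := by
  have hd0 : (1 : ℝ) ≤ d := by exact_mod_cast hd
  set c := √(2 * (d : ℝ)) with hc
  have hc0 : 0 < c := Real.sqrt_pos.2 (by positivity)
  have hlog2 : 0 < Real.log 2 := Real.log_pos (by norm_num)
  have hlog2' : Real.log 2 < 1 := by linarith [Real.log_two_lt_d9]
  have hKpos : 0 < Real.log d / 2 + 2 * α₀ := by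
    have := Real.log_nonneg hd0
    linarith
  obtain ⟨v, hv⟩ : ∃ v : ℝ≥0, (v : ℝ) = Real.log 2 := ⟨⟨_, hlog2.le⟩, rfl⟩
  obtain ⟨K, hK⟩ : ∃ K : ℝ≥0, (K : ℝ) = Real.log d / 2 + 2 * α₀ := ⟨⟨_, hKpos.le⟩, rfl⟩
  have hv0 : v ≠ 0 := by rintro rfl; simp at hv; linarith
  have hK0 : K ≠ 0 := by rintro rfl; simp at hK; linarith
  obtain ⟨A, κ, T, l, hA, hκ, hT, hl, hmain⟩ := exists_tiltedTail_le (C := Fin d → Bool) hv0 hK0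
    hc0 (by rw [hv]; exact exp_sq_sqrt_two_mul_log_two d)
  refine ⟨A, κ, T, l, logShift c (3 / Real.log 2), hA, hκ, hT, hl, logShift_nonneg hc0 ?_,
    fun N hN Ω _ P _ φ hG hL b hb => ?_⟩
  · rw [le_div_iff₀ hlog2]; linarith
  obtain ⟨k, hk1, hk2, hk3⟩ := exists_dyadic_scale hN
  have hN2 : (2 : ℝ) ≤ N := by exact_mod_cast hN
  have hlogN : Real.log 2 ≤ Real.log N := Real.log_le_log (by norm_num) hN2
  have hlogN0 : 0 < Real.log N := by linarith
  have hb2 := sq_nonneg b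
  obtain ⟨t₀, ht₀⟩ : ∃ t₀, t₀ = T + b ^ 2 := ⟨_, rfl⟩
  have ht₀1 : 1 ≤ t₀ := by linarith
  have hkR : (0 : ℝ) ≤ k := Nat.cast_nonneg k
  rw [← ht₀]
  -- The centering is `c log N - logShift c (log N)`. Since `k log 2` is within `log 2` of `log N`,
  -- the logarithmic corrections cancel, up to a bounded amount from above and up to `logShift c t₀`
  -- plus a constant from below.
  have hD : centering d N - c * k * v + (logShift c (k + t₀) - logShift c t₀)
      = c * (Real.log N - k * Real.log 2) + logShift c (k + t₀) - logShift c t₀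
        - logShift c (Real.log N) := by
    unfold centering logShift
    rw [← hc, hv]
    ring
  have hm := hmain b hb t₀ ht₀.ge k
  refine ⟨k + t₀, centering d N - c * k * v + (logShift c (k + t₀) - logShift c t₀), by linarith,
    ?_, ?_, ?_, fun B w => ?_⟩
  · have : (k : ℝ) ≤ 2 * Real.logb 2 N := by
      rw [Real.logb, mul_div_assoc', le_div_iff₀ hlog2]
      linarith
    linarith
  · rw [hD]
    have h1 : (k : ℝ) + t₀ ≤ 3 / Real.log 2 * (t₀ * Real.log N) := by
      rw [div_mul_eq_mul_div, le_div_iff₀ hlog2]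
      have h2 : Real.log N ≤ t₀ * Real.log N := by nlinarith
      have h3 : t₀ * Real.log 2 ≤ t₀ * Real.log N := by gcongr
      linarith
    have h2 := logShift_mono hc0 (by positivity) h1
    rw [logShift_mul (by positivity) (by positivity), logShift_mul (by positivity)
      (by positivity)] at h2
    have h3 : c * (Real.log N - k * Real.log 2) ≤ 0 :=
      mul_nonpos_of_nonneg_of_nonpos hc0.le (by linarith)
    linarith
  · rw [hD]
    have h1 : Real.log N ≤ k + t₀ := by nlinarith
    have h2 := logShift_mono hc0 hlogN0 h1
    have h3 : c * (-Real.log 2) ≤ c * (Real.log N - k * Real.log 2) := by gcongr; linarith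
    linarith
  · rw [setOf_le_maxOver]
    have h1 := measureReal_exists_le_le_two_mul_brwTail hd hα₀ hv hK hk1 (by omega) hG hL B
      (centering d N + w)
    refine h1.trans ?_
    obtain ⟨x, hx⟩ : ∃ x, x = centering d N + w - c * k * v := ⟨_, rfl⟩
    have h2 := hm (B.image (leaf k)) x
    have h3 : brwTail (Fin d → Bool) v K k (B.image (leaf k)) (centering d N + w)
        = Real.exp (-(c * x)) * tiltedTail (Fin d → Bool) v K c k (B.image (leaf k)) x := by
      unfold tiltedTail
      rw [← mul_assoc, ← Real.exp_add, hx]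
      simp
    have hcard : ((B.image (leaf k)).card : ℝ) / (Fintype.card (Fin d → Bool) : ℝ) ^ k
        ≤ B.card / Fintype.card (Box d N) := by
      -- There are at least as many leaves as vertices, so the density of the image among the leaves
      -- is no larger than that of `B` in the box.
      have h4 : (Fintype.card (Box d N) : ℝ) ≤ (Fintype.card (Fin d → Bool) : ℝ) ^ k := by
        simp only [Fintype.card_pi, Fintype.card_fin, Fintype.card_bool, Finset.prod_const,
          Finset.card_univ]
        rw [← Nat.cast_pow, Nat.cast_le, ← pow_mul, mul_comm, pow_mul]
        exact Nat.pow_le_pow_left hk1 d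
      have h5 : (0 : ℝ) < Fintype.card (Box d N) := by
        simp only [Fintype.card_pi, Fintype.card_fin, Finset.prod_const]
        positivity
      gcongr
      exact Finset.card_image_le
    obtain ⟨r, hr⟩ : ∃ r, r = logShift c (k + t₀) - logShift c t₀ := ⟨_, rfl⟩
    rw [← hr] at h2 ⊢
    rw [h3, mul_assoc, mul_assoc]
    have h6 : w + (centering d N - c * k * v + r) - l + b = x + r - l + b := by rw [hx]; ring
    rw [h6, ← hv]
    have h7 : l - (centering d N - c * k * v + r) - w = l - r - x := by rw [hx]; ring
    rw [h7]
    have h8 := cappedProfile_nonneg (c := c) (v := v) (t := k + t₀) (zero_le_one.trans hA)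
      (zero_le_one.trans hκ) (by linarith) (x + r - l + b)
    refine mul_le_mul_of_nonneg_left ?_ (by norm_num)
    calc Real.exp (-(c * x)) * tiltedTail (Fin d → Bool) v K c k (B.image (leaf k)) x
        ≤ Real.exp (-(c * x)) * ((Real.exp (-(c * b)) + B.card / Fintype.card (Box d N))
          * Real.exp (c * (l - r)) * cappedProfile c v A κ (k + t₀) (x + r - l + b)) := by
          refine mul_le_mul_of_nonneg_left (h2.trans ?_) (Real.exp_nonneg _)
          gcongr
      _ = _ := by
        have : Real.exp (c * (l - r - x)) = Real.exp (-(c * x)) * Real.exp (c * (l - r)) := by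
          rw [← Real.exp_add]; congr 1; ring
        rw [this]; ring

end TailBounds

/-! ### Absorbing constants and polynomial prefactors -/

section MaximumTail

/-- Absorption of the polynomial prefactor in the density of the vertex set. -/
theorem one_add_pow_mul_exp_le {c b : ℝ} (hc : 0 < c) (hb : 0 ≤ b) :
    Real.exp (-(c * b)) * (1 + b) ^ 5
      ≤ (1 + 10 / c) ^ 5 * Real.exp (-(c * b)) ^ (1 / 2 : ℝ) := by
  have h1 : 1 + b ≤ (1 + 10 / c) * Real.exp (c * b / 10) := by
    have h2 := Real.add_one_le_exp (c * b / 10)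
    have h3 : b = 10 / c * (c * b / 10) := by field_simp
    have h4 : 10 / c * (c * b / 10) ≤ 10 / c * Real.exp (c * b / 10) := by gcongr; linarith
    have h5 : 1 ≤ Real.exp (c * b / 10) := Real.one_le_exp (by positivity)
    linarith
  calc Real.exp (-(c * b)) * (1 + b) ^ 5
      ≤ Real.exp (-(c * b)) * ((1 + 10 / c) * Real.exp (c * b / 10)) ^ 5 := by gcongr
    _ = (1 + 10 / c) ^ 5 * (Real.exp (-(c * b)) * Real.exp (c * b / 10) ^ 5) := by ring
    _ = (1 + 10 / c) ^ 5 * Real.exp (-(c * b)) ^ (1 / 2 : ℝ) := by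
      rw [← Real.exp_mul, ← Real.exp_nat_mul, ← Real.exp_add]
      congr 2
      push_cast
      ring

theorem exp_mul_logShift_le_sq {c t : ℝ} (hc : 0 < c) (ht : 1 ≤ t) :
    Real.exp (c * logShift c t) ≤ t ^ 2 := by
  have h1 : t ^ 2 = Real.exp (2 * Real.log t) := by
    rw [two_mul, Real.exp_add, Real.exp_log (by linarith), sq]
  rw [h1, Real.exp_le_exp]
  have h2 := Real.log_nonneg ht
  unfold logShift
  have h3 : c * (3 / (2 * c) * Real.log t) = 3 / 2 * Real.log t := by field_simp
  linarith

/-- The barrier at height `z`, with its Gaussian decay. -/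
theorem cappedProfile_le_of_one_le {c v A κ t n τ H D₁ z u C : ℝ} (hc : 0 ≤ c) (hv : 0 < v)
    (hA : 0 ≤ A) (hκ : 0 ≤ κ) (ht : 1 ≤ t) (hn : 1 ≤ n) (hτ : 0 ≤ τ) (htn : t ≤ 2 * n + τ)
    (hD₁ : 0 ≤ D₁) (hz : 1 ≤ z) (hu1 : z - H ≤ u) (hu2 : u ≤ z + D₁) (hC0 : 0 < C)
    (hC1 : 16 * v * (2 + τ) ≤ C) (hC2 : 4 * H ^ 2 ≤ C) :
    cappedProfile c v A κ t u
      ≤ (1 + 2 * A * (1 + D₁) + κ) * z * Real.exp 1 * Real.exp (-(C⁻¹ * z ^ 2 / n)) := by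
  have hG : 1 + 2 * A * (z + D₁) + κ ≤ (1 + 2 * A * (1 + D₁) + κ) * z := by
    have h1 : 2 * A * D₁ ≤ 2 * A * D₁ * z := le_mul_of_one_le_right (by positivity) hz
    have h2 : κ ≤ κ * z := le_mul_of_one_le_right hκ hz
    linarith
  have hG0 : 0 ≤ (1 + 2 * A * (1 + D₁) + κ) * z := by positivity
  -- For bounded `z` the Gaussian factor is at least `exp (-1)`, compensated by `exp 1`. For larger
  -- `z` the argument `u` is at least `z / 2` and the Gaussian factor of the profile is used.
  rcases le_total z (2 * H) with h | h
  · have h1 : 1 ≤ Real.exp 1 * Real.exp (-(C⁻¹ * z ^ 2 / n)) := by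
      rw [← Real.exp_add]
      apply Real.one_le_exp
      have h2 : z ^ 2 ≤ C := by
        have := pow_le_pow_left₀ (by linarith) h 2
        linarith
      have h3 : C⁻¹ * z ^ 2 / n ≤ 1 := by
        rw [div_le_one (by linarith)]
        calc C⁻¹ * z ^ 2 ≤ C⁻¹ * C := by gcongr
          _ = 1 := inv_mul_cancel₀ hC0.ne'
          _ ≤ n := hn
      linarith
    have h2 := cappedProfile_le_of_le (κ := κ) hc hv hA hκ ht (by linarith : 0 ≤ z + D₁) hu2
    rw [mul_assoc _ (Real.exp 1)]
    exact (h2.trans hG).trans (le_mul_of_one_le_right hG0 h1)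
  · have hu0 : z / 2 ≤ u := by linarith
    have h1 := cappedProfile_le_mul_exp (c := c) (κ := κ) hv hA ht (by linarith : 0 ≤ u)
    have h2 : Real.exp (-(u ^ 2 / (4 * v * t))) ≤ Real.exp (-(C⁻¹ * z ^ 2 / n)) := by
      rw [Real.exp_le_exp, neg_le_neg_iff]
      have h3 : z ^ 2 ≤ 4 * u ^ 2 := by
        have := pow_le_pow_left₀ (by linarith : 0 ≤ z / 2) hu0 2
        linarith
      have h4 : 16 * v * t ≤ C * n := by
        calc 16 * v * t ≤ 16 * v * ((2 + τ) * n) := by gcongr; nlinarith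
          _ = 16 * v * (2 + τ) * n := by ring
          _ ≤ C * n := by gcongr
      calc C⁻¹ * z ^ 2 / n = z ^ 2 / (C * n) := by field_simp
        _ ≤ 4 * u ^ 2 / (16 * v * t) := by gcongr
        _ = u ^ 2 / (4 * v * t) := by field_simp; ring
    have h3 : 2 * A * u + κ ≤ (1 + 2 * A * (1 + D₁) + κ) * z := by
      have : 2 * A * u ≤ 2 * A * (z + D₁) := by gcongr
      linarith
    have h4 : 1 ≤ Real.exp 1 := Real.one_le_exp zero_le_one
    have h5 := le_mul_of_one_le_right hG0 h4
    refine h1.trans ?_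
    gcongr
    exact h3.trans h5

/-- The tail bound with a shift of the barrier, after absorbing the polynomial prefactors. -/
theorem mul_exp_mul_cappedProfile_le {c v A κ t T l D D₁ b z w δ : ℝ} (hc : 0 < c) (hv : 0 < v)
    (hA : 0 ≤ A) (hκ : 0 ≤ κ) (ht : 1 ≤ t) (hT : 1 ≤ T) (hl : 0 ≤ l) (hD₁ : 0 ≤ D₁)
    (hD : D ≤ D₁) (hD' : -(c * v + logShift c (T + b ^ 2)) ≤ D) (hb : 0 ≤ b) (hz : 1 ≤ z)
    (hw : w ≤ z) (hδ : δ = Real.exp (-(c * b))) :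
    2 * (δ + δ) * Real.exp (c * (l - D - w)) * cappedProfile c v A κ t (w + D - l + b)
      ≤ 4 * Real.exp (c * (c * v + l)) * T ^ 2 * (1 + 2 * A * (1 + D₁) + κ) * (1 + 10 / c) ^ 5
        * δ ^ (1 / 2 : ℝ) * z * Real.exp (-(c * w)) := by
  have hδ0 : 0 < δ := by rw [hδ]; exact Real.exp_pos _
  -- The displacement costs at most `(T + b²) ^ 2`, hence four powers of `1 + b`, and the capped
  -- profile costs a fifth. These five are what `one_add_pow_mul_exp_le` absorbs.
  have hT2 : T + b ^ 2 ≤ T * (1 + b) ^ 2 := by nlinarith [mul_nonneg (zero_le_one.trans hT) hb]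
  have hexp : Real.exp (c * (l - D - w))
      ≤ Real.exp (c * (c * v + l)) * (T * (1 + b) ^ 2) ^ 2 * Real.exp (-(c * w)) := by
    have h2 := exp_mul_logShift_le_sq (t := T + b ^ 2) hc (by linarith [sq_nonneg b])
    have h3 : (T + b ^ 2) ^ 2 ≤ (T * (1 + b) ^ 2) ^ 2 :=
      pow_le_pow_left₀ (by positivity) hT2 2
    calc Real.exp (c * (l - D - w))
        ≤ Real.exp (c * (c * v + l) + c * logShift c (T + b ^ 2) + -(c * w)) := by
          rw [Real.exp_le_exp]
          have : c * (l - D) ≤ c * (c * v + l + logShift c (T + b ^ 2)) := by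
            gcongr; linarith
          linarith
      _ ≤ _ := by
          rw [Real.exp_add, Real.exp_add]
          gcongr
          exact h2.trans h3
  obtain ⟨G, hG⟩ : ∃ G, G = 1 + 2 * A * (1 + D₁) + κ := ⟨_, rfl⟩
  have hG0 : 0 ≤ G := by rw [hG]; positivity
  have hcap : cappedProfile c v A κ t (w + D - l + b) ≤ G * z * (1 + b) := by
    refine (cappedProfile_le_of_le (w := z + D₁ + b) hc.le hv hA hκ ht (by linarith)
      (by linarith)).trans ?_
    have e0 : 1 ≤ z * (1 + b) := by nlinarith
    have e1 : 2 * A * D₁ ≤ 2 * A * D₁ * (z * (1 + b)) := le_mul_of_one_le_right (by positivity) e0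
    have e2 : κ ≤ κ * (z * (1 + b)) := le_mul_of_one_le_right hκ e0
    have e3 : 2 * A * (z + b) ≤ 2 * A * (z * (1 + b)) := by
      gcongr; nlinarith
    rw [hG]
    linarith
  have hcap0 := cappedProfile_nonneg (c := c) (v := v) hA hκ ht (w + D - l + b)
  have hpow := one_add_pow_mul_exp_le hc hb
  rw [← hδ] at hpow
  rw [← hG]
  calc 2 * (δ + δ) * Real.exp (c * (l - D - w)) * cappedProfile c v A κ t (w + D - l + b)
      ≤ 2 * (δ + δ) * (Real.exp (c * (c * v + l)) * (T * (1 + b) ^ 2) ^ 2 * Real.exp (-(c * w)))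
        * (G * z * (1 + b)) := by gcongr
    _ = 4 * Real.exp (c * (c * v + l)) * T ^ 2 * G * (δ * (1 + b) ^ 5)
        * z * Real.exp (-(c * w)) := by ring
    _ ≤ 4 * Real.exp (c * (c * v + l)) * T ^ 2 * G
        * ((1 + 10 / c) ^ 5 * δ ^ (1 / 2 : ℝ)) * z * Real.exp (-(c * w)) := by gcongr
    _ = _ := by ring

end MaximumTail
end LogCorrelated

/-! ### The two tail bounds -/

theorem mainTheorem4 (d : ℕ) (hd : 1 ≤ d) (α₀ : ℝ) (hα₀ : 0 < α₀) :
    ∃ C : ℝ, 0 < C ∧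
      ∀ (N : ℕ), 2 ≤ N →
      ∀ (Ω : Type*) [MeasurableSpace Ω] (P : Measure Ω) [IsProbabilityMeasure P]
        (φ : LogCorrelated.Box d N → Ω → ℝ),
        LogCorrelated.IsCenteredGaussianField φ P →
        LogCorrelated.IsLogBounded α₀ φ P →
        (∀ z : ℝ, 1 ≤ z →
          P.real {ω | ((LogCorrelated.centering d N + z : ℝ) : EReal) ≤ LogCorrelated.boxMax φ ω}
            ≤ C * z * Real.exp (-(Real.sqrt (2 * d) * z))
                * Real.exp (-(C⁻¹ * z ^ 2 / Real.logb 2 N))) ∧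
        (∀ z y : ℝ, 1 ≤ z → 0 ≤ y → ∀ A : Finset (LogCorrelated.Box d N),
          P.real {ω | ((LogCorrelated.centering d N + z - y : ℝ) : EReal)
              ≤ LogCorrelated.maxOver φ A ω}
            ≤ C * ((A.card : ℝ) / (Fintype.card (LogCorrelated.Box d N) : ℝ)) ^ (1 / 2 : ℝ)
                * z * Real.exp (-(Real.sqrt (2 * d) * (z - y)))) := by
  obtain ⟨A, κ, T, l, D₁, hA, hκ, hT, hl, hD₁, hmain⟩ :=
    LogCorrelated.exists_measureReal_exists_le d hd α₀ hα₀
  have hd0 : (1 : ℝ) ≤ d := by exact_mod_cast hd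
  set c := √(2 * (d : ℝ)) with hc
  have hc0 : 0 < c := Real.sqrt_pos.2 (by positivity)
  have hlog2 : 0 < Real.log 2 := Real.log_pos (by norm_num)
  obtain ⟨G, hG⟩ : ∃ G, G = 1 + 2 * A * (1 + D₁) + κ := ⟨_, rfl⟩
  have hG0 : 0 < G := by rw [hG]; positivity
  obtain ⟨H, hH⟩ : ∃ H, H = c * Real.log 2 + LogCorrelated.logShift c T + l := ⟨_, rfl⟩
  obtain ⟨C₁, hC₁⟩ : ∃ C₁, C₁ = 4 * Real.exp (c * H) * G * Real.exp 1 := ⟨_, rfl⟩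
  obtain ⟨C₂, hC₂⟩ : ∃ C₂, C₂ = 4 * Real.exp (c * (c * Real.log 2 + l)) * T ^ 2 * G
    * (1 + 10 / c) ^ 5 := ⟨_, rfl⟩
  have hC₁0 : 0 < C₁ := by rw [hC₁]; positivity
  have hC₂0 : 0 < C₂ := by rw [hC₂]; positivity
  have hp1 : 0 ≤ 16 * Real.log 2 * (2 + T) := by positivity
  have hp2 : 0 ≤ 4 * H ^ 2 := by positivity
  obtain ⟨C, hC⟩ : ∃ C, C = C₁ + C₂ + 16 * Real.log 2 * (2 + T) + 4 * H ^ 2 := ⟨_, rfl⟩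
  have hC0 : 0 < C := by linarith
  refine ⟨C, hC0, fun N hN Ω _ P _ φ hφ hL => ⟨fun z hz => ?_, fun z y hz hy B => ?_⟩⟩
  -- For the whole box no shift is needed: `b = 0` makes the prefactor at most 4 and keeps `t`
  -- within a constant of `2 n`, which gives the Gaussian decay.
  · obtain ⟨t, D, ht1, htn, hD, hD', hP⟩ := hmain N hN Ω P φ hφ hL 0 le_rfl
    have h0 : (T + 0 ^ 2 : ℝ) = T := by ring
    rw [h0] at htn hD'
    have hn : 1 ≤ Real.logb 2 N := by
      rw [Real.le_logb_iff_rpow_le (by norm_num) (by exact_mod_cast (by omega : 0 < N))]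
      simpa using (by exact_mod_cast hN : (2 : ℝ) ≤ N)
    have hcap := LogCorrelated.cappedProfile_le_of_one_le (c := c) (A := A) (κ := κ) (H := H)
      (u := z + D - l + 0) hc0.le hlog2 (by linarith) (by linarith) ht1 hn (by linarith) htn hD₁ hz
      (by linarith) (by linarith) hC0 (by linarith) (by linarith)
    have h1 := hP Finset.univ z
    have hfrac : ((Finset.univ : Finset (LogCorrelated.Box d N)).card : ℝ) / Fintype.card (LogCorrelated.Box d N) ≤ 1 := by
      rw [Finset.card_univ]; exact div_self_le_one _
    have hexp : Real.exp (c * (l - D - z)) ≤ Real.exp (c * H) * Real.exp (-(c * z)) := by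
      rw [← Real.exp_add, Real.exp_le_exp]
      have : c * (l - D) ≤ c * H := by gcongr; linarith
      linarith
    rw [← hG] at hcap
    refine h1.trans ?_
    calc 2 * (Real.exp (-(c * 0))
            + ((Finset.univ : Finset (LogCorrelated.Box d N)).card : ℝ) / Fintype.card (LogCorrelated.Box d N))
          * Real.exp (c * (l - D - z))
          * LogCorrelated.cappedProfile c (Real.log 2) A κ t (z + D - l + 0)
        ≤ 2 * (1 + 1) * (Real.exp (c * H) * Real.exp (-(c * z)))
          * (G * z * Real.exp 1 * Real.exp (-(C⁻¹ * z ^ 2 / Real.logb 2 N))) := by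
          have := LogCorrelated.cappedProfile_nonneg (c := c) (v := Real.log 2) (t := t)
            (zero_le_one.trans hA) (zero_le_one.trans hκ) ht1 (z + D - l + 0)
          gcongr
          simp
      _ = C₁ * z * Real.exp (-(c * z)) * Real.exp (-(C⁻¹ * z ^ 2 / Real.logb 2 N)) := by
          rw [hC₁]; ring
      _ ≤ _ := by
          gcongr
          linarith
  · rcases B.eq_empty_or_nonempty with rfl | hB
    · have : {ω | ((LogCorrelated.centering d N + z - y : ℝ) : EReal)
          ≤ LogCorrelated.maxOver φ ∅ ω} = ∅ := by
        rw [LogCorrelated.setOf_le_maxOver]; simp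
      rw [this, measureReal_empty]
      positivity
    have hcardV : (0 : ℝ) < Fintype.card (LogCorrelated.Box d N) := by
      exact_mod_cast Fintype.card_pos_iff.2 ⟨hB.choose⟩
    have hcardB : (0 : ℝ) < B.card := by exact_mod_cast hB.card_pos
    obtain ⟨δ, hδ⟩ : ∃ δ, δ = (B.card : ℝ) / Fintype.card (LogCorrelated.Box d N) := ⟨_, rfl⟩
    have hδ0 : 0 < δ := by rw [hδ]; positivity
    have hδ1 : δ ≤ 1 := by
      rw [hδ, div_le_one hcardV]
      exact_mod_cast Finset.card_le_univ B
    -- This shift balances the two terms of the prefactor: `exp (-c b)` equals the density `δ`. Its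
    -- definition requires `δ > 0`, hence the separate treatment of the empty set.
    obtain ⟨b, hb⟩ : ∃ b, b = -Real.log δ / c := ⟨_, rfl⟩
    have hb0 : 0 ≤ b := by
      rw [hb]; exact div_nonneg (neg_nonneg.2 (Real.log_nonpos hδ0.le hδ1)) hc0.le
    have hδb : δ = Real.exp (-(c * b)) := by
      rw [hb, mul_div_cancel₀ _ hc0.ne', neg_neg, Real.exp_log hδ0]
    obtain ⟨t, D, ht1, -, hD, hD', hP⟩ := hmain N hN Ω P φ hφ hL b hb0
    have h1 := hP B (z - y)
    rw [← add_sub_assoc, ← hδ] at h1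
    refine h1.trans ?_
    rw [← hδ]
    have h2 := LogCorrelated.mul_exp_mul_cappedProfile_le (A := A) (κ := κ) (w := z - y) hc0 hlog2
      (by linarith) (by linarith) ht1 hT hl hD₁ hD hD' hb0 hz (by linarith) hδb
    rw [← hδb]
    refine h2.trans ?_
    rw [← hG, ← hC₂]
    gcongr
    linarith
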